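/- **Setting.** Let $U$, $V$ be smooth manifolds of dimension $n$, $x_0\in U$, $y_0\in V$. A *setup* consists of a smooth Hausdorff manifold $M$ of dimension $1+n$ with a (geodesically) complete smooth Lorentzian metric $g$ of signature $(-,+,\dots,+)$, smooth embeddings of $U$ and of $V$ as hypersurfaces of $M$, each of them timelike or spacelike, and a lightlike geodesic $\gamma_0:[0,1]\to M$ from $x_0$ to $y_0$ which is transversal to $U$ at $x_0$ and to $V$ at $y_0$ and along which $x_0$ and $y_0$ are not conjugate (the differential of $\exp_{x_0}$ at $v_0=\dot\gamma_0(0)$ is injective). Let $v_0'$ be the orthogonal projection of $v_0$ to $T_{x_0}U$. Everything below is local: only geodesic segments $[0,1]\ni t\mapsto \exp_x(tv)$, $x\in U$, with $(x,v)$ in a small neighborhood of $(x_0,v_0)$ in $TM$ are considered, and statements near a point are statements about germs. * The *scattering relation* $\mathcal S$ is given by $\mathcal S(x,v')=(y,w')$ for $(x,v')\in TU$ in a small conic neighborhood of $(x_0,v_0')$: $v$ is the lightlike vector at $x$ with orthogonal projection $v'$ to $T_xU$ on the same side of $U$ as $v_0$, $y\in V$ is the point where the geodesic $\gamma_{x,v}$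 meets $V$, and $w'$ is the orthogonal projection to $T_yV$ of its direction there. $\mathcal S^\sharp(x,\xi')=(y,\eta')$ is the same relation on the cotangent bundles, with $\xi'=g(v',\cdot)|_{T_xU}$ and $\eta'=g(w',\cdot)|_{T_yV}$. * $\Sigma$ is the set of $(x,y)\in U\times V$ connected by a (locally) unique lightlike geodesic. A *defining function* of $\Sigma$ is a real function $r$, smooth near $(x_0,y_0)$ in $U\times V$, such that near $(x_0,y_0)$: $r=0$ and $\mathrm dr\neq0$ on $\Sigma$, and $r(x,y)<0$ if and only if the locally unique geodesic connecting $x$ and $y$ is timelike. **Statement.** Consider two setups, with metrics $g_1$ on $M_1$ and $g_2$ on $M_2$ (and the same $U,V,x_0,y_0$), with scattering relations $\mathcal S_1,\mathcal S_2$, their cotangent versions $\mathcal S_1^\sharp,\mathcal S_2^\sharp$, and sets $\Sigma_1,\Sigma_2$. 1. ($\mathcal S$ determines $r$ up to an elliptic factor.) If $\mathcal S_1=\mathcal S_2$ near the ray of $(x_0,v_0')$ (with $v_0'$ that of the first setup), and $r_1$, $r_2$ are any defining functions of $\Sigma_1$, $\Sigma_2$, respectively, then near $(x_0,y_0)$ we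 have $r_1=\kappa r_2$ with a smooth nowhere vanishing function $\kappa$. 2. ($r$ determines $\mathcal S$.) If a function $r$ is a defining function of both $\Sigma_1$ and $\Sigma_2$, then $\mathcal S_1^\sharp=\mathcal S_2^\sharp$ near the ray of $(x_0,g_1(v_0',\cdot)|_{T_{x_0}U})$; and if, in addition, $g_1$ and $g_2$ induce the same metrics on $U$ near $x_0$ and on $V$ near $y_0$, then $\mathcal S_1=\mathcal S_2$ near the ray of $(x_0,v_0')$. -/

import Mathlib

open Set Filter Topology Bundle Manifold ContDiff

noncomputable section

/-- A bilinear form has Lorentzian signature `(-,+,…,+)`: there is a vector with negative square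
whose orthogonal complement is positive definite. -/
def IsLorentzForm {E : Type*} [AddCommGroup E] [Module ℝ E] [TopologicalSpace E]
    (B : E →L[ℝ] E →L[ℝ] ℝ) : Prop :=
  ∃ τ : E, B τ τ < 0 ∧ ∀ w : E, B τ w = 0 → w ≠ 0 → 0 < B w w

/-- A bilinear form is positive definite. -/
def IsPosForm {E : Type*} [AddCommGroup E] [Module ℝ E] [TopologicalSpace E]
    (B : E →L[ℝ] E →L[ℝ] ℝ) : Prop :=
  ∀ w : E, w ≠ 0 → 0 < B w w

/-- The pullback `(a, b) ↦ B(L a, L b)` of a bilinear form by a linear map. -/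
def pullbackForm {E F : Type*} [AddCommGroup E] [Module ℝ E] [TopologicalSpace E]
    [IsTopologicalAddGroup E] [ContinuousConstSMul ℝ E]
    [AddCommGroup F] [Module ℝ F] [TopologicalSpace F]
    [IsTopologicalAddGroup F] [ContinuousConstSMul ℝ F]
    (B : F →L[ℝ] F →L[ℝ] ℝ) (L : E →L[ℝ] F) : E →L[ℝ] E →L[ℝ] ℝ :=
  (ContinuousLinearMap.precomp ℝ L).comp (B.comp L)

/-- A smooth Lorentzian metric on a manifold of dimension `n + 1`. -/
structure LorentzMetric (n : ℕ) (M : Type*) [TopologicalSpace M]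
    [ChartedSpace (EuclideanSpace ℝ (Fin (n + 1))) M] [IsManifold (𝓡 (n + 1)) ∞ M] where
  /-- the scalar product on each tangent space -/
  val (x : M) : TangentSpace (𝓡 (n + 1)) x →L[ℝ] TangentSpace (𝓡 (n + 1)) x →L[ℝ] ℝ
  symm (x : M) (v w : TangentSpace (𝓡 (n + 1)) x) : val x v w = val x w v
  lorentz (x : M) : IsLorentzForm (val x)
  contMDiff : ContMDiff (𝓡 (n + 1))
    ((𝓡 (n + 1)).prod 𝓘(ℝ, EuclideanSpace ℝ (Fin (n + 1)) →L[ℝ]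
      EuclideanSpace ℝ (Fin (n + 1)) →L[ℝ] ℝ)) ∞
    (fun x => TotalSpace.mk' (EuclideanSpace ℝ (Fin (n + 1)) →L[ℝ]
      EuclideanSpace ℝ (Fin (n + 1)) →L[ℝ] ℝ) x (val x))

/-- The velocity curve `t ↦ (γ t, γ' t)` in the tangent bundle. -/
def velocity {m : ℕ} {M : Type*} [TopologicalSpace M]
    [ChartedSpace (EuclideanSpace ℝ (Fin m)) M] [IsManifold (𝓡 m) ∞ M]
    (γ : ℝ → M) (t : ℝ) : TangentBundle (𝓡 m) M :=
  ⟨γ t, mfderiv 𝓘(ℝ, ℝ) (𝓡 m) γ t (1 : ℝ)⟩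

namespace LorentzMetric

variable {n : ℕ} {M : Type*} [TopologicalSpace M]
  [ChartedSpace (EuclideanSpace ℝ (Fin (n + 1))) M] [IsManifold (𝓡 (n + 1)) ∞ M]

/-- A lightlike (null) tangent vector: a nonzero vector of square zero. -/
def IsNull (g : LorentzMetric n M) {x : M} (v : TangentSpace (𝓡 (n + 1)) x) : Prop :=
  v ≠ 0 ∧ g.val x v v = 0

/-- The metric written in the chart at `p`, a function `u ↦ (g_ij(u))` of the coordinates. -/
def inChart (g : LorentzMetric n M) (p : M) (u : EuclideanSpace ℝ (Fin (n + 1))) :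
    EuclideanSpace ℝ (Fin (n + 1)) →L[ℝ] EuclideanSpace ℝ (Fin (n + 1)) →L[ℝ] ℝ :=
  pullbackForm (g.val ((extChartAt (𝓡 (n + 1)) p).symm u))
    (mfderiv 𝓘(ℝ, EuclideanSpace ℝ (Fin (n + 1))) (𝓡 (n + 1)) (extChartAt (𝓡 (n + 1)) p).symm u)

/-- Christoffel symbols of the first kind in the chart at `p`:
`Γ(a,b;c) = ½ (∂_a g(b,c) + ∂_b g(a,c) - ∂_c g(a,b))`. -/
def christoffel (g : LorentzMetric n M) (p : M) (u a b c : EuclideanSpace ℝ (Fin (n + 1))) : ℝ :=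
  (1 / 2) * (fderiv ℝ (g.inChart p) u a b c + fderiv ℝ (g.inChart p) u b a c
    - fderiv ℝ (g.inChart p) u c a b)

/-- Affinely parametrized geodesics `γ : ℝ → M`: smooth curves whose coordinate representation `c`
in each chart satisfies the geodesic equation `g(c'', w) + Γ(c', c'; w) = 0` for all `w`, that is,
`c''ᵏ + Γᵏ_ij c'ⁱ c'ʲ = 0` with the index `k` lowered. -/
def IsGeodesic (g : LorentzMetric n M) (γ : ℝ → M) : Prop :=
  ContMDiff 𝓘(ℝ, ℝ) (𝓡 (n + 1)) ∞ γ ∧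
  ∀ (p : M) (t : ℝ), γ t ∈ (chartAt (EuclideanSpace ℝ (Fin (n + 1))) p).source →
    ∀ w : EuclideanSpace ℝ (Fin (n + 1)),
      let c : ℝ → EuclideanSpace ℝ (Fin (n + 1)) := fun s => extChartAt (𝓡 (n + 1)) p (γ s)
      g.inChart p (c t) (deriv (deriv c) t) w
        + g.christoffel p (c t) (deriv c t) (deriv c t) w = 0

/-- Geodesic completeness: each initial condition is that of a geodesic defined on all of `ℝ`. -/
def IsComplete (g : LorentzMetric n M) : Prop :=
  ∀ q : TangentBundle (𝓡 (n + 1)) M, ∃ γ : ℝ → M, g.IsGeodesic γ ∧ velocity γ 0 = q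

open Classical in
/-- The geodesic `γ_{x,v}` with initial condition `q = (x, v)`. (It exists when `g` is complete and
is unique when `M` is Hausdorff.) -/
def geodesic (g : LorentzMetric n M) (q : TangentBundle (𝓡 (n + 1)) M) : ℝ → M :=
  if h : ∃ γ : ℝ → M, g.IsGeodesic γ ∧ velocity γ 0 = q then h.choose else fun _ => q.1

/-- The geodesic flow `(x, v) ↦ (γ_{x,v}(t), γ_{x,v}'(t))`. -/
def flow (g : LorentzMetric n M) (t : ℝ) (q : TangentBundle (𝓡 (n + 1)) M) :
    TangentBundle (𝓡 (n + 1)) M :=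
  velocity (g.geodesic q) t

/-- The exponential map `v ↦ exp_x v = γ_{x,v}(1)`. -/
def exp (g : LorentzMetric n M) (x : M) (v : TangentSpace (𝓡 (n + 1)) x) : M :=
  g.geodesic ⟨x, v⟩ 1

/-- `x` and `exp_x v` are not conjugate along `t ↦ exp_x (t v)`: the differential of `exp_x` at `v`
is injective. -/
def NotConjugate (g : LorentzMetric n M) (x : M) (v : TangentSpace (𝓡 (n + 1)) x) : Prop :=
  Function.Injective
    (mfderiv 𝓘(ℝ, EuclideanSpace ℝ (Fin (n + 1))) (𝓡 (n + 1))
      (fun u : EuclideanSpace ℝ (Fin (n + 1)) => g.exp x u) v)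

variable {U : Type*} [TopologicalSpace U]
  [ChartedSpace (EuclideanSpace ℝ (Fin n)) U] [IsManifold (𝓡 n) ∞ U]

/-- The metric `ι^* g` induced on the hypersurface `ι : U → M`. -/
def induced (g : LorentzMetric n M) (ι : U → M) (x : U) :
    TangentSpace (𝓡 n) x →L[ℝ] TangentSpace (𝓡 n) x →L[ℝ] ℝ :=
  pullbackForm (g.val (ι x)) (mfderiv (𝓡 n) (𝓡 (n + 1)) ι x)

/-- `ι : U → M` is a timelike hypersurface (Lorentzian induced metric) or a spacelike hypersurface
(positive definite induced metric). -/
def TimelikeOrSpacelike (g : LorentzMetric n M) (ι : U → M) : Prop :=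
  (∀ x : U, IsLorentzForm (g.induced ι x)) ∨ (∀ x : U, IsPosForm (g.induced ι x))

/-- `v'` is the orthogonal projection of `v ∈ T_{ι x} M` to the tangent space of the hypersurface:
`v - dι(v')` is orthogonal to the hypersurface. -/
def IsTangentialProj (g : LorentzMetric n M) (ι : U → M) (x : U)
    (v : TangentSpace (𝓡 (n + 1)) (ι x)) (v' : TangentSpace (𝓡 n) x) : Prop :=
  ∀ a : TangentSpace (𝓡 n) x,
    g.val (ι x) (v - mfderiv (𝓡 n) (𝓡 (n + 1)) ι x v') (mfderiv (𝓡 n) (𝓡 (n + 1)) ι x a) = 0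

end LorentzMetric

/-- Two hypersurfaces `U`, `V`, each timelike or spacelike, in a complete Lorentzian manifold `M`,
and a lightlike geodesic `γ₀ : [0,1] → M` from `x₀ ∈ U` to `y₀ ∈ V`, transversal to `U` at `x₀` and
to `V` at `y₀`, along which `x₀` and `y₀` are not conjugate. -/
structure LightRaySetup (n : ℕ) (U V M : Type*)
    [TopologicalSpace U] [ChartedSpace (EuclideanSpace ℝ (Fin n)) U] [IsManifold (𝓡 n) ∞ U]
    [TopologicalSpace V] [ChartedSpace (EuclideanSpace ℝ (Fin n)) V] [IsManifold (𝓡 n) ∞ V]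
    [TopologicalSpace M] [ChartedSpace (EuclideanSpace ℝ (Fin (n + 1))) M]
    [IsManifold (𝓡 (n + 1)) ∞ M] (x₀ : U) (y₀ : V) where
  g : LorentzMetric n M
  complete : g.IsComplete
  ιU : U → M
  ιV : V → M
  embU : IsSmoothEmbedding (𝓡 n) (𝓡 (n + 1)) ∞ ιU
  embV : IsSmoothEmbedding (𝓡 n) (𝓡 (n + 1)) ∞ ιV
  causalU : g.TimelikeOrSpacelike ιU
  causalV : g.TimelikeOrSpacelike ιV
  /-- `v₀ = γ₀'(0)` -/
  v₀ : TangentSpace (𝓡 (n + 1)) (ιU x₀)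
  /-- `w₀ = γ₀'(1)` -/
  w₀ : TangentSpace (𝓡 (n + 1)) (ιV y₀)
  /-- the orthogonal projection of `v₀` to the tangent space of `U` -/
  v₀' : TangentSpace (𝓡 n) x₀
  null : g.IsNull v₀
  reach : g.flow 1 ⟨ιU x₀, v₀⟩ = ⟨ιV y₀, w₀⟩
  proj : g.IsTangentialProj ιU x₀ v₀ v₀'
  transversalU : v₀ ∉ range (mfderiv (𝓡 n) (𝓡 (n + 1)) ιU x₀)
  transversalV : w₀ ∉ range (mfderiv (𝓡 n) (𝓡 (n + 1)) ιV y₀)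
  notConjugate : g.NotConjugate (ιU x₀) v₀

/-- The total space of the cotangent bundle of an `n`-manifold. -/
abbrev CotangentBundle (n : ℕ) (U : Type*) [TopologicalSpace U]
    [ChartedSpace (EuclideanSpace ℝ (Fin n)) U] [IsManifold (𝓡 n) ∞ U] : Type _ :=
  TotalSpace (EuclideanSpace ℝ (Fin n) →L[ℝ] ℝ) (fun x : U => TangentSpace (𝓡 n) x →L[ℝ] ℝ)

namespace LightRaySetup

variable {n : ℕ} {U V M : Type*}
  [TopologicalSpace U] [ChartedSpace (EuclideanSpace ℝ (Fin n)) U] [IsManifold (𝓡 n) ∞ U]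
  [TopologicalSpace V] [ChartedSpace (EuclideanSpace ℝ (Fin n)) V] [IsManifold (𝓡 n) ∞ V]
  [TopologicalSpace M] [ChartedSpace (EuclideanSpace ℝ (Fin (n + 1))) M]
  [IsManifold (𝓡 (n + 1)) ∞ M] {x₀ : U} {y₀ : V}

/-- The initial condition `(x₀, v₀)` of the reference light ray. All objects below are local: they
only involve geodesics `[0,1] → M` with initial condition in a small neighborhood `W` of it. -/
def base (C : LightRaySetup n U V M x₀ y₀) : TangentBundle (𝓡 (n + 1)) M := ⟨C.ιU x₀, C.v₀⟩

/-- `t ↦ exp_x (t v)`, `0 ≤ t ≤ 1`, is a geodesic from `x ∈ U` to `y ∈ V`, with initial condition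
in `W`. -/
def Connects (C : LightRaySetup n U V M x₀ y₀) (W : Set (TangentBundle (𝓡 (n + 1)) M))
    (x : U) (y : V) (v : TangentSpace (𝓡 (n + 1)) (C.ιU x)) : Prop :=
  (⟨C.ιU x, v⟩ : TangentBundle (𝓡 (n + 1)) M) ∈ W ∧ C.g.exp (C.ιU x) v = C.ιV y

/-- The set `Σ ⊆ U × V` of pairs connected by a (locally) unique lightlike geodesic. -/
def lightPairs (C : LightRaySetup n U V M x₀ y₀) (W : Set (TangentBundle (𝓡 (n + 1)) M)) :
    Set (U × V) :=
  {p | ∃! v : TangentSpace (𝓡 (n + 1)) (C.ιU p.1), C.Connects W p.1 p.2 v ∧ C.g.IsNull v}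

/-- The pairs for which the (locally) unique geodesic connecting them is timelike. -/
def timelikePairs (C : LightRaySetup n U V M x₀ y₀) (W : Set (TangentBundle (𝓡 (n + 1)) M)) :
    Set (U × V) :=
  {p | ∃ v : TangentSpace (𝓡 (n + 1)) (C.ιU p.1), C.Connects W p.1 p.2 v ∧
    (∀ u : TangentSpace (𝓡 (n + 1)) (C.ιU p.1), C.Connects W p.1 p.2 u → u = v) ∧
    C.g.val (C.ιU p.1) v v < 0}

/-- `r` is, near `(x₀, y₀)`, a defining function of `Σ`: it is smooth, `r = 0` and `dr ≠ 0` on `Σ`,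
and `r < 0` exactly at the pairs connected by a timelike geodesic. -/
def IsDefiningFunction (C : LightRaySetup n U V M x₀ y₀) (r : U × V → ℝ) : Prop :=
  (∀ᶠ p in 𝓝 (x₀, y₀), ContMDiffAt ((𝓡 n).prod (𝓡 n)) 𝓘(ℝ, ℝ) ∞ r p) ∧
  ∃ N ∈ 𝓝 C.base, ∀ W ∈ 𝓝 C.base, W ⊆ N → ∀ᶠ p in 𝓝 (x₀, y₀),
    (p ∈ C.lightPairs W → r p = 0 ∧ mfderiv ((𝓡 n).prod (𝓡 n)) 𝓘(ℝ, ℝ) r p ≠ 0) ∧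
    (r p < 0 ↔ p ∈ C.timelikePairs W)

/-- The scattering relation `S(x, v') = (y, w')`, as a relation between `z = (x, v')` and
`z' = (y, w')`: `v'` is the projection of a lightlike vector `v` at `x`, the geodesic `γ_{x,v}`
meets `V` at `y = γ_{x,v}(s)`, `s > 0`, in the direction `w`, and `w'` is the projection of `w`. The
condition that `(x, s v)`, the initial condition of that geodesic segment reparametrized over
`[0,1]`, lies in `W` makes `S` local; in particular it selects, of the two lightlike lifts of `v'`,
the one on the side of `v₀`. The relation is invariant under `(v', w') ↦ (a v', a w')`, `a > 0`. -/
def Scattering (C : LightRaySetup n U V M x₀ y₀) (W : Set (TangentBundle (𝓡 (n + 1)) M))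
    (z : TangentBundle (𝓡 n) U) (z' : TangentBundle (𝓡 n) V) : Prop :=
  ∃ (v : TangentSpace (𝓡 (n + 1)) (C.ιU z.1)) (w : TangentSpace (𝓡 (n + 1)) (C.ιV z'.1)) (s : ℝ),
    0 < s ∧ (⟨C.ιU z.1, s • v⟩ : TangentBundle (𝓡 (n + 1)) M) ∈ W ∧ C.g.IsNull v ∧
    C.g.IsTangentialProj C.ιU z.1 v z.2 ∧
    C.g.flow s ⟨C.ιU z.1, v⟩ = ⟨C.ιV z'.1, w⟩ ∧
    C.g.IsTangentialProj C.ιV z'.1 w z'.2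

/-- The scattering relation on the cotangent bundles, `S^♯(x, ξ') = (y, η')`: the vectors `v'`, `w'`
are replaced by the covectors `ξ' = g(v', ·)`, `η' = g(w', ·)` on the hypersurfaces. -/
def ScatteringSharp (C : LightRaySetup n U V M x₀ y₀) (W : Set (TangentBundle (𝓡 (n + 1)) M))
    (z : CotangentBundle n U) (z' : CotangentBundle n V) : Prop :=
  ∃ (v' : TangentSpace (𝓡 n) z.1) (w' : TangentSpace (𝓡 n) z'.1),
    C.g.induced C.ιU z.1 v' = z.2 ∧ C.g.induced C.ιV z'.1 w' = z'.2 ∧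
    C.Scattering W ⟨z.1, v'⟩ ⟨z'.1, w'⟩

end LightRaySetup

section TwoSetups

variable {n : ℕ} {U V M₁ M₂ : Type*}
  [TopologicalSpace U] [ChartedSpace (EuclideanSpace ℝ (Fin n)) U] [IsManifold (𝓡 n) ∞ U]
  [TopologicalSpace V] [ChartedSpace (EuclideanSpace ℝ (Fin n)) V] [IsManifold (𝓡 n) ∞ V]
  [TopologicalSpace M₁] [ChartedSpace (EuclideanSpace ℝ (Fin (n + 1))) M₁]
  [IsManifold (𝓡 (n + 1)) ∞ M₁]
  [TopologicalSpace M₂] [ChartedSpace (EuclideanSpace ℝ (Fin (n + 1))) M₂]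
  [IsManifold (𝓡 (n + 1)) ∞ M₂] {x₀ : U} {y₀ : V}

/-- The two (local) scattering relations agree near `(x₀, v₀')`; by homogeneity, they then agree on
a conic neighborhood of `(x₀, v₀')`. -/
def SameScattering (C₁ : LightRaySetup n U V M₁ x₀ y₀) (C₂ : LightRaySetup n U V M₂ x₀ y₀) :
    Prop :=
  ∃ N₁ ∈ 𝓝 C₁.base, ∃ N₂ ∈ 𝓝 C₂.base, ∀ W₁ ∈ 𝓝 C₁.base, ∀ W₂ ∈ 𝓝 C₂.base,
    W₁ ⊆ N₁ → W₂ ⊆ N₂ →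
    ∀ᶠ z in 𝓝 (⟨x₀, C₁.v₀'⟩ : TangentBundle (𝓡 n) U), ∀ z' : TangentBundle (𝓡 n) V,
      C₁.Scattering W₁ z z' ↔ C₂.Scattering W₂ z z'

/-- The two (local) scattering relations on the cotangent bundles agree near `(x₀, g(v₀', ·))`. -/
def SameScatteringSharp (C₁ : LightRaySetup n U V M₁ x₀ y₀)
    (C₂ : LightRaySetup n U V M₂ x₀ y₀) : Prop :=
  ∃ N₁ ∈ 𝓝 C₁.base, ∃ N₂ ∈ 𝓝 C₂.base, ∀ W₁ ∈ 𝓝 C₁.base, ∀ W₂ ∈ 𝓝 C₂.base,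
    W₁ ⊆ N₁ → W₂ ⊆ N₂ →
    ∀ᶠ z in 𝓝 (⟨x₀, C₁.g.induced C₁.ιU x₀ C₁.v₀'⟩ : CotangentBundle n U),
      ∀ z' : CotangentBundle n V,
        C₁.ScatteringSharp W₁ z z' ↔ C₂.ScatteringSharp W₂ z z'

/-- The two metrics induce the same metric on `U` near `x₀` and on `V` near `y₀`. -/
def SameInduced (C₁ : LightRaySetup n U V M₁ x₀ y₀) (C₂ : LightRaySetup n U V M₂ x₀ y₀) : Prop :=
  (∀ᶠ x in 𝓝 x₀, C₁.g.induced C₁.ιU x = C₂.g.induced C₂.ιU x) ∧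
  (∀ᶠ y in 𝓝 y₀, C₁.g.induced C₁.ιV y = C₂.g.induced C₂.ιV y)

end TwoSetups

end

/-!
The proof rests on the *world function* `ρ(x, y) = g(v, v)`, where `exp_x v = y` is the geodesic
from `x ∈ U` to `y ∈ V` close to the reference light ray. Since `x₀` and `y₀` are not conjugate, the
implicit function theorem shows that this geodesic exists, is locally unique and depends
differentiably on `(x, y)` (`LightRaySetup.exists_isWorldFunction`). If `v` and `w` are its initial
and final velocities, the first variation formula reads
`dρ(α, β) = 2 (g(w, β) - g(v, α))`, so on `Σ = {ρ = 0}` the differential of `ρ` records the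
covectors that the light ray induces on the two hypersurfaces. It does not vanish there, because a
lightlike vector is never orthogonal to a timelike or spacelike hypersurface. The formula is a
property of the geodesic flow, proved for small times from the differentiable dependence of ODE
solutions on their initial value and continued to all times along each geodesic
(`LorentzMetric.IsComplete.flowRegularAt`).

Pairs joined by a lightlike or timelike geodesic are those with `ρ = 0` or `ρ < 0`. Hence a defining
function `r` has the same zeros as `ρ`, and on `Σ` its differential is a positive multiple of `dρ`,
as `r` and `ρ` are negative at the same points (`LightRaySetup.IsDefiningFunction.compare`).

The scattering relation tells which pairs are joined by a light ray near the reference one, hence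
determines `Σ`: lifting each pair on `Σ₁` to the projected initial velocity of its ray, a vector
close to `v₀'`, shows that `ρ₂ = 0` on `Σ₁` (`LightRaySetup.SameScattering.eq_zero`). Two smooth
functions, the first vanishing where the second does, with nonzero differentials at a common zero,
differ by a smooth nonvanishing factor (`exists_smooth_quotient`).

Conversely, for a common defining function, `dρ₁` is a positive multiple of `dρ₂` on `Σ₁ = Σ₂`, so
that, after rescaling, the rays of the two setups joining the same points induce the same covectors
on `U` and `V` (`LightRaySetup.IsWorldFunction.exists_isLightRay`). It remains to know that a ray
whose initial covector is close to the reference one ends close to `y₀`, where this comparison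
applies. The neighborhood in which the ray lies is fixed beforehand, so this is not automatic: it
holds because, by transversality, the linearized equations of a light ray with given initial
covector are injective at the reference ray
(`LightRaySetup.exists_nhds_isLightRay_mem`). If the induced metrics agree, they identify tangent
vectors of the hypersurfaces with covectors in the same way, and the relations of vectors agree too.
-/

noncomputable section

/-! ### Dependence of ODE solutions on the initial value -/

theorem dist_le_gronwallBound_of_nonneg {F : Type*} [NormedAddCommGroup F] [NormedSpace ℝ F]
    {f : F → F} {S : Set F} {K : NNReal} (hf : LipschitzOnWith K f S) {ε δ : ℝ}
    {u v v' : ℝ → F}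
    (hu : ∀ t ∈ Ioo (-ε) ε, HasDerivAt u (f (u t)) t ∧ u t ∈ S)
    (hv : ∀ t ∈ Ioo (-ε) ε, HasDerivAt v (v' t) t ∧ v t ∈ S)
    (hδ : ∀ t ∈ Ioo (-ε) ε, dist (v' t) (f (v t)) ≤ δ) (h0 : u 0 = v 0)
    {t : ℝ} (ht0 : 0 ≤ t) (ht : t < ε) :
    dist (u t) (v t) ≤ gronwallBound 0 K δ t := by
  have hsub : Icc 0 t ⊆ Ioo (-ε) ε := fun s hs => ⟨by linarith [hs.1], by linarith [hs.2]⟩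
  have hsub' : Ico 0 t ⊆ Ioo (-ε) ε := Ico_subset_Icc_self.trans hsub
  have := dist_le_of_approx_trajectories_ODE_of_mem (v := fun _ => f) (s := fun _ => S)
    (f := u) (g := v) (f' := fun s => f (u s)) (g' := v') (a := 0) (b := t) (δ := 0) (εf := 0)
    (εg := δ) (fun _ _ => hf)
    (fun s hs => (hu s (hsub hs)).1.continuousAt.continuousWithinAt)
    (fun s hs => (hu s (hsub' hs)).1.hasDerivWithinAt)
    (fun s _ => by simp) (fun s hs => (hu s (hsub' hs)).2)
    (fun s hs => (hv s (hsub hs)).1.continuousAt.continuousWithinAt)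
    (fun s hs => (hv s (hsub' hs)).1.hasDerivWithinAt)
    (fun s hs => hδ s (hsub' hs)) (fun s hs => (hv s (hsub' hs)).2)
    (by simp [h0]) t ⟨ht0, le_rfl⟩
  simpa using this

/-- Grönwall's inequality on both sides of the initial time, comparing a solution of `u' = f(u)`
with an approximate solution. -/
theorem dist_le_gronwallBound_abs {F : Type*} [NormedAddCommGroup F] [NormedSpace ℝ F]
    {f : F → F} {S : Set F} {K : NNReal} (hf : LipschitzOnWith K f S) {ε δ : ℝ}
    {u v v' : ℝ → F}
    (hu : ∀ t ∈ Ioo (-ε) ε, HasDerivAt u (f (u t)) t ∧ u t ∈ S)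
    (hv : ∀ t ∈ Ioo (-ε) ε, HasDerivAt v (v' t) t ∧ v t ∈ S)
    (hδ : ∀ t ∈ Ioo (-ε) ε, dist (v' t) (f (v t)) ≤ δ) (h0 : u 0 = v 0)
    {t : ℝ} (ht : t ∈ Ioo (-ε) ε) :
    dist (u t) (v t) ≤ gronwallBound 0 K δ |t| := by
  rcases le_total 0 t with h | h
  · rw [abs_of_nonneg h]
    exact dist_le_gronwallBound_of_nonneg hf hu hv hδ h0 h ht.2
  · rw [abs_of_nonpos h]
    have hneg : ∀ s ∈ Ioo (-ε) ε, -s ∈ Ioo (-ε) ε := fun s hs => ⟨by linarith [hs.2], by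
      linarith [hs.1]⟩
    have hrev : ∀ (w : ℝ → F) (w' : F) (s : ℝ), HasDerivAt w w' (-s) →
        HasDerivAt (fun s => w (-s)) (-w') s := fun w w' s hw => by
      simpa using! hw.scomp s (hasDerivAt_neg s)
    have := dist_le_gronwallBound_of_nonneg (f := fun z => -f z) (S := S) (K := K) (ε := ε)
      (δ := δ) (u := fun s => u (-s)) (v := fun s => v (-s)) (v' := fun s => -v' (-s))
      hf.neg
      (fun s hs => ⟨hrev _ _ _ (hu _ (hneg s hs)).1, (hu _ (hneg s hs)).2⟩)
      (fun s hs => ⟨hrev _ _ _ (hv _ (hneg s hs)).1, (hv _ (hneg s hs)).2⟩)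
      (fun s hs => by simpa using hδ _ (hneg s hs)) (by simpa using h0) (t := -t)
      (by linarith) (by linarith [ht.1])
    simpa using this

/-- The local flow `φ` of a `C²` vector field is `C¹` in the initial value; its derivative `ψ`
solves the linearized equation. The pair `(φ, ψ)` is the flow of the vector field
`(z, B) ↦ (f z, Df(z) ∘ B)` starting at `(z, id)`; that `ψ` is the derivative of `φ` is Grönwall's
inequality applied to `φ z'` and `φ z + ψ z (z' - z)`. -/
theorem exists_local_flow {F : Type*} [NormedAddCommGroup F] [NormedSpace ℝ F] [CompleteSpace F]
    {f : F → F} {z₀ : F} (hf : ContDiffAt ℝ 2 f z₀) {O : Set F} (hO : O ∈ 𝓝 z₀) :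
    ∃ r > (0 : ℝ), ∃ ε > (0 : ℝ), ∃ (φ : F → ℝ → F) (ψ : F → ℝ → F →L[ℝ] F),
      (∀ z ∈ Metric.ball z₀ r, φ z 0 = z ∧ ψ z 0 = ContinuousLinearMap.id ℝ F ∧
        ∀ t ∈ Ioo (-ε) ε, φ z t ∈ O ∧ HasDerivAt (φ z) (f (φ z t)) t ∧
          HasDerivAt (ψ z) ((fderiv ℝ f (φ z t)).comp (ψ z t)) t ∧
          HasFDerivAt (fun z => φ z t) (ψ z t) z) ∧
      ∀ t ∈ Ioo (-ε) ε, ContinuousOn (fun z => ψ z t) (Metric.ball z₀ r) := by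
  set f2 : F × (F →L[ℝ] F) → F × (F →L[ℝ] F) := fun p => (f p.1, (fderiv ℝ f p.1).comp p.2)
    with hf2def
  set p₀ : F × (F →L[ℝ] F) := (z₀, ContinuousLinearMap.id ℝ F) with hp₀
  have hDf : ContDiffAt ℝ 1 (fderiv ℝ f) z₀ := hf.fderiv_right (by norm_num [one_add_one_eq_two])
  have hf2 : ContDiffAt ℝ 1 f2 p₀ := by
    have h1 : ContDiffAt ℝ 1 (fun p : F × (F →L[ℝ] F) => f p.1) p₀ :=
      ContDiffAt.comp p₀ (hf.of_le (by norm_num)) contDiffAt_fst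
    have h2 : ContDiffAt ℝ 1 (fun p : F × (F →L[ℝ] F) => fderiv ℝ f p.1) p₀ :=
      ContDiffAt.comp p₀ hDf contDiffAt_fst
    exact h1.prodMk (h2.clm_comp contDiffAt_snd)
  obtain ⟨ε₀, hε₀, a, r₀, L, K, hr₀, hPL⟩ := IsPicardLindelof.of_contDiffAt_one hf2
  obtain ⟨α, hα, L', hL'⟩ :=
    (hPL 0).exists_forall_mem_closedBall_eq_hasDerivWithinAt_lipschitzOnWith
  -- a ball on which `f` and its derivative are Lipschitz
  obtain ⟨K₁, S₁, hS₁, hK₁⟩ :=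
    (hf.of_le (by norm_num : (1 : WithTop ℕ∞) ≤ 2)).exists_lipschitzOnWith
  obtain ⟨K₂, S₂, hS₂, hK₂⟩ := hDf.exists_lipschitzOnWith
  have hdiff : ∀ᶠ z in 𝓝 z₀, DifferentiableAt ℝ f z :=
    ((hf.of_le (by norm_num : (1 : WithTop ℕ∞) ≤ 2)).eventually (by simp)).mono
      fun z hz => hz.differentiableAt (by simp)
  obtain ⟨R, hR, hRsub⟩ :=
    Metric.mem_nhds_iff.1 (inter_mem (inter_mem hS₁ hS₂) (inter_mem hO hdiff))
  have hcont : ContinuousAt (α p₀) 0 := by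
    have := (hα p₀ (Metric.mem_closedBall_self r₀.2)).2 0 (by constructor <;> simp [hε₀.le])
    exact (this.hasDerivAt (Icc_mem_nhds (by simpa) (by simpa))).continuousAt
  have hα0 : α p₀ 0 = p₀ := (hα p₀ (Metric.mem_closedBall_self r₀.2)).1
  set ρ := min (R / 4) 1 with hρ
  have hρ0 : 0 < ρ := lt_min (by linarith) one_pos
  obtain ⟨ε₁, hε₁, hclose⟩ := Metric.continuousAt_iff.1 hcont ρ hρ0
  set ε := min ε₀ ε₁ with hε
  have hε0 : 0 < ε := lt_min hε₀ hε₁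
  set r := min (r₀ : ℝ) (ρ / (L' + 1)) with hr
  have hL'pos : (0 : ℝ) < L' + 1 := by positivity
  have hr0 : 0 < r := lt_min (by exact_mod_cast hr₀) (by positivity)
  set ι : F → F × (F →L[ℝ] F) := fun z => (z, ContinuousLinearMap.id ℝ F) with hι
  have hιdist : ∀ z z', dist (ι z) (ι z') = dist z z' := fun z z' => by
    simp [hι, Prod.dist_eq]
  have hιmem : ∀ z ∈ Metric.ball z₀ r, ι z ∈ Metric.closedBall p₀ r₀ := fun z hz => by
    rw [Metric.mem_closedBall, show p₀ = ι z₀ from rfl, hιdist]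
    exact (Metric.mem_ball.1 hz).le.trans (min_le_left _ _)
  have htmem : ∀ t ∈ Ioo (-ε) ε, t ∈ Ioo (0 - ε₀) (0 + ε₀) := fun t ht =>
    ⟨by linarith [ht.1, min_le_left ε₀ ε₁], by linarith [ht.2, min_le_left ε₀ ε₁]⟩
  have hαder : ∀ z ∈ Metric.ball z₀ r, ∀ t ∈ Ioo (-ε) ε,
      HasDerivAt (α (ι z)) (f2 (α (ι z) t)) t := fun z hz t ht =>
    ((hα _ (hιmem z hz)).2 t (Ioo_subset_Icc_self (htmem t ht))).hasDerivAt
      (Icc_mem_nhds (htmem t ht).1 (htmem t ht).2)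
  have hstay : ∀ z ∈ Metric.ball z₀ r, ∀ t ∈ Ioo (-ε) ε, dist (α (ι z) t) p₀ < 2 * ρ := by
    intro z hz t ht
    have h1 : dist (α (ι z) t) (α p₀ t) ≤ L' * dist z z₀ := by
      rw [← hιdist]
      exact (hL' t (Ioo_subset_Icc_self (htmem t ht))).dist_le_mul _ (hιmem z hz) _
        (Metric.mem_closedBall_self r₀.2)
    have h2 : dist (α p₀ t) p₀ < ρ := by
      have := @hclose t (by
        rw [Real.dist_eq, sub_zero, abs_lt]
        exact ⟨by linarith [ht.1, min_le_right ε₀ ε₁], by linarith [ht.2, min_le_right ε₀ ε₁]⟩)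
      rwa [hα0] at this
    have h3 : L' * dist z z₀ ≤ ρ := by
      have hz' : dist z z₀ ≤ ρ / (L' + 1) := (Metric.mem_ball.1 hz).le.trans (min_le_right _ _)
      calc (L' : ℝ) * dist z z₀ ≤ (L' + 1) * (ρ / (L' + 1)) := by gcongr; linarith
        _ = ρ := by field_simp
    linarith [dist_triangle (α (ι z) t) (α p₀ t) p₀]
  set φ : F → ℝ → F := fun z t => (α (ι z) t).1 with hφ
  set ψ : F → ℝ → F →L[ℝ] F := fun z t => (α (ι z) t).2 with hψ
  have hφmem : ∀ z ∈ Metric.ball z₀ r, ∀ t ∈ Ioo (-ε) ε, φ z t ∈ Metric.ball z₀ (R / 2) := by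
    intro z hz t ht
    have h1 := hstay z hz t ht
    have h2 : dist (φ z t) z₀ ≤ dist (α (ι z) t) p₀ := by
      rw [Prod.dist_eq]; exact le_max_left _ _
    rw [Metric.mem_ball]
    linarith [min_le_left (R / 4) 1]
  have hψnorm : ∀ z ∈ Metric.ball z₀ r, ∀ t ∈ Ioo (-ε) ε, ‖ψ z t‖ ≤ 3 := by
    intro z hz t ht
    have h1 := hstay z hz t ht
    have h2 : dist (ψ z t) (ContinuousLinearMap.id ℝ F) ≤ dist (α (ι z) t) p₀ := by
      rw [Prod.dist_eq]; exact le_max_right _ _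
    rw [dist_eq_norm] at h2
    have h3 : ‖ContinuousLinearMap.id ℝ F‖ ≤ 1 := ContinuousLinearMap.norm_id_le
    have h4 := norm_le_norm_sub_add (ψ z t) (ContinuousLinearMap.id ℝ F)
    linarith [min_le_right (R / 4) 1]
  have hφder : ∀ z ∈ Metric.ball z₀ r, ∀ t ∈ Ioo (-ε) ε, HasDerivAt (φ z) (f (φ z t)) t :=
    fun z hz t ht => (hαder z hz t ht).fst
  have hψder : ∀ z ∈ Metric.ball z₀ r, ∀ t ∈ Ioo (-ε) ε,
      HasDerivAt (ψ z) ((fderiv ℝ f (φ z t)).comp (ψ z t)) t :=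
    fun z hz t ht => (hαder z hz t ht).snd
  have hinit : ∀ z ∈ Metric.ball z₀ r, φ z 0 = z ∧ ψ z 0 = ContinuousLinearMap.id ℝ F :=
    fun z hz => by
      have := (hα _ (hιmem z hz)).1
      change α (ι z) 0 = ι z at this
      exact ⟨congrArg Prod.fst this, congrArg Prod.snd this⟩
  -- quadratic Taylor estimate for `f`
  have htaylor : ∀ x ∈ Metric.ball z₀ (R / 2), ∀ h : F, ‖h‖ < R / 2 →
      ‖f (x + h) - f x - fderiv ℝ f x h‖ ≤ K₂ * ‖h‖ * ‖h‖ := by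
    intro x hx h hh
    have hsub : ∀ y ∈ Metric.closedBall x ‖h‖, y ∈ Metric.ball z₀ R := fun y hy => by
      have := dist_triangle y x z₀
      rw [Metric.mem_ball] at hx ⊢
      rw [Metric.mem_closedBall] at hy
      linarith
    have := (convex_closedBall x ‖h‖).norm_image_sub_le_of_norm_fderiv_le' (𝕜 := ℝ) (f := f)
      (C := K₂ * ‖h‖) (φ := fderiv ℝ f x) (x := x) (y := x + h)
      (fun y hy => (hRsub (hsub y hy)).2.2)
      (fun y hy => by
        have h1 := hK₂.dist_le_mul y (hRsub (hsub y hy)).1.2 x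
          (hRsub (hsub x (Metric.mem_closedBall_self (norm_nonneg h)))).1.2
        rw [dist_eq_norm] at h1
        exact h1.trans (by gcongr; exact hy))
      (Metric.mem_closedBall_self (norm_nonneg h)) (by simp)
    simpa using this
  have hφdiff : ∀ z ∈ Metric.ball z₀ r, ∀ t ∈ Ioo (-ε) ε,
      HasFDerivAt (fun z => φ z t) (ψ z t) z := by
    intro z hz t ht
    have hbound : ∀ᶠ z' in 𝓝 z, ‖φ z' t - (φ z t + ψ z t (z' - z))‖
        ≤ (9 * K₂ * gronwallBound 0 (K₁ + 1) 1 |t|) * ‖‖z' - z‖ ^ 2‖ := by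
      have hnear : ∀ᶠ z' in 𝓝 z, ‖z' - z‖ < R / 6 := by
        have : Tendsto (fun z' => ‖z' - z‖) (𝓝 z) (𝓝 ‖z - z‖) :=
          (continuous_id.sub continuous_const).norm.tendsto z
        rw [sub_self, norm_zero] at this
        exact this.eventually (gt_mem_nhds (by linarith))
      filter_upwards [hnear, Metric.isOpen_ball.mem_nhds hz] with z' hz'1 hz'2
      have hsmall : ∀ s ∈ Ioo (-ε) ε, ‖ψ z s (z' - z)‖ ≤ 3 * ‖z' - z‖ := fun s hs =>
        (ContinuousLinearMap.le_opNorm _ _).trans (by gcongr; exact hψnorm z hz s hs)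
      have hg := dist_le_gronwallBound_abs (f := f) (S := Metric.ball z₀ R) (K := K₁ + 1) (ε := ε)
        (δ := 9 * K₂ * ‖z' - z‖ ^ 2) (u := φ z') (v := fun s => φ z s + ψ z s (z' - z))
        (v' := fun s => f (φ z s) + fderiv ℝ f (φ z s) (ψ z s (z' - z)))
        ((hK₁.mono fun y hy => (hRsub hy).1.1).weaken (by simp))
        (fun s hs => ⟨hφder z' hz'2 s hs, Metric.ball_subset_ball (by linarith)
          (hφmem z' hz'2 s hs)⟩)
        (fun s hs => ⟨(hφder z hz s hs).add
          (by simpa using (hψder z hz s hs).clm_apply (hasDerivAt_const s (z' - z))), by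
            have h1 := Metric.mem_ball.1 (hφmem z hz s hs)
            have h2 := hsmall s hs
            rw [Metric.mem_ball, dist_eq_norm]
            rw [dist_eq_norm] at h1
            calc ‖φ z s + ψ z s (z' - z) - z₀‖ = ‖(φ z s - z₀) + ψ z s (z' - z)‖ := by
                  congr 1; abel
              _ ≤ ‖φ z s - z₀‖ + ‖ψ z s (z' - z)‖ := norm_add_le _ _
              _ < R := by linarith⟩)
        (fun s hs => by
          have h2 := hsmall s hs
          have := htaylor (φ z s) (hφmem z hz s hs) (ψ z s (z' - z)) (by linarith)
          rw [dist_comm, dist_eq_norm]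
          rw [← sub_sub]
          refine this.trans ?_
          calc (K₂ : ℝ) * ‖ψ z s (z' - z)‖ * ‖ψ z s (z' - z)‖
              ≤ K₂ * (3 * ‖z' - z‖) * (3 * ‖z' - z‖) := by gcongr
            _ = _ := by ring)
        (by simp [(hinit z hz).1, (hinit z' hz'2).1, (hinit z hz).2]) ht
      rw [dist_eq_norm] at hg
      refine hg.trans (le_of_eq ?_)
      have hK : ((K₁ : ℝ) + 1) ≠ 0 := by positivity
      simp only [NNReal.coe_add, NNReal.coe_one]
      rw [gronwallBound_of_K_ne_0 hK, gronwallBound_of_K_ne_0 hK]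
      simp
      ring
    have hO : (fun z' => φ z' t - (φ z t + ψ z t (z' - z))) =O[𝓝 z] fun z' => ‖z' - z‖ ^ 2 :=
      Asymptotics.IsBigO.of_bound _ hbound
    have h0 := hO.hasFDerivAt (𝕜 := ℝ) (by norm_num)
    have h1 : HasFDerivAt (fun z' => φ z t + ψ z t (z' - z)) (ψ z t) z := by
      have := ((ψ z t).hasFDerivAt.comp z ((hasFDerivAt_id z).sub_const z)).const_add (φ z t)
      simpa using! this
    have := h0.add h1
    rw [zero_add] at this
    exact this.congr_of_eventuallyEq (Eventually.of_forall fun z' => by simp)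
  refine ⟨r, hr0, ε, hε0, φ, ψ, fun z hz => ⟨(hinit z hz).1, (hinit z hz).2, fun t ht =>
    ⟨(hRsub (Metric.ball_subset_ball (by linarith) (hφmem z hz t ht))).2.1, hφder z hz t ht,
      hψder z hz t ht, hφdiff z hz t ht⟩⟩, fun t ht => ?_⟩
  have := (hL' t (Ioo_subset_Icc_self (htmem t ht))).continuousOn
  exact continuous_snd.comp_continuousOn (this.comp
    (by fun_prop : Continuous ι).continuousOn fun z hz => hιmem z hz)

/-! ### Coordinates on the tangent bundle -/

section Charts

variable {m : ℕ} {M : Type*} [TopologicalSpace M]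
  [ChartedSpace (EuclideanSpace ℝ (Fin m)) M] [IsManifold (𝓡 m) ∞ M]

/-- The differential at `x` of the chart at `p`: the coordinates of a tangent vector. -/
def dChart (p x : M) : TangentSpace (𝓡 m) x →L[ℝ] EuclideanSpace ℝ (Fin m) :=
  mfderiv (𝓡 m) 𝓘(ℝ, EuclideanSpace ℝ (Fin m)) (extChartAt (𝓡 m) p) x

/-- The differential at `u` of the inverse of the chart at `p`. -/
def dChartSymm (p : M) (u : EuclideanSpace ℝ (Fin m)) :
    EuclideanSpace ℝ (Fin m) →L[ℝ] TangentSpace (𝓡 m) ((extChartAt (𝓡 m) p).symm u) :=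
  mfderiv 𝓘(ℝ, EuclideanSpace ℝ (Fin m)) (𝓡 m) (extChartAt (𝓡 m) p).symm u

omit [IsManifold (𝓡 m) ∞ M] in
theorem isOpen_chart_target (p : M) : IsOpen (extChartAt (𝓡 m) p).target :=
  isOpen_extChartAt_target p

theorem dChart_dChartSymm (p : M) {u : EuclideanSpace ℝ (Fin m)}
    (hu : u ∈ (extChartAt (𝓡 m) p).target) (w : EuclideanSpace ℝ (Fin m)) :
    dChart p ((extChartAt (𝓡 m) p).symm u) (dChartSymm p u w) = w := by
  have h := mfderiv_extChartAt_comp_mfderivWithin_extChartAt_symm (I := 𝓡 m) hu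
  rw [ModelWithCorners.range_eq_univ, mfderivWithin_univ] at h
  exact DFunLike.congr_fun h w

theorem dChartSymm_dChart (p : M) {u : EuclideanSpace ℝ (Fin m)}
    (hu : u ∈ (extChartAt (𝓡 m) p).target)
    (v : TangentSpace (𝓡 m) ((extChartAt (𝓡 m) p).symm u)) :
    dChartSymm p u (dChart p ((extChartAt (𝓡 m) p).symm u) v) = v := by
  have h := mfderivWithin_extChartAt_symm_comp_mfderiv_extChartAt (I := 𝓡 m) hu
  rw [ModelWithCorners.range_eq_univ, mfderivWithin_univ] at h
  exact DFunLike.congr_fun h v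

theorem dChart_bijective (p : M) {x : M} (hx : x ∈ (extChartAt (𝓡 m) p).source) :
    Function.Bijective (dChart (m := m) p x) := by
  obtain ⟨u, hu, rfl⟩ : ∃ u ∈ (extChartAt (𝓡 m) p).target, (extChartAt (𝓡 m) p).symm u = x :=
    ⟨_, (extChartAt (𝓡 m) p).map_source hx, (extChartAt (𝓡 m) p).left_inv hx⟩
  exact ⟨(show Function.LeftInverse (dChartSymm (m := m) p u)
      (dChart (m := m) p ((extChartAt (𝓡 m) p).symm u)) from
      dChartSymm_dChart p hu).injective,
    (show Function.RightInverse (dChartSymm (m := m) p u)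
      (dChart (m := m) p ((extChartAt (𝓡 m) p).symm u)) from
      dChart_dChartSymm p hu).surjective⟩

variable (m) in
/-- Coordinates on a vector bundle over a manifold, near the fibre over `p`: the chart at `p` on the
base, the preferred trivialization at `p` on the fibres. -/
def bundleCoord (F : Type*) [NormedAddCommGroup F] [NormedSpace ℝ F] (V : M → Type*)
    [TopologicalSpace (TotalSpace F V)] [∀ x, TopologicalSpace (V x)] [FiberBundle F V] (p : M) :
    OpenPartialHomeomorph (TotalSpace F V) (EuclideanSpace ℝ (Fin m) × F) :=
  (trivializationAt F V p).toOpenPartialHomeomorph.trans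
    ((chartAt (EuclideanSpace ℝ (Fin m)) p).prod (OpenPartialHomeomorph.refl F))

/-- Coordinates on the tangent bundle: `(x, v) ↦ (c(x), dc(v))`, with `c` the chart at `p`. -/
def tangentCoord (p : M) : OpenPartialHomeomorph (TangentBundle (𝓡 m) M)
    (EuclideanSpace ℝ (Fin m) × EuclideanSpace ℝ (Fin m)) :=
  bundleCoord m (EuclideanSpace ℝ (Fin m)) (TangentSpace (𝓡 m) : M → Type _) p

theorem mem_tangentCoord_source {p : M} {q : TangentBundle (𝓡 m) M} :
    q ∈ (tangentCoord p).source ↔ q.1 ∈ (extChartAt (𝓡 m) p).source := by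
  simp only [tangentCoord, bundleCoord, mfld_simps]

theorem tangentCoord_apply {p : M} {q : TangentBundle (𝓡 m) M}
    (hq : q.1 ∈ (extChartAt (𝓡 m) p).source) :
    tangentCoord p q = (extChartAt (𝓡 m) p q.1, dChart p q.1 q.2) := by
  have hq' : q.1 ∈ (chartAt (EuclideanSpace ℝ (Fin m)) p).source := by simpa using hq
  have hb : q.1 ∈ (trivializationAt (EuclideanSpace ℝ (Fin m))
    (TangentSpace (𝓡 m) : M → Type _) p).baseSet := hq'
  have h2 : ((trivializationAt (EuclideanSpace ℝ (Fin m))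
      (TangentSpace (𝓡 m) : M → Type _) p) q).2 = dChart p q.1 q.2 := by
    rw [dChart, ← TangentBundle.continuousLinearMapAt_trivializationAt hq',
      Trivialization.continuousLinearMapAt_apply, Trivialization.coe_linearMapAt_of_mem _ hb]
  refine Prod.ext ?_ h2
  simp [tangentCoord, bundleCoord, (trivializationAt (EuclideanSpace ℝ (Fin m))
      (TangentSpace (𝓡 m) : M → Type _) p).coe_fst' hb]

theorem tangentCoord_target (p : M) :
    (tangentCoord p).target = (extChartAt (𝓡 m) p).target ×ˢ univ := by
  ext ⟨u, w⟩
  simp only [tangentCoord, bundleCoord, mfld_simps]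
  exact ⟨fun h => h.1, fun h => ⟨h, (chartAt (EuclideanSpace ℝ (Fin m)) p).map_target h⟩⟩

theorem mem_tangentCoord_target {p : M}
    {z : EuclideanSpace ℝ (Fin m) × EuclideanSpace ℝ (Fin m)} :
    z ∈ (tangentCoord p).target ↔ z.1 ∈ (extChartAt (𝓡 m) p).target := by
  rw [tangentCoord_target]; simp

theorem tangentCoord_symm_apply {p : M} {z : EuclideanSpace ℝ (Fin m) × EuclideanSpace ℝ (Fin m)}
    (hz : z.1 ∈ (extChartAt (𝓡 m) p).target) :
    (tangentCoord p).symm z = ⟨(extChartAt (𝓡 m) p).symm z.1, dChartSymm p z.1 z.2⟩ := by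
  have hs := (extChartAt (𝓡 m) p).map_target hz
  have h1 : (⟨(extChartAt (𝓡 m) p).symm z.1, dChartSymm p z.1 z.2⟩ : TangentBundle (𝓡 m) M) ∈
      (tangentCoord p).source := mem_tangentCoord_source.2 hs
  rw [← (tangentCoord p).left_inv h1, tangentCoord_apply hs]
  congr 1
  rw [dChart_dChartSymm p hz, (extChartAt (𝓡 m) p).right_inv hz]

/-- The chain rule in coordinates: `dc'(dF(v)) = d(c' ∘ F ∘ c⁻¹)(dc(v))`. -/
theorem dChart_mfderiv {m' : ℕ} {N : Type*} [TopologicalSpace N]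
    [ChartedSpace (EuclideanSpace ℝ (Fin m')) N] [IsManifold (𝓡 m') ∞ N] {F : M → N} {p x : M}
    {p' : N} (hx : x ∈ (extChartAt (𝓡 m) p).source)
    (hFx : F x ∈ (extChartAt (𝓡 m') p').source) (hF : MDifferentiableAt (𝓡 m) (𝓡 m') F x)
    (v : TangentSpace (𝓡 m) x) :
    dChart p' (F x) (mfderiv (𝓡 m) (𝓡 m') F x v) =
      fderiv ℝ (extChartAt (𝓡 m') p' ∘ F ∘ (extChartAt (𝓡 m) p).symm) (extChartAt (𝓡 m) p x)
        (dChart p x v) := by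
  have hFx' : F x ∈ (chartAt (EuclideanSpace ℝ (Fin m')) p').source := by simpa using hFx
  obtain ⟨u, hu, rfl⟩ : ∃ u ∈ (extChartAt (𝓡 m) p).target, (extChartAt (𝓡 m) p).symm u = x :=
    ⟨_, (extChartAt (𝓡 m) p).map_source hx, (extChartAt (𝓡 m) p).left_inv hx⟩
  rw [(extChartAt (𝓡 m) p).right_inv hu]
  have h1 : MDifferentiableAt (𝓡 m') 𝓘(ℝ, EuclideanSpace ℝ (Fin m')) (extChartAt (𝓡 m') p')
      (F ((extChartAt (𝓡 m) p).symm u)) := mdifferentiableAt_extChartAt hFx'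
  have h3 : MDifferentiableAt 𝓘(ℝ, EuclideanSpace ℝ (Fin m)) (𝓡 m)
      (extChartAt (𝓡 m) p).symm u := by
    have := mdifferentiableWithinAt_extChartAt_symm (I := 𝓡 m) hu
    rwa [ModelWithCorners.range_eq_univ, mdifferentiableWithinAt_univ] at this
  rw [← mfderiv_eq_fderiv, mfderiv_comp u h1 (hF.comp u h3), mfderiv_comp u hF h3]
  have := dChartSymm_dChart p hu v
  change _ = dChart p' _ (mfderiv _ _ F _ (dChartSymm p u (dChart p _ v)))
  rw [this]

/-- The chain rule in coordinates for a curve. -/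
theorem dChart_velocity {γ : ℝ → M} {t : ℝ} {p : M}
    (ht : γ t ∈ (extChartAt (𝓡 m) p).source) (hγ : MDifferentiableAt 𝓘(ℝ, ℝ) (𝓡 m) γ t) :
    dChart p (γ t) (velocity γ t).2 = deriv (fun s => extChartAt (𝓡 m) p (γ s)) t := by
  have ht' : γ t ∈ (chartAt (EuclideanSpace ℝ (Fin m)) p).source := by simpa using ht
  have h1 : MDifferentiableAt (𝓡 m) 𝓘(ℝ, EuclideanSpace ℝ (Fin m)) (extChartAt (𝓡 m) p) (γ t) :=
    mdifferentiableAt_extChartAt ht'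
  have := mfderiv_comp t h1 hγ
  rw [mfderiv_eq_fderiv] at this
  rw [← fderiv_apply_one_eq_deriv]
  exact (DFunLike.congr_fun this (1 : ℝ)).symm

theorem tangentCoord_velocity {γ : ℝ → M} {t : ℝ} {p : M}
    (ht : γ t ∈ (extChartAt (𝓡 m) p).source) (hγ : MDifferentiableAt 𝓘(ℝ, ℝ) (𝓡 m) γ t) :
    tangentCoord p (velocity γ t) =
      (extChartAt (𝓡 m) p (γ t), deriv (fun s => extChartAt (𝓡 m) p (γ s)) t) := by
  rw [tangentCoord_apply (show (velocity γ t).1 ∈ _ from ht)]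
  exact Prod.ext rfl (dChart_velocity ht hγ)

/-- In two coordinate systems, tangent vectors are related by the differential of the coordinate
change. -/
theorem tangentCoord_symm_tangentCoord {p p' : M}
    {z : EuclideanSpace ℝ (Fin m) × EuclideanSpace ℝ (Fin m)}
    (hz : z.1 ∈ (extChartAt (𝓡 m) p).target)
    (hz' : (extChartAt (𝓡 m) p).symm z.1 ∈ (extChartAt (𝓡 m) p').source) :
    tangentCoord p' ((tangentCoord p).symm z) =
      ((extChartAt (𝓡 m) p' ∘ (extChartAt (𝓡 m) p).symm) z.1,
        fderiv ℝ (extChartAt (𝓡 m) p' ∘ (extChartAt (𝓡 m) p).symm) z.1 z.2) := by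
  rw [tangentCoord_symm_apply hz, tangentCoord_apply (by exact hz')]
  refine Prod.ext rfl ?_
  have := dChart_mfderiv (F := (id : M → M)) (p := p) (p' := p')
    ((extChartAt (𝓡 m) p).map_target hz) hz' mdifferentiableAt_id (dChartSymm p z.1 z.2)
  rw [dChart_dChartSymm p hz, (extChartAt (𝓡 m) p).right_inv hz, mfderiv_id] at this
  exact this

theorem contDiffAt_coordChange {p p' : M} {u : EuclideanSpace ℝ (Fin m)}
    (hu : u ∈ (extChartAt (𝓡 m) p).target)
    (hu' : (extChartAt (𝓡 m) p).symm u ∈ (extChartAt (𝓡 m) p').source) :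
    ContDiffAt ℝ ∞ (extChartAt (𝓡 m) p' ∘ (extChartAt (𝓡 m) p).symm) u := by
  have := contDiffWithinAt_ext_coord_change (I := 𝓡 m) (n := ∞) p' p (y := u)
    (by simpa using ⟨by simpa using hu, by simpa using hu'⟩)
  rwa [ModelWithCorners.range_eq_univ, contDiffWithinAt_univ] at this

end Charts

section Metric

variable {n : ℕ} {M : Type*} [TopologicalSpace M]
  [ChartedSpace (EuclideanSpace ℝ (Fin (n + 1))) M] [IsManifold (𝓡 (n + 1)) ∞ M]
  (g : LorentzMetric n M)

theorem LorentzMetric.inChart_dChart {p x : M} (hx : x ∈ (extChartAt (𝓡 (n + 1)) p).source)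
    (a b : TangentSpace (𝓡 (n + 1)) x) :
    g.inChart p (extChartAt (𝓡 (n + 1)) p x) (dChart p x a) (dChart p x b) = g.val x a b := by
  obtain ⟨u, hu, rfl⟩ : ∃ u ∈ (extChartAt (𝓡 (n + 1)) p).target,
      (extChartAt (𝓡 (n + 1)) p).symm u = x :=
    ⟨_, (extChartAt _ p).map_source hx, (extChartAt _ p).left_inv hx⟩
  rw [(extChartAt (𝓡 (n + 1)) p).right_inv hu]
  change g.val _ (dChartSymm p u (dChart p _ a)) (dChartSymm p u (dChart p _ b)) = _
  rw [dChartSymm_dChart p hu, dChartSymm_dChart p hu]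

theorem LorentzMetric.inChart_apply (p : M) (u a b : EuclideanSpace ℝ (Fin (n + 1))) :
    g.inChart p u a b =
      g.val ((extChartAt (𝓡 (n + 1)) p).symm u) (dChartSymm p u a) (dChartSymm p u b) := rfl

theorem LorentzMetric.inChart_symm (p : M) (u a b : EuclideanSpace ℝ (Fin (n + 1))) :
    g.inChart p u a b = g.inChart p u b a := by
  rw [g.inChart_apply, g.inChart_apply, g.symm]

theorem LorentzMetric.contDiffAt_inChart {p : M} {u : EuclideanSpace ℝ (Fin (n + 1))}
    (hu : u ∈ (extChartAt (𝓡 (n + 1)) p).target) : ContDiffAt ℝ ∞ (g.inChart p) u := by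
  have hbase : ∀ u' ∈ (extChartAt (𝓡 (n + 1)) p).target, (extChartAt (𝓡 (n + 1)) p).symm u' ∈
      (trivializationAt (EuclideanSpace ℝ (Fin (n + 1)))
        (TangentSpace (𝓡 (n + 1)) : M → Type _) p).baseSet := fun u' hu' => by
    have := (extChartAt (𝓡 (n + 1)) p).map_target hu'
    simpa using this
  set e := trivializationAt (EuclideanSpace ℝ (Fin (n + 1)))
    (TangentSpace (𝓡 (n + 1)) : M → Type _) p with he
  have hsymm : ∀ u' ∈ (extChartAt (𝓡 (n + 1)) p).target, ∀ a,
      e.symm ((extChartAt (𝓡 (n + 1)) p).symm u') a = dChartSymm p u' a := by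
    intro u' hu' a
    have := TangentBundle.symmL_trivializationAt (I := 𝓡 (n + 1)) (x₀ := p)
      (x := (extChartAt (𝓡 (n + 1)) p).symm u')
      (by simpa using (extChartAt (𝓡 (n + 1)) p).map_target hu')
    rw [ModelWithCorners.range_eq_univ, mfderivWithin_univ,
      (extChartAt (𝓡 (n + 1)) p).right_inv hu'] at this
    rw [← e.symmL_apply (R := ℝ) (hbase u' hu')]
    exact DFunLike.congr_fun this a
  -- the coordinate vector fields are smooth
  have hfield : ∀ (a : EuclideanSpace ℝ (Fin (n + 1))) (x : M), x ∈ e.baseSet →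
      ContMDiffAt (𝓡 (n + 1)) ((𝓡 (n + 1)).prod 𝓘(ℝ, EuclideanSpace ℝ (Fin (n + 1)))) ∞
        (fun y => TotalSpace.mk' (EuclideanSpace ℝ (Fin (n + 1))) y (e.symm y a)) x := by
    intro a x hx
    rw [e.contMDiffAt_section_iff hx]
    refine (contMDiffAt_const (c := a)).congr_of_eventuallyEq ?_
    filter_upwards [e.open_baseSet.mem_nhds hx] with y hy
    rw [e.apply_mk_symm hy]
  have hfun : ∀ a b : EuclideanSpace ℝ (Fin (n + 1)),
      ContDiffOn ℝ ∞ (fun u => g.inChart p u a b) (extChartAt (𝓡 (n + 1)) p).target := by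
    intro a b u hu
    refine ContDiffAt.contDiffWithinAt ?_
    set x := (extChartAt (𝓡 (n + 1)) p).symm u with hx
    have h1 := ContMDiffAt.clm_bundle_apply₂ (F₁ := EuclideanSpace ℝ (Fin (n + 1)))
      (F₂ := EuclideanSpace ℝ (Fin (n + 1))) (F₃ := ℝ) (E₃ := Bundle.Trivial M ℝ)
      (b := fun y : M => y) (ψ := g.val)
      (g.contMDiff x) (hfield a x (hbase u hu)) (hfield b x (hbase u hu))
    have h1' := (contMDiffAt_totalSpace.1 h1).2
    have h2 : ContMDiffAt 𝓘(ℝ, EuclideanSpace ℝ (Fin (n + 1))) (𝓡 (n + 1)) ∞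
        (extChartAt (𝓡 (n + 1)) p).symm u :=
      (contMDiffOn_extChartAt_symm p).contMDiffAt ((isOpen_chart_target p).mem_nhds hu)
    have h3 := (h1'.comp u h2).contDiffAt
    refine h3.congr_of_eventuallyEq ?_
    filter_upwards [(isOpen_chart_target p).mem_nhds hu] with u' hu'
    have e1 := hsymm u' hu' a
    have e2 := hsymm u' hu' b
    rw [g.inChart_apply, ← e1, ← e2]
    rfl
  have : ContDiffOn ℝ ∞ (g.inChart p) (extChartAt (𝓡 (n + 1)) p).target :=
    contDiffOn_clm_apply.2 fun a => contDiffOn_clm_apply.2 fun b => hfun a b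
  exact this.contDiffAt ((isOpen_chart_target p).mem_nhds hu)

end Metric

/-! ### Geodesics as integral curves in coordinates -/

theorem IsLorentzForm.eq_zero_of_forall {E : Type*} [AddCommGroup E] [Module ℝ E]
    [TopologicalSpace E] {B : E →L[ℝ] E →L[ℝ] ℝ} (hB : IsLorentzForm B) {v : E}
    (hv : ∀ w, B w v = 0) : v = 0 := by
  obtain ⟨τ, -, h⟩ := hB
  by_contra hne
  exact (h v (hv τ) hne).ne' (hv v)

theorem isInvertible_of_injective {m : ℕ}
    {B : EuclideanSpace ℝ (Fin m) →L[ℝ] EuclideanSpace ℝ (Fin m) →L[ℝ] ℝ}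
    (hB : Function.Injective B) : B.IsInvertible := by
  have hrank : Module.finrank ℝ (EuclideanSpace ℝ (Fin m)) =
      Module.finrank ℝ (EuclideanSpace ℝ (Fin m) →L[ℝ] ℝ) :=
    (InnerProductSpace.toDual ℝ (EuclideanSpace ℝ (Fin m))).toLinearEquiv.finrank_eq
  exact ⟨(LinearEquiv.ofInjectiveOfFinrankEq (B : EuclideanSpace ℝ (Fin m) →ₗ[ℝ] _) hB
    hrank).toContinuousLinearEquiv, by ext; rfl⟩

/-- The Christoffel symbol `Γ(w, w; ·)`, `z = (u, w)`, of a field `G` of bilinear forms, as a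
covector. -/
def christoffelForm {E : Type*} [NormedAddCommGroup E] [NormedSpace ℝ E]
    (G : E → E →L[ℝ] E →L[ℝ] ℝ) (z : E × E) : E →L[ℝ] ℝ :=
  fderiv ℝ G z.1 z.2 z.2 - (1 / 2 : ℝ) • ((fderiv ℝ G z.1).flip z.2).flip z.2

theorem christoffelForm_apply {E : Type*} [NormedAddCommGroup E] [NormedSpace ℝ E]
    (G : E → E →L[ℝ] E →L[ℝ] ℝ) (u w c : E) :
    christoffelForm G (u, w) c = (1 / 2) * (fderiv ℝ G u w w c + fderiv ℝ G u w w c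
      - fderiv ℝ G u c w w) := by
  simp [christoffelForm]; ring

set_option maxSynthPendingDepth 3 in
theorem contDiffAt_christoffelForm {E : Type*} [NormedAddCommGroup E] [NormedSpace ℝ E]
    {G : E → E →L[ℝ] E →L[ℝ] ℝ} {z : E × E} (hG : ContDiffAt ℝ ∞ G z.1) :
    ContDiffAt ℝ ∞ (christoffelForm G) z := by
  have hDG : ContDiffAt ℝ ∞ (fun z : E × E => fderiv ℝ G z.1) z :=
    ContDiffAt.comp z (hG.fderiv_right (m := ∞) (by simp)) contDiffAt_fst
  have hflip := (ContinuousLinearMap.flipₗᵢ ℝ E E (E →L[ℝ] ℝ)).contDiff (n := ∞)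
  have hflip' := (ContinuousLinearMap.flipₗᵢ ℝ E E ℝ).contDiff (n := ∞)
  have h3 : ContDiffAt ℝ ∞ (fun z : E × E => (fderiv ℝ G z.1).flip z.2) z :=
    (hflip.contDiffAt.comp z hDG).clm_apply contDiffAt_snd
  have h4 := hflip'.contDiffAt.comp z h3
  exact ((hDG.clm_apply contDiffAt_snd).clm_apply contDiffAt_snd).sub
    ((h4.clm_apply contDiffAt_snd).const_smul (1 / 2 : ℝ))

theorem contDiffAt_inverse_form {E : Type*} [NormedAddCommGroup E] [NormedSpace ℝ E]
    [CompleteSpace E] {G : E → E →L[ℝ] E →L[ℝ] ℝ} {u : E} (hG : ContDiffAt ℝ ∞ G u)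
    (h : (G u).IsInvertible) : ContDiffAt ℝ ∞ (fun u => (G u).inverse) u := by
  obtain ⟨e, he⟩ := h
  have hinv := contDiffAt_map_inverse (𝕜 := ℝ) (n := ∞) e
  rw [he] at hinv
  exact ContDiffAt.comp u hinv hG

set_option maxSynthPendingDepth 3 in
theorem christoffel_smul_smul {E : Type*} [NormedAddCommGroup E] [NormedSpace ℝ E]
    (D : E →L[ℝ] E →L[ℝ] E →L[ℝ] ℝ) (a : ℝ) (v w : E) :
    (1 / 2) * (D (a • v) (a • v) w + D (a • v) (a • v) w - D w (a • v) (a • v)) =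
      a * a * ((1 / 2) * (D v v w + D v v w - D w v v)) := by
  simp only [map_smul, smul_apply, smul_eq_mul]
  ring

theorem differentiableAt_deriv_of_contDiffAt {E : Type*} [NormedAddCommGroup E] [NormedSpace ℝ E]
    {c : ℝ → E} {t : ℝ} (h : ContDiffAt ℝ ∞ c t) : DifferentiableAt ℝ (deriv c) t := by
  have h1 : ContDiffAt ℝ 1 (fderiv ℝ c) t :=
    (h.of_le (m := 2) (WithTop.coe_le_coe.2 le_top)).fderiv_right (m := 1) (by norm_num)
  have h2 : DifferentiableAt ℝ (fun s => fderiv ℝ c s 1) t :=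
    (h1.differentiableAt one_ne_zero).clm_apply (differentiableAt_const _)
  exact h2

section Geodesics

variable {n : ℕ} {M : Type*} [TopologicalSpace M]
  [ChartedSpace (EuclideanSpace ℝ (Fin (n + 1))) M] [IsManifold (𝓡 (n + 1)) ∞ M]
  (g : LorentzMetric n M)

namespace LorentzMetric

theorem inChart_eq_zero {p : M} {u : EuclideanSpace ℝ (Fin (n + 1))}
    (hu : u ∈ (extChartAt (𝓡 (n + 1)) p).target) {a : EuclideanSpace ℝ (Fin (n + 1))}
    (ha : ∀ b, g.inChart p u b a = 0) : a = 0 := by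
  have : dChartSymm p u a = 0 := (g.lorentz _).eq_zero_of_forall fun w => by
    have := ha (dChart p _ w)
    rwa [g.inChart_apply, dChartSymm_dChart p hu] at this
  rw [← dChart_dChartSymm p hu a, this, map_zero]

theorem isInvertible_inChart {p : M} {u : EuclideanSpace ℝ (Fin (n + 1))}
    (hu : u ∈ (extChartAt (𝓡 (n + 1)) p).target) : (g.inChart p u).IsInvertible :=
  isInvertible_of_injective <| (injective_iff_map_eq_zero _).2 fun a ha =>
    g.inChart_eq_zero hu fun b => by rw [g.inChart_symm, ha]; rfl

/-- The geodesic vector field `(u, w) ↦ (w, -Γ(u)(w, w))` in the chart at `p`. -/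
def spray (p : M) (z : EuclideanSpace ℝ (Fin (n + 1)) × EuclideanSpace ℝ (Fin (n + 1))) :
    EuclideanSpace ℝ (Fin (n + 1)) × EuclideanSpace ℝ (Fin (n + 1)) :=
  (z.2, -(g.inChart p z.1).inverse (christoffelForm (g.inChart p) z))

theorem eq_spray_snd {p : M} {z : EuclideanSpace ℝ (Fin (n + 1)) × EuclideanSpace ℝ (Fin (n + 1))}
    (hz : z.1 ∈ (extChartAt (𝓡 (n + 1)) p).target) {a : EuclideanSpace ℝ (Fin (n + 1))} :
    (∀ c, g.inChart p z.1 a c + g.christoffel p z.1 z.2 z.2 c = 0) ↔ a = (g.spray p z).2 := by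
  obtain ⟨e, he⟩ := g.isInvertible_inChart hz
  have h1 : (∀ c, g.inChart p z.1 a c + g.christoffel p z.1 z.2 z.2 c = 0) ↔
      e a = -christoffelForm (g.inChart p) z := by
    rw [ContinuousLinearMap.ext_iff]
    refine forall_congr' fun c => ?_
    rw [christoffel, ← christoffelForm_apply, ← he]
    simp [eq_neg_iff_add_eq_zero]
  rw [h1, spray, ← he, ContinuousLinearMap.inverse_equiv]
  constructor
  · intro h
    rw [← e.symm_apply_apply a, h, map_neg]; rfl
  · rintro rfl
    simp

theorem contDiffAt_spray {p : M}
    {z : EuclideanSpace ℝ (Fin (n + 1)) × EuclideanSpace ℝ (Fin (n + 1))}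
    (hz : z.1 ∈ (extChartAt (𝓡 (n + 1)) p).target) : ContDiffAt ℝ ∞ (g.spray p) z := by
  have hG := g.contDiffAt_inChart hz
  have h1 : ContDiffAt ℝ ∞ (fun z : EuclideanSpace ℝ (Fin (n + 1)) × EuclideanSpace ℝ (Fin (n + 1))
      => (g.inChart p z.1).inverse) z :=
    ContDiffAt.comp z (contDiffAt_inverse_form hG (g.isInvertible_inChart hz)) contDiffAt_fst
  exact contDiffAt_snd.prodMk (h1.clm_apply (contDiffAt_christoffelForm hG)).neg

variable {g}

theorem IsGeodesic.mdifferentiableAt {γ : ℝ → M} (hγ : g.IsGeodesic γ) (t : ℝ) :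
    MDifferentiableAt 𝓘(ℝ, ℝ) (𝓡 (n + 1)) γ t := (hγ.1 t).mdifferentiableAt (by simp)

theorem IsGeodesic.continuous {γ : ℝ → M} (hγ : g.IsGeodesic γ) : Continuous γ :=
  hγ.1.continuous

theorem IsGeodesic.contDiffAt_coord {γ : ℝ → M} (hγ : g.IsGeodesic γ) {p : M} {t : ℝ}
    (ht : γ t ∈ (extChartAt (𝓡 (n + 1)) p).source) :
    ContDiffAt ℝ ∞ (fun s => extChartAt (𝓡 (n + 1)) p (γ s)) t := by
  have ht' : γ t ∈ (chartAt (EuclideanSpace ℝ (Fin (n + 1))) p).source := by simpa using ht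
  exact ((contMDiffAt_extChartAt' ht').comp t (hγ.1 t)).contDiffAt

theorem IsGeodesic.hasDerivAt_tangentCoord {γ : ℝ → M} (hγ : g.IsGeodesic γ) {p : M} {t : ℝ}
    (ht : γ t ∈ (extChartAt (𝓡 (n + 1)) p).source) :
    HasDerivAt (fun s => tangentCoord p (velocity γ s))
      (g.spray p (tangentCoord p (velocity γ t))) t := by
  set c : ℝ → EuclideanSpace ℝ (Fin (n + 1)) := fun s => extChartAt (𝓡 (n + 1)) p (γ s) with hc
  have hev : (fun s => tangentCoord p (velocity γ s)) =ᶠ[𝓝 t] fun s => (c s, deriv c s) := by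
    filter_upwards [hγ.continuous.continuousAt.eventually_mem
      ((isOpen_extChartAt_source p).mem_nhds ht)] with s hs
    exact tangentCoord_velocity hs (hγ.mdifferentiableAt s)
  have h1 : ContDiffAt ℝ ∞ c t := hγ.contDiffAt_coord ht
  have h2 : DifferentiableAt ℝ (deriv c) t :=
    differentiableAt_deriv_of_contDiffAt h1
  refine HasDerivAt.congr_of_eventuallyEq ?_ hev
  have e : g.spray p (tangentCoord p (velocity γ t)) = (deriv c t, deriv (deriv c) t) := by
    rw [tangentCoord_velocity ht (hγ.mdifferentiableAt t)]
    refine Prod.ext rfl ?_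
    refine ((g.eq_spray_snd (z := (c t, deriv c t)) ?_).1 ?_).symm
    · exact (extChartAt (𝓡 (n + 1)) p).map_source ht
    · exact hγ.2 p t (by simpa using ht)
  rw [e]
  exact (h1.differentiableAt (by simp)).hasDerivAt.prodMk h2.hasDerivAt

theorem spray_lipschitz {p : M}
    {z : EuclideanSpace ℝ (Fin (n + 1)) × EuclideanSpace ℝ (Fin (n + 1))}
    (hz : z.1 ∈ (extChartAt (𝓡 (n + 1)) p).target) :
    ∃ K, ∃ S ∈ 𝓝 z, LipschitzOnWith K (g.spray p) S :=
  ((g.contDiffAt_spray hz).of_le (by simp)).exists_lipschitzOnWith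

/-- Two solutions of the geodesic equation in a chart that agree at one time agree nearby. -/
theorem spray_unique_eventually {p : M}
    {c d : ℝ → EuclideanSpace ℝ (Fin (n + 1)) × EuclideanSpace ℝ (Fin (n + 1))} {t : ℝ}
    (ht : (c t).1 ∈ (extChartAt (𝓡 (n + 1)) p).target)
    (hc : ∀ᶠ s in 𝓝 t, HasDerivAt c (g.spray p (c s)) s)
    (hd : ∀ᶠ s in 𝓝 t, HasDerivAt d (g.spray p (d s)) s) (h : c t = d t) : c =ᶠ[𝓝 t] d := by
  obtain ⟨K, S, hS, hK⟩ := spray_lipschitz (g := g) ht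
  refine ODE_solution_unique_of_eventually (v := fun _ => g.spray p) (s := fun _ => S)
    (Eventually.of_forall fun _ => hK) (hc.and ?_) (hd.and ?_) h
  · exact hc.self_of_nhds.continuousAt.eventually_mem hS
  · exact hd.self_of_nhds.continuousAt.eventually_mem (h ▸ hS)

theorem IsGeodesic.eventually_hasDerivAt {γ : ℝ → M} (hγ : g.IsGeodesic γ) {p : M} {t : ℝ}
    (ht : γ t ∈ (extChartAt (𝓡 (n + 1)) p).source) :
    ∀ᶠ s in 𝓝 t, HasDerivAt (fun s => tangentCoord p (velocity γ s))
      (g.spray p (tangentCoord p (velocity γ s))) s :=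
  (hγ.continuous.continuousAt.eventually_mem ((isOpen_extChartAt_source p).mem_nhds ht)).mono
    fun _ hs => hγ.hasDerivAt_tangentCoord hs

/-- A geodesic follows a solution of the geodesic equation in a chart for as long as the latter
exists. -/
theorem IsGeodesic.velocity_eq_of_spray [T2Space M] {γ : ℝ → M} (hγ : g.IsGeodesic γ) {p : M}
    {a b t₀ : ℝ} {c : ℝ → EuclideanSpace ℝ (Fin (n + 1)) × EuclideanSpace ℝ (Fin (n + 1))}
    (hc : ∀ t ∈ Ioo a b, (c t).1 ∈ (extChartAt (𝓡 (n + 1)) p).target ∧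
      HasDerivAt c (g.spray p (c t)) t) (ht₀ : t₀ ∈ Ioo a b)
    (h₀ : velocity γ t₀ = (tangentCoord p).symm (c t₀)) :
    ∀ t ∈ Ioo a b, velocity γ t = (tangentCoord p).symm (c t) := by
  set S := {t ∈ Ioo a b | velocity γ t = (tangentCoord p).symm (c t)} with hS
  have hfst : ∀ t ∈ Ioo a b, ((tangentCoord p).symm (c t)).1 =
      (extChartAt (𝓡 (n + 1)) p).symm (c t).1 := fun t ht => by
    rw [tangentCoord_symm_apply (hc t ht).1]
  have hsrc : ∀ t ∈ Ioo a b, γ t = (extChartAt (𝓡 (n + 1)) p).symm (c t).1 →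
      γ t ∈ (extChartAt (𝓡 (n + 1)) p).source := fun t ht h => by
    rw [h]; exact (extChartAt (𝓡 (n + 1)) p).map_target (hc t ht).1
  have hγS : ∀ t ∈ S, γ t = (extChartAt (𝓡 (n + 1)) p).symm (c t).1 := fun t ht => by
    rw [← hfst t ht.1, ← ht.2]; rfl
  have hcoordS : ∀ t ∈ S, tangentCoord p (velocity γ t) = c t := fun t ht => by
    rw [ht.2, (tangentCoord p).right_inv (mem_tangentCoord_target.2 (hc t ht.1).1)]
  have hback : ∀ t, γ t ∈ (extChartAt (𝓡 (n + 1)) p).source →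
      tangentCoord p (velocity γ t) = c t → velocity γ t = (tangentCoord p).symm (c t) := by
    intro t ht h
    rw [← h, (tangentCoord p).left_inv (mem_tangentCoord_source.2 (by exact ht))]
  have hsub : Ioo a b ⊆ S := by
    refine isPreconnected_Ioo.subset_of_closure_inter_subset ?_ ⟨t₀, ht₀, ht₀, h₀⟩ ?_
    · refine isOpen_iff_mem_nhds.2 fun t ht => ?_
      have hts := hsrc t ht.1 (hγS t ht)
      have := spray_unique_eventually (g := g) (p := p)
        (c := fun s => tangentCoord p (velocity γ s)) (d := c) (t := t)
        (by rw [hcoordS t ht]; exact (hc t ht.1).1) (hγ.eventually_hasDerivAt hts)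
        (by filter_upwards [isOpen_Ioo.mem_nhds ht.1] with s hs using (hc s hs).2) (hcoordS t ht)
      filter_upwards [this, isOpen_Ioo.mem_nhds ht.1, hγ.continuous.continuousAt.eventually_mem
        ((isOpen_extChartAt_source p).mem_nhds hts)] with s hs1 hs2 hs3
      exact ⟨hs2, hback s hs3 hs1⟩
    · rintro t ⟨htS, ht⟩
      have hne : (𝓝[S] t).NeBot := mem_closure_iff_nhdsWithin_neBot.1 htS
      have hct := (hc t ht).2.continuousAt
      have h1 : γ t = (extChartAt (𝓡 (n + 1)) p).symm (c t).1 := by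
        have l1 : Tendsto γ (𝓝[S] t) (𝓝 (γ t)) :=
          hγ.continuous.continuousAt.tendsto.mono_left nhdsWithin_le_nhds
        have l2 : Tendsto (fun s => (extChartAt (𝓡 (n + 1)) p).symm (c s).1) (𝓝[S] t)
            (𝓝 ((extChartAt (𝓡 (n + 1)) p).symm (c t).1)) :=
          ((continuousAt_extChartAt_symm'' (hc t ht).1).comp
            (f := fun s => (c s).1) hct.fst).tendsto.mono_left nhdsWithin_le_nhds
        exact tendsto_nhds_unique l1 (l2.congr' (by
          filter_upwards [self_mem_nhdsWithin] with s hs using (hγS s hs).symm))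
      have hts := hsrc t ht h1
      refine ⟨ht, hback t hts ?_⟩
      have l1 : Tendsto (fun s => tangentCoord p (velocity γ s)) (𝓝[S] t) (𝓝 _) :=
        (hγ.hasDerivAt_tangentCoord hts).continuousAt.tendsto.mono_left nhdsWithin_le_nhds
      have l2 : Tendsto c (𝓝[S] t) (𝓝 (c t)) := hct.tendsto.mono_left nhdsWithin_le_nhds
      exact tendsto_nhds_unique l1 (l2.congr' (by
          filter_upwards [self_mem_nhdsWithin] with s hs using (hcoordS s hs).symm))
  exact fun t ht => (hsub ht).2

/-- A geodesic in a Hausdorff manifold is determined by its velocity at one time. -/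
theorem IsGeodesic.eq_of_velocity_eq [T2Space M] {γ δ : ℝ → M} (hγ : g.IsGeodesic γ)
    (hδ : g.IsGeodesic δ) {t₀ : ℝ} (h₀ : velocity (m := n + 1) γ t₀ = velocity δ t₀) : γ = δ := by
  have hpt : ∀ t, velocity (m := n + 1) γ t = velocity δ t → γ t = δ t := fun t h =>
    congrArg TotalSpace.proj h
  have hopen : IsOpen {t | velocity (m := n + 1) γ t = velocity δ t} := by
    refine isOpen_iff_mem_nhds.2 fun t ht => ?_
    have h1 : γ t ∈ (extChartAt (𝓡 (n + 1)) (γ t)).source := mem_extChartAt_source _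
    have h2 : δ t ∈ (extChartAt (𝓡 (n + 1)) (γ t)).source := by rw [← hpt t ht]; exact h1
    have := spray_unique_eventually (g := g) (p := γ t)
        (c := fun s => tangentCoord (γ t) (velocity γ s))
        (d := fun s => tangentCoord (γ t) (velocity δ s)) (t := t)
        (by
          rw [tangentCoord_velocity h1 (hγ.mdifferentiableAt t)]
          exact mem_extChartAt_target _)
        (hγ.eventually_hasDerivAt h1) (hδ.eventually_hasDerivAt h2)
        (congrArg _ ht)
    filter_upwards [this, hγ.continuous.continuousAt.eventually_mem
        ((isOpen_extChartAt_source _).mem_nhds h1), hδ.continuous.continuousAt.eventually_mem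
        ((isOpen_extChartAt_source _).mem_nhds h2)] with s hs h1s h2s
    exact (tangentCoord (γ t)).injOn (mem_tangentCoord_source.2 (by exact h1s))
      (mem_tangentCoord_source.2 (by exact h2s)) hs
  have hclosed : IsClosed {t | velocity (m := n + 1) γ t = velocity δ t} := by
    refine isClosed_of_closure_subset fun t ht => ?_
    have hne := mem_closure_iff_nhdsWithin_neBot.1 ht
    have h0 : γ t = δ t := by
      refine (isClosed_eq hγ.continuous hδ.continuous).closure_subset_iff.2 ?_ ht
      exact fun s hs => hpt s hs
    have h1 : γ t ∈ (extChartAt (𝓡 (n + 1)) (γ t)).source := mem_extChartAt_source _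
    have h2 : δ t ∈ (extChartAt (𝓡 (n + 1)) (γ t)).source := by rw [← h0]; exact h1
    refine (tangentCoord (γ t)).injOn (mem_tangentCoord_source.2 (by exact h1))
      (mem_tangentCoord_source.2 (by exact h2)) ?_
    have l1 := (hγ.hasDerivAt_tangentCoord h1).continuousAt.tendsto.mono_left
      (nhdsWithin_le_nhds (s := {t | velocity (m := n + 1) γ t = velocity δ t}))
    have l2 := (hδ.hasDerivAt_tangentCoord h2).continuousAt.tendsto.mono_left
      (nhdsWithin_le_nhds (s := {t | velocity (m := n + 1) γ t = velocity δ t}))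
    exact tendsto_nhds_unique l1 (l2.congr' (by
      filter_upwards [self_mem_nhdsWithin] with s hs
      exact congrArg _ (Eq.symm hs)))
  have huniv := IsClopen.eq_univ ⟨hclosed, hopen⟩ ⟨t₀, h₀⟩
  funext t
  exact hpt t (huniv ▸ mem_univ t : t ∈ {t | velocity (m := n + 1) γ t = velocity δ t})

theorem velocity_comp_affine {γ : ℝ → M} (hγ : g.IsGeodesic γ) (a b t : ℝ) :
    velocity (m := n + 1) (fun t => γ (a * t + b)) t =
      ⟨γ (a * t + b), a • (velocity γ (a * t + b)).2⟩ := by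
  have h1 : HasDerivAt (fun t : ℝ => a * t + b) a t := by
    simpa using ((hasDerivAt_id t).const_mul a).add_const b
  have h2 := mfderiv_comp t (I := 𝓘(ℝ, ℝ)) (I' := 𝓘(ℝ, ℝ)) (I'' := 𝓡 (n + 1)) (g := γ)
    (f := fun t : ℝ => a * t + b) (hγ.mdifferentiableAt (a * t + b))
    h1.differentiableAt.mdifferentiableAt
  rw [mfderiv_eq_fderiv, h1.hasFDerivAt.fderiv] at h2
  change (⟨γ (a * t + b), mfderiv 𝓘(ℝ, ℝ) (𝓡 (n + 1)) (γ ∘ fun t : ℝ => a * t + b) t (1 : ℝ)⟩ :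
    TangentBundle (𝓡 (n + 1)) M) = _
  rw [h2]
  congr 1
  change mfderiv 𝓘(ℝ, ℝ) (𝓡 (n + 1)) γ (a * t + b)
    ((ContinuousLinearMap.toSpanSingleton ℝ a : ℝ →L[ℝ] ℝ) (1 : ℝ)) = _
  rw [ContinuousLinearMap.toSpanSingleton_apply, one_smul]
  have h3 := (mfderiv 𝓘(ℝ, ℝ) (𝓡 (n + 1)) γ (a * t + b)).map_smul a (1 : ℝ)
  refine Eq.trans (congrArg _ ?_) h3
  exact (mul_one a).symm

theorem IsGeodesic.comp_affine {γ : ℝ → M} (hγ : g.IsGeodesic γ) (a b : ℝ) :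
    g.IsGeodesic (fun t => γ (a * t + b)) := by
  refine ⟨hγ.1.comp (ContDiff.contMDiff (by fun_prop)), fun p t ht w => ?_⟩
  intro c'
  set c : ℝ → EuclideanSpace ℝ (Fin (n + 1)) := fun s => extChartAt (𝓡 (n + 1)) p (γ s) with hc
  have hts : γ (a * t + b) ∈ (extChartAt (𝓡 (n + 1)) p).source := by simpa using ht
  have h1 : ContDiffAt ℝ ∞ c (a * t + b) := hγ.contDiffAt_coord hts
  have haff : ∀ s, HasDerivAt (fun t : ℝ => a * t + b) a s := fun s => by
    simpa using ((hasDerivAt_id s).const_mul a).add_const b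
  have hd : deriv c' =ᶠ[𝓝 t] fun s => a • deriv c (a * s + b) := by
    have hcont : ContinuousAt (fun t : ℝ => a * t + b) t := (haff t).continuousAt
    filter_upwards [hcont.eventually ((h1.of_le (by simp : (1 : WithTop ℕ∞) ≤ ∞)).eventually
      (by simp))] with s hs
    exact ((hs.differentiableAt (by simp)).hasDerivAt.scomp s (haff s)).deriv
  have h2 : DifferentiableAt ℝ (deriv c) (a * t + b) :=
    differentiableAt_deriv_of_contDiffAt h1
  have hdd : deriv (deriv c') t = a • a • deriv (deriv c) (a * t + b) := by
    rw [hd.deriv_eq]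
    exact ((h2.hasDerivAt.scomp t (haff t)).const_smul a).deriv
  have := hγ.2 p (a * t + b) ht w
  simp only at this
  rw [hdd, hd.self_of_nhds]
  change g.inChart p (c (a * t + b)) _ w + g.christoffel p (c (a * t + b)) _ _ w = 0
  have h3 : g.christoffel p (c (a * t + b)) (a • deriv c (a * t + b)) (a • deriv c (a * t + b)) w
      = a * a * g.christoffel p (c (a * t + b)) (deriv c (a * t + b)) (deriv c (a * t + b)) w := by
    exact christoffel_smul_smul _ _ _ _
  rw [h3]
  rw [smul_smul, map_smul, smul_apply, smul_eq_mul, ← mul_add]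
  exact mul_eq_zero_of_right _ this

/-! ### The geodesic flow -/

theorem IsComplete.geodesic_spec (hg : g.IsComplete) (q : TangentBundle (𝓡 (n + 1)) M) :
    g.IsGeodesic (g.geodesic q) ∧ velocity (g.geodesic q) 0 = q := by
  have h := hg q
  rw [geodesic, dif_pos h]
  exact h.choose_spec

theorem IsComplete.flow_zero (hg : g.IsComplete) (q : TangentBundle (𝓡 (n + 1)) M) :
    g.flow 0 q = q := (hg.geodesic_spec q).2

theorem IsComplete.flow_eq [T2Space M] (hg : g.IsComplete) {q : TangentBundle (𝓡 (n + 1)) M}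
    {γ : ℝ → M} (hγ : g.IsGeodesic γ) (h : velocity γ 0 = q) (t : ℝ) :
    g.flow t q = velocity γ t := by
  rw [flow, (hg.geodesic_spec q).1.eq_of_velocity_eq hγ ((hg.geodesic_spec q).2.trans h.symm)]

theorem IsComplete.flow_add [T2Space M] (hg : g.IsComplete) (s t : ℝ)
    (q : TangentBundle (𝓡 (n + 1)) M) : g.flow (s + t) q = g.flow s (g.flow t q) := by
  have hγ := (hg.geodesic_spec q).1
  have h1 : ∀ s, velocity (fun s => g.geodesic q (1 * s + t)) s = g.flow (s + t) q := fun s => by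
    rw [velocity_comp_affine hγ, one_smul, one_mul]; rfl
  rw [hg.flow_eq (q := g.flow t q) (hγ.comp_affine 1 t) (by rw [h1, zero_add]), h1]

theorem IsComplete.flow_smul [T2Space M] (hg : g.IsComplete) (a t : ℝ) (x : M)
    (v : TangentSpace (𝓡 (n + 1)) x) :
    g.flow t ⟨x, a • v⟩ = ⟨(g.flow (a * t) ⟨x, v⟩).1, a • (g.flow (a * t) ⟨x, v⟩).2⟩ := by
  have hγ := (hg.geodesic_spec ⟨x, v⟩).1
  have h1 : ∀ s, velocity (fun s => g.geodesic ⟨x, v⟩ (a * s + 0)) s =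
      ⟨(g.flow (a * s) ⟨x, v⟩).1, a • (g.flow (a * s) ⟨x, v⟩).2⟩ := fun s => by
    rw [velocity_comp_affine hγ, add_zero]; rfl
  rw [hg.flow_eq (hγ.comp_affine a 0) (by rw [h1, mul_zero, hg.flow_zero]), h1]

end LorentzMetric
end Geodesics

/-! ### Conservation of energy and the first variation in coordinates -/

section FormField

variable {E : Type*} [NormedAddCommGroup E] [NormedSpace ℝ E] {G : E → E →L[ℝ] E →L[ℝ] ℝ}

/-- The energy `G(u)(w, w)` of `z = (u, w)`. -/
def formEnergy (G : E → E →L[ℝ] E →L[ℝ] ℝ) (z : E × E) : ℝ := G z.1 z.2 z.2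

set_option maxSynthPendingDepth 3 in
theorem hasDerivAt_form_apply {a b c : ℝ → E} {a' b' c' : E} {t : ℝ}
    (hG : DifferentiableAt ℝ G (a t)) (ha : HasDerivAt a a' t) (hb : HasDerivAt b b' t)
    (hc : HasDerivAt c c' t) :
    HasDerivAt (fun s => G (a s) (b s) (c s))
      (fderiv ℝ G (a t) a' (b t) (c t) + G (a t) b' (c t) + G (a t) (b t) c') t := by
  have h1 := hG.hasFDerivAt.comp_hasDerivAt t ha
  have h2 := (h1.clm_apply hb).clm_apply hc
  simpa using h2

set_option maxSynthPendingDepth 3 in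
theorem hasFDerivAt_formEnergy {z : E × E} (hG : DifferentiableAt ℝ G z.1) :
    ∃ L : E × E →L[ℝ] ℝ, HasFDerivAt (formEnergy G) L z ∧
      ∀ δ : E × E, L δ = fderiv ℝ G z.1 δ.1 z.2 z.2 + G z.1 δ.2 z.2 + G z.1 z.2 δ.2 := by
  have h1 : HasFDerivAt (fun z : E × E => G z.1) _ z :=
    HasFDerivAt.comp z hG.hasFDerivAt hasFDerivAt_fst
  have h2 := (h1.clm_apply (hasFDerivAt_snd (p := z))).clm_apply (hasFDerivAt_snd (p := z))
  refine ⟨_, h2, fun δ => ?_⟩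
  simp
  ring

variable {f : E × E → E × E}

/-- The energy is constant along solutions of the geodesic equation. -/
theorem formEnergy_hasDerivAt (hsymm : ∀ u a b, G u a b = G u b a) {c : ℝ → E × E} {t : ℝ}
    (hG : DifferentiableAt ℝ G (c t).1) (hf1 : (f (c t)).1 = (c t).2)
    (hf2 : ∀ w, G (c t).1 (f (c t)).2 w + christoffelForm G (c t) w = 0)
    (hc : HasDerivAt c (f (c t)) t) : HasDerivAt (fun s => formEnergy G (c s)) 0 t := by
  have h := hasDerivAt_form_apply hG hc.fst hc.snd hc.snd
  refine h.congr_deriv ?_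
  have h2 := hf2 (c t).2
  rw [show c t = ((c t).1, (c t).2) from rfl, christoffelForm_apply] at h2
  rw [hsymm _ (c t).2, hf1]
  simp only at h2
  linarith

/-- The derivative of `G(c, η)` for a Jacobi field `η` along a solution `c` of the geodesic
equation. -/
theorem hasDerivAt_form_variation (hsymm : ∀ u a b, G u a b = G u b a) {c η : ℝ → E × E} {t : ℝ}
    (hG : DifferentiableAt ℝ G (c t).1) (hf : DifferentiableAt ℝ f (c t))
    (hf1 : ∀ z, (f z).1 = z.2)
    (hf2 : ∀ w, G (c t).1 (f (c t)).2 w + christoffelForm G (c t) w = 0)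
    (hc : HasDerivAt c (f (c t)) t) (hη : HasDerivAt η (fderiv ℝ f (c t) (η t)) t) :
    HasDerivAt (fun s => G (c s).1 (c s).2 (η s).1)
      (1 / 2 * fderiv ℝ (formEnergy G) (c t) (η t)) t := by
  have h := hasDerivAt_form_apply hG hc.fst hc.snd hη.fst
  refine h.congr_deriv ?_
  obtain ⟨L, hL, hL'⟩ := hasFDerivAt_formEnergy hG
  rw [hL.fderiv, hL', hf1]
  have h1 : (fderiv ℝ f (c t) (η t)).1 = (η t).2 := by
    have e1 := hf.hasFDerivAt.fst
    have e2 : HasFDerivAt (fun z : E × E => (f z).1) (ContinuousLinearMap.snd ℝ E E) (c t) := by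
      simp only [hf1]; exact hasFDerivAt_snd
    exact DFunLike.congr_fun (e1.unique e2) (η t)
  have h2 := hf2 (η t).1
  rw [show c t = ((c t).1, (c t).2) from rfl, christoffelForm_apply] at h2
  rw [h1, hsymm _ (η t).2 (c t).2]
  simp only at h2
  linarith

end FormField

/-! ### Regularity of the geodesic flow -/

section Flow

variable {n : ℕ} {M : Type*} [TopologicalSpace M]
  [ChartedSpace (EuclideanSpace ℝ (Fin (n + 1))) M] [IsManifold (𝓡 (n + 1)) ∞ M]
  {g : LorentzMetric n M}

namespace LorentzMetric

theorem inChart_spray_add {p : M}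
    {z : EuclideanSpace ℝ (Fin (n + 1)) × EuclideanSpace ℝ (Fin (n + 1))}
    (hz : z.1 ∈ (extChartAt (𝓡 (n + 1)) p).target) (w : EuclideanSpace ℝ (Fin (n + 1))) :
    g.inChart p z.1 (g.spray p z).2 w + christoffelForm (g.inChart p) z w = 0 := by
  rw [show z = (z.1, z.2) from rfl, christoffelForm_apply]
  exact (g.eq_spray_snd hz).2 rfl w

variable (g) in
/-- The time `t` geodesic flow written in the bundle charts at `p` and `p'`. -/
def flowCoord (t : ℝ) (p p' : M)
    (z : EuclideanSpace ℝ (Fin (n + 1)) × EuclideanSpace ℝ (Fin (n + 1))) :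
    EuclideanSpace ℝ (Fin (n + 1)) × EuclideanSpace ℝ (Fin (n + 1)) :=
  tangentCoord p' (g.flow t ((tangentCoord p).symm z))

variable (g) in
/-- The time `t` flow is continuous at `q`, continuously differentiable in the charts at `p` and
`p'`, preserves the energy, and satisfies the first variation formula there. -/
structure FlowRegularAt (t : ℝ) (p p' : M) (q : TangentBundle (𝓡 (n + 1)) M) : Prop where
  source : q.1 ∈ (extChartAt (𝓡 (n + 1)) p).source
  source' : (g.flow t q).1 ∈ (extChartAt (𝓡 (n + 1)) p').source
  continuousAt : ContinuousAt (g.flow t) q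
  contDiffAt : ContDiffAt ℝ 1 (g.flowCoord t p p') (tangentCoord p q)
  energy : ∀ᶠ z in 𝓝 (tangentCoord p q),
    formEnergy (g.inChart p') (g.flowCoord t p p' z) = formEnergy (g.inChart p) z
  variation : ∀ᶠ z in 𝓝 (tangentCoord p q),
    ∀ δ, g.inChart p' (g.flowCoord t p p' z).1 (g.flowCoord t p p' z).2
      (fderiv ℝ (g.flowCoord t p p') z δ).1 =
      g.inChart p z.1 z.2 δ.1 + t / 2 * fderiv ℝ (formEnergy (g.inChart p)) z δ

theorem differentiableAt_inChart {p : M} {u : EuclideanSpace ℝ (Fin (n + 1))}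
    (hu : u ∈ (extChartAt (𝓡 (n + 1)) p).target) : DifferentiableAt ℝ (g.inChart p) u :=
  (g.contDiffAt_inChart hu).differentiableAt (by simp)

/-- For small times the flow stays in one chart, where its regularity is that of the solutions of
the geodesic equation, whose derivatives in the initial value are Jacobi fields. -/
theorem IsComplete.flowRegularAt_local [T2Space M] (hg : g.IsComplete)
    (q : TangentBundle (𝓡 (n + 1)) M) :
    ∃ ε > 0, ∀ᶠ q' in 𝓝 q, ∀ t ∈ Ioo (-ε) ε, g.FlowRegularAt t q.1 q.1 q' := by
  set p := q.1 with hp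
  have hq : q.1 ∈ (extChartAt (𝓡 (n + 1)) p).source := mem_extChartAt_source _
  set z₀ := tangentCoord p q with hz₀
  have hqs : q ∈ (tangentCoord p).source := mem_tangentCoord_source.2 hq
  have hz₀t : z₀ ∈ (tangentCoord p).target := (tangentCoord p).map_source hqs
  obtain ⟨r, hr, ε, hε, φ, ψ, hφ, hψ⟩ := exists_local_flow
    ((g.contDiffAt_spray (mem_tangentCoord_target.1 hz₀t)).of_le (WithTop.coe_le_coe.2 le_top))
    ((tangentCoord p).open_target.mem_nhds hz₀t)
  have hzero : (0 : ℝ) ∈ Ioo (-ε) ε := ⟨by linarith, hε⟩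
  have htgt : ∀ z ∈ Metric.ball z₀ r, ∀ t ∈ Ioo (-ε) ε,
      (φ z t).1 ∈ (extChartAt (𝓡 (n + 1)) p).target := fun z hz t ht =>
    mem_tangentCoord_target.1 ((hφ z hz).2.2 t ht).1
  have hflow : ∀ z ∈ Metric.ball z₀ r, ∀ t ∈ Ioo (-ε) ε,
      g.flow t ((tangentCoord p).symm z) = (tangentCoord p).symm (φ z t) := by
    intro z hz t ht
    obtain ⟨hγ, h0⟩ := hg.geodesic_spec ((tangentCoord p).symm z)
    exact hγ.velocity_eq_of_spray (c := φ z) (p := p)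
      (fun t ht => ⟨htgt z hz t ht, ((hφ z hz).2.2 t ht).2.1⟩) hzero
      (by rw [h0, (hφ z hz).1]) t ht
  have hcoord : ∀ z ∈ Metric.ball z₀ r, ∀ t ∈ Ioo (-ε) ε, g.flowCoord t p p z = φ z t := by
    intro z hz t ht
    rw [flowCoord, hflow z hz t ht, (tangentCoord p).right_inv ((hφ z hz).2.2 t ht).1]
  have hder : ∀ t ∈ Ioo (-ε) ε, ∀ z ∈ Metric.ball z₀ r,
      HasFDerivAt (g.flowCoord t p p) (ψ z t) z := fun t ht z hz =>
    ((hφ z hz).2.2 t ht).2.2.2.congr_of_eventuallyEq (by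
      filter_upwards [Metric.isOpen_ball.mem_nhds hz] with y hy using hcoord y hy t ht)
  have henergy : ∀ t ∈ Ioo (-ε) ε, ∀ z ∈ Metric.ball z₀ r,
      formEnergy (g.inChart p) (φ z t) = formEnergy (g.inChart p) z := by
    intro t ht z hz
    have hd : ∀ t ∈ Ioo (-ε) ε, HasDerivAt (fun s => formEnergy (g.inChart p) (φ z s)) 0 t :=
      fun t ht => formEnergy_hasDerivAt (f := g.spray p) (g.inChart_symm p)
        (differentiableAt_inChart (htgt z hz t ht)) rfl (inChart_spray_add (htgt z hz t ht))
        ((hφ z hz).2.2 t ht).2.1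
    have := isOpen_Ioo.is_const_of_deriv_eq_zero isPreconnected_Ioo
      (fun t ht => (hd t ht).differentiableAt.differentiableWithinAt)
      (fun t ht => (hd t ht).deriv) ht hzero
    simpa only [(hφ z hz).1] using this
  have henergy' : ∀ t ∈ Ioo (-ε) ε, ∀ z ∈ Metric.ball z₀ r, ∀ δ,
      fderiv ℝ (formEnergy (g.inChart p)) (φ z t) (ψ z t δ) =
        fderiv ℝ (formEnergy (g.inChart p)) z δ := by
    intro t ht z hz δ
    obtain ⟨L, hL, -⟩ := hasFDerivAt_formEnergy (differentiableAt_inChart (htgt z hz t ht))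
    have h1 := hL.comp z ((hφ z hz).2.2 t ht).2.2.2
    have h2 : formEnergy (g.inChart p) =ᶠ[𝓝 z] formEnergy (g.inChart p) ∘ fun z => φ z t := by
      filter_upwards [Metric.isOpen_ball.mem_nhds hz] with y hy using (henergy t ht y hy).symm
    rw [(h1.congr_of_eventuallyEq h2).fderiv, hL.fderiv]
    rfl
  have hvar : ∀ t ∈ Ioo (-ε) ε, ∀ z ∈ Metric.ball z₀ r, ∀ δ,
      g.inChart p (φ z t).1 (φ z t).2 (ψ z t δ).1 = g.inChart p z.1 z.2 δ.1 +
        t / 2 * fderiv ℝ (formEnergy (g.inChart p)) z δ := by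
    intro t ht z hz δ
    have hd : ∀ t ∈ Ioo (-ε) ε, HasDerivAt
        (fun s => g.inChart p (φ z s).1 (φ z s).2 (ψ z s δ).1 -
          s / 2 * fderiv ℝ (formEnergy (g.inChart p)) z δ) 0 t := by
      intro t ht
      have e := hasDerivAt_form_variation (f := g.spray p) (c := φ z) (η := fun s => ψ z s δ)
        (g.inChart_symm p)
        (differentiableAt_inChart (htgt z hz t ht))
        ((g.contDiffAt_spray (htgt z hz t ht)).differentiableAt (by simp)) (fun _ => rfl)
        (inChart_spray_add (htgt z hz t ht)) ((hφ z hz).2.2 t ht).2.1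
        (by simpa using ((hφ z hz).2.2 t ht).2.2.1.clm_apply (hasDerivAt_const t δ))
      rw [henergy' t ht z hz] at e
      refine (e.sub (((hasDerivAt_id t).div_const 2).mul_const _)).congr_deriv ?_
      simp
    have := isOpen_Ioo.is_const_of_deriv_eq_zero isPreconnected_Ioo
      (fun t ht => (hd t ht).differentiableAt.differentiableWithinAt)
      (fun t ht => (hd t ht).deriv) ht hzero
    simp only [(hφ z hz).1, (hφ z hz).2.1, zero_div, zero_mul, sub_zero] at this
    have h3 := sub_eq_iff_eq_add.1 this
    simpa using h3
  refine ⟨ε, hε, ?_⟩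
  filter_upwards [(tangentCoord p).open_source.mem_nhds hqs,
    ((tangentCoord p).continuousAt hqs).eventually_mem (Metric.ball_mem_nhds z₀ hr)]
    with q' hq's hq'b t ht
  have hnear : ∀ᶠ z in 𝓝 (tangentCoord p q'), z ∈ Metric.ball z₀ r :=
    Metric.isOpen_ball.mem_nhds hq'b
  have hq'f : g.flow t q' = (tangentCoord p).symm (φ (tangentCoord p q') t) := by
    rw [← hflow _ hq'b t ht, (tangentCoord p).left_inv hq's]
  refine ⟨mem_tangentCoord_source.1 hq's, ?_, ?_, ?_, ?_, ?_⟩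
  · rw [hq'f]
    exact mem_tangentCoord_source.1 ((tangentCoord p).map_target ((hφ _ hq'b).2.2 t ht).1)
  · have h1 : g.flow t =ᶠ[𝓝 q'] fun q => (tangentCoord p).symm (φ (tangentCoord p q) t) := by
      filter_upwards [(tangentCoord p).open_source.mem_nhds hq's,
        ((tangentCoord p).continuousAt hq's).eventually hnear] with q'' h1 h2
      rw [← hflow _ h2 t ht, (tangentCoord p).left_inv h1]
    refine ContinuousAt.congr ?_ h1.symm
    exact ((tangentCoord p).symm.continuousAt ((hφ _ hq'b).2.2 t ht).1).comp
      (f := fun q => φ (tangentCoord p q) t)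
      ((((hφ _ hq'b).2.2 t ht).2.2.2.continuousAt).comp (f := tangentCoord p)
        (g := fun z => φ z t) ((tangentCoord p).continuousAt hq's))
  · exact contDiffAt_one_iff.2 ⟨fun z => ψ z t, Metric.ball z₀ r,
      Metric.isOpen_ball.mem_nhds hq'b, hψ t ht, hder t ht⟩
  · filter_upwards [hnear] with z hz
    rw [hcoord z hz t ht, henergy t ht z hz]
  · filter_upwards [hnear] with z hz δ
    rw [hcoord z hz t ht, (hder t ht z hz).fderiv, hvar t ht z hz]

end LorentzMetric
end Flow

section Flow

variable {n : ℕ} {M : Type*} [TopologicalSpace M]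
  [ChartedSpace (EuclideanSpace ℝ (Fin (n + 1))) M] [IsManifold (𝓡 (n + 1)) ∞ M]
  {g : LorentzMetric n M}

namespace LorentzMetric

theorem flowCoord_tangentCoord {t : ℝ} {p p' : M} {q : TangentBundle (𝓡 (n + 1)) M}
    (hq : q.1 ∈ (extChartAt (𝓡 (n + 1)) p).source) :
    g.flowCoord t p p' (tangentCoord p q) = tangentCoord p' (g.flow t q) := by
  rw [flowCoord, (tangentCoord p).left_inv (mem_tangentCoord_source.2 hq)]

theorem FlowRegularAt.eventually_source {t : ℝ} {p p' : M} {q : TangentBundle (𝓡 (n + 1)) M}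
    (h : g.FlowRegularAt t p p' q) : ∀ᶠ z in 𝓝 (tangentCoord p q),
      z.1 ∈ (extChartAt (𝓡 (n + 1)) p).target ∧
      (g.flow t ((tangentCoord p).symm z)).1 ∈ (extChartAt (𝓡 (n + 1)) p').source ∧
      (g.flowCoord t p p' z).1 ∈ (extChartAt (𝓡 (n + 1)) p').target := by
  have hqs := mem_tangentCoord_source.2 h.source
  have hqt := (tangentCoord p).map_source hqs
  have h1 : ContinuousAt (fun z => g.flow t ((tangentCoord p).symm z)) (tangentCoord p q) := by
    refine ContinuousAt.comp (g := g.flow t) ?_ ((tangentCoord p).symm.continuousAt hqt)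
    rw [(tangentCoord p).left_inv hqs]
    exact h.continuousAt
  have h2 : g.flow t ((tangentCoord p).symm (tangentCoord p q)) ∈ (tangentCoord p').source := by
    rw [(tangentCoord p).left_inv hqs]
    exact mem_tangentCoord_source.2 h.source'
  filter_upwards [h1.eventually_mem ((tangentCoord p').open_source.mem_nhds h2),
    (tangentCoord p).open_target.mem_nhds hqt] with z hz hz'
  exact ⟨mem_tangentCoord_target.1 hz', mem_tangentCoord_source.1 hz,
    mem_tangentCoord_target.1 ((tangentCoord p').map_source hz)⟩

/-- Regularity of the flow is inherited by compositions: the energy is preserved, so that the terms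
`t / 2 * dE` of the first variation formula add up. -/
theorem FlowRegularAt.comp [T2Space M] (hg : g.IsComplete) {s t : ℝ} {p p' p'' : M}
    {q : TangentBundle (𝓡 (n + 1)) M} (hs : g.FlowRegularAt s p' p'' (g.flow t q))
    (ht : g.FlowRegularAt t p p' q) : g.FlowRegularAt (s + t) p p'' q := by
  have hΨ : g.flowCoord t p p' (tangentCoord p q) = tangentCoord p' (g.flow t q) :=
    flowCoord_tangentCoord ht.source
  have hcont : Tendsto (g.flowCoord t p p') (𝓝 (tangentCoord p q))
      (𝓝 (tangentCoord p' (g.flow t q))) := hΨ ▸ ht.contDiffAt.continuousAt.tendsto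
  have hev : ∀ᶠ z in 𝓝 (tangentCoord p q),
      g.flowCoord (s + t) p p'' z = g.flowCoord s p' p'' (g.flowCoord t p p' z) := by
    filter_upwards [ht.eventually_source] with z hz
    simp only [flowCoord]
    rw [(tangentCoord p').left_inv (mem_tangentCoord_source.2 hz.2.1), hg.flow_add]
  have hd1 : ∀ᶠ z in 𝓝 (tangentCoord p q), DifferentiableAt ℝ (g.flowCoord t p p') z :=
    (ht.contDiffAt.eventually (by simp)).mono fun z h => h.differentiableAt one_ne_zero
  have hd2 : ∀ᶠ z in 𝓝 (tangentCoord p' (g.flow t q)),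
      DifferentiableAt ℝ (g.flowCoord s p' p'') z :=
    (hs.contDiffAt.eventually (by simp)).mono fun z h => h.differentiableAt one_ne_zero
  refine ⟨ht.source, ?_, ?_, ?_, ?_, ?_⟩
  · rw [hg.flow_add]; exact hs.source'
  · rw [show g.flow (s + t) = g.flow s ∘ g.flow t from funext (hg.flow_add s t)]
    exact hs.continuousAt.comp ht.continuousAt
  · have := (ContDiffAt.comp (tangentCoord p q) (hΨ.symm ▸ hs.contDiffAt) ht.contDiffAt)
    exact this.congr_of_eventuallyEq hev
  · filter_upwards [hev, ht.energy, hcont.eventually hs.energy] with z h1 h2 h3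
    rw [h1, h3, h2]
  · filter_upwards [hev.eventually_nhds, ht.energy.eventually_nhds, ht.variation,
      hcont.eventually hs.variation, hd1, hcont.eventually hd2, ht.eventually_source]
      with z h1 h2 h3 h4 h5 h6 h7 δ
    have e1 : fderiv ℝ (g.flowCoord (s + t) p p'') z =
        (fderiv ℝ (g.flowCoord s p' p'') (g.flowCoord t p p' z)).comp
          (fderiv ℝ (g.flowCoord t p p') z) := by
      rw [Filter.EventuallyEq.fderiv_eq h1]
      exact fderiv_comp z h6 h5
    obtain ⟨L, hL, -⟩ := hasFDerivAt_formEnergy (differentiableAt_inChart (g := g) h7.2.2)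
    have e2 : fderiv ℝ (formEnergy (g.inChart p)) z =
        (fderiv ℝ (formEnergy (g.inChart p')) (g.flowCoord t p p' z)).comp
          (fderiv ℝ (g.flowCoord t p p') z) := by
      rw [← Filter.EventuallyEq.fderiv_eq h2]
      exact fderiv_comp z hL.differentiableAt h5
    have h4' := h4 (fderiv ℝ (g.flowCoord t p p') z δ)
    have e3 := DFunLike.congr_fun e2 δ
    simp only [ContinuousLinearMap.comp_apply] at e3
    rw [e1, h1.self_of_nhds, ContinuousLinearMap.comp_apply, h4', h3, e3]
    ring

/-- The metric in two charts is related by the derivative of the change of coordinates. -/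
theorem inChart_coordChange {p p' : M} {u : EuclideanSpace ℝ (Fin (n + 1))}
    (hu : u ∈ (extChartAt (𝓡 (n + 1)) p).target)
    (hu' : (extChartAt (𝓡 (n + 1)) p).symm u ∈ (extChartAt (𝓡 (n + 1)) p').source)
    (a b : EuclideanSpace ℝ (Fin (n + 1))) :
    g.inChart p' ((extChartAt (𝓡 (n + 1)) p' ∘ (extChartAt (𝓡 (n + 1)) p).symm) u)
      (fderiv ℝ (extChartAt (𝓡 (n + 1)) p' ∘ (extChartAt (𝓡 (n + 1)) p).symm) u a)
      (fderiv ℝ (extChartAt (𝓡 (n + 1)) p' ∘ (extChartAt (𝓡 (n + 1)) p).symm) u b) =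
      g.inChart p u a b := by
  have h : ∀ a, dChart p' ((extChartAt (𝓡 (n + 1)) p).symm u) (dChartSymm p u a) =
      fderiv ℝ (extChartAt (𝓡 (n + 1)) p' ∘ (extChartAt (𝓡 (n + 1)) p).symm) u a := fun a => by
    have h1 := tangentCoord_symm_tangentCoord (z := (u, a)) hu hu'
    rw [tangentCoord_symm_apply (z := (u, a)) hu, tangentCoord_apply (by exact hu')] at h1
    exact congrArg Prod.snd h1
  rw [← h, ← h, g.inChart_apply]
  exact g.inChart_dChart hu' _ _

theorem IsComplete.flowRegularAt_zero (hg : g.IsComplete) {p p' : M}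
    {q : TangentBundle (𝓡 (n + 1)) M} (hp : q.1 ∈ (extChartAt (𝓡 (n + 1)) p).source)
    (hp' : q.1 ∈ (extChartAt (𝓡 (n + 1)) p').source) : g.FlowRegularAt 0 p p' q := by
  have hflow : g.flow 0 = id := funext hg.flow_zero
  have hqs := mem_tangentCoord_source.2 hp
  have hqt := (tangentCoord p).map_source hqs
  have hnear : ∀ᶠ z in 𝓝 (tangentCoord p q), z.1 ∈ (extChartAt (𝓡 (n + 1)) p).target ∧
      (extChartAt (𝓡 (n + 1)) p).symm z.1 ∈ (extChartAt (𝓡 (n + 1)) p').source := by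
    have h1 : (tangentCoord p).symm (tangentCoord p q) ∈ (tangentCoord p').source := by
      rw [(tangentCoord p).left_inv hqs]
      exact mem_tangentCoord_source.2 hp'
    filter_upwards [(tangentCoord p).open_target.mem_nhds hqt,
      ((tangentCoord p).symm.continuousAt hqt).eventually_mem
        ((tangentCoord p').open_source.mem_nhds h1)] with z hz hz'
    rw [mem_tangentCoord_target] at hz
    rw [mem_tangentCoord_source, tangentCoord_symm_apply hz] at hz'
    exact ⟨hz, hz'⟩
  set τ := extChartAt (𝓡 (n + 1)) p' ∘ (extChartAt (𝓡 (n + 1)) p).symm with hτ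
  have hev : ∀ᶠ z in 𝓝 (tangentCoord p q),
      g.flowCoord 0 p p' z = (τ z.1, fderiv ℝ τ z.1 z.2) := by
    filter_upwards [hnear] with z hz
    rw [flowCoord, hg.flow_zero, tangentCoord_symm_tangentCoord hz.1 hz.2]
  have hτd : ∀ᶠ z in 𝓝 (tangentCoord p q), ContDiffAt ℝ ∞ τ z.1 := by
    filter_upwards [hnear] with z hz using contDiffAt_coordChange hz.1 hz.2
  refine ⟨hp, by rwa [hflow], by rw [hflow]; exact continuousAt_id, ?_, ?_, ?_⟩
  · have h1 := hτd.self_of_nhds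
    have h2 : ContDiffAt ℝ 1 (fun z : EuclideanSpace ℝ (Fin (n + 1)) ×
        EuclideanSpace ℝ (Fin (n + 1)) => fderiv ℝ τ z.1) (tangentCoord p q) :=
      ContDiffAt.comp _ ((h1.of_le (m := 2) (WithTop.coe_le_coe.2 le_top)).fderiv_right (m := 1)
        (by norm_num)) contDiffAt_fst
    have h3 : ContDiffAt ℝ 1 (fun z : EuclideanSpace ℝ (Fin (n + 1)) ×
        EuclideanSpace ℝ (Fin (n + 1)) => τ z.1) (tangentCoord p q) :=
      ContDiffAt.comp (g := τ) (f := Prod.fst) _ (h1.of_le (WithTop.coe_le_coe.2 le_top))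
        contDiffAt_fst
    exact (h3.prodMk (h2.clm_apply contDiffAt_snd)).congr_of_eventuallyEq hev
  · filter_upwards [hev, hnear] with z h1 h2
    rw [h1]
    exact inChart_coordChange h2.1 h2.2 _ _
  · filter_upwards [hev.eventually_nhds, hnear, hτd] with z h1 h2 h3 δ
    have h4 : (fderiv ℝ (g.flowCoord 0 p p') z δ).1 = fderiv ℝ τ z.1 δ.1 := by
      have hdτ := h3.differentiableAt (by simp)
      have h5 : DifferentiableAt ℝ (fderiv ℝ τ) z.1 :=
        ((h3.of_le (m := 2) (WithTop.coe_le_coe.2 le_top)).fderiv_right (m := 1)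
          (by norm_num)).differentiableAt one_ne_zero
      have h6 : HasFDerivAt (fun z : EuclideanSpace ℝ (Fin (n + 1)) ×
        EuclideanSpace ℝ (Fin (n + 1)) => τ z.1) _ z :=
        HasFDerivAt.comp (g := τ) (f := Prod.fst) z hdτ.hasFDerivAt hasFDerivAt_fst
      have h7 : DifferentiableAt ℝ (fun z : EuclideanSpace ℝ (Fin (n + 1)) ×
        EuclideanSpace ℝ (Fin (n + 1)) => fderiv ℝ τ z.1 z.2) z :=
        (DifferentiableAt.comp z h5 differentiableAt_fst).clm_apply differentiableAt_snd
      rw [Filter.EventuallyEq.fderiv_eq h1, (h6.prodMk h7.hasFDerivAt).fderiv]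
      rfl
    rw [h4, h1.self_of_nhds, zero_div, zero_mul, add_zero]
    exact inChart_coordChange h2.1 h2.2 _ _

theorem IsGeodesic.continuous_velocity {γ : ℝ → M} (hγ : g.IsGeodesic γ) :
    Continuous (velocity (m := n + 1) γ) := by
  refine continuous_iff_continuousAt.2 fun t => ?_
  have h1 : γ t ∈ (extChartAt (𝓡 (n + 1)) (γ t)).source := mem_extChartAt_source _
  have h2 : velocity (m := n + 1) γ t ∈ (tangentCoord (γ t)).source :=
    mem_tangentCoord_source.2 h1
  have h3 := (hγ.hasDerivAt_tangentCoord h1).continuousAt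
  have h4 : velocity (m := n + 1) γ =ᶠ[𝓝 t]
      fun s => (tangentCoord (γ t)).symm (tangentCoord (γ t) (velocity γ s)) := by
    filter_upwards [hγ.continuous.continuousAt.eventually_mem
        ((isOpen_extChartAt_source _).mem_nhds h1)] with s hs
    rw [(tangentCoord (γ t)).left_inv (mem_tangentCoord_source.2 (by exact hs))]
  refine ContinuousAt.congr ?_ h4.symm
  exact ((tangentCoord (γ t)).symm.continuousAt ((tangentCoord (γ t)).map_source h2)).comp
    (f := fun s => tangentCoord (γ t) (velocity γ s)) h3

/-- The geodesic flow of a complete metric is regular at all times: the set of times at which it is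
regular along a given geodesic is open and closed. -/
theorem IsComplete.flowRegularAt [T2Space M] (hg : g.IsComplete) (t : ℝ) {p p' : M}
    {q : TangentBundle (𝓡 (n + 1)) M} (hp : q.1 ∈ (extChartAt (𝓡 (n + 1)) p).source)
    (hp' : (g.flow t q).1 ∈ (extChartAt (𝓡 (n + 1)) p').source) : g.FlowRegularAt t p p' q := by
  set S := {t : ℝ | ∀ p', (g.flow t q).1 ∈ (extChartAt (𝓡 (n + 1)) p').source →
    g.FlowRegularAt t p p' q} with hS
  have hcont : Continuous fun s => g.flow s q := (hg.geodesic_spec q).1.continuous_velocity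
  -- changing the chart at the endpoint
  have hmem : ∀ s p₁, g.FlowRegularAt s p p₁ q → s ∈ S := fun s p₁ h p₂ hp₂ => by
    simpa using (hg.flowRegularAt_zero h.source' hp₂).comp hg h
  have hlocal : ∀ t, ∀ᶠ s in 𝓝 t, s ∈ S ↔ t ∈ S := by
    intro t
    obtain ⟨ε, hε, hN⟩ := hg.flowRegularAt_local (g.flow t q)
    have h0 : (0 : ℝ) ∈ Ioo (-ε) ε := ⟨by linarith, hε⟩
    filter_upwards [hcont.continuousAt.eventually hN, Ioo_mem_nhds (show t - ε < t by linarith)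
      (show t < t + ε by linarith)] with s hs hst
    have h1 := hN.self_of_nhds (s - t) ⟨by linarith [hst.1], by linarith [hst.2]⟩
    have h2 := hs (t - s) ⟨by linarith [hst.2], by linarith [hst.1]⟩
    constructor
    · intro h
      have := h2.comp hg (h _ h2.source)
      rw [sub_add_cancel] at this
      exact hmem _ _ this
    · intro h
      have := h1.comp hg (h _ h1.source)
      rw [sub_add_cancel] at this
      exact hmem _ _ this
  have hclopen : IsClopen S := by
    refine ⟨⟨isOpen_iff_mem_nhds.2 fun t ht => ?_⟩, isOpen_iff_mem_nhds.2 fun t ht => ?_⟩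
    · filter_upwards [hlocal t] with s hs h using ht (hs.1 h)
    · filter_upwards [hlocal t] with s hs using hs.2 ht
  have huniv := hclopen.eq_univ ⟨0, hmem 0 p (hg.flowRegularAt_zero hp hp)⟩
  exact (huniv ▸ mem_univ t : t ∈ S) p' hp'

end LorentzMetric
end Flow

/-! ### Hypersurfaces in a Lorentzian vector space -/

section Forms

variable {E F : Type*} [NormedAddCommGroup E] [NormedSpace ℝ E] [NormedAddCommGroup F]
  [NormedSpace ℝ F] {B : E →L[ℝ] E →L[ℝ] ℝ}

theorem pullbackForm_apply (B : E →L[ℝ] E →L[ℝ] ℝ) (L : F →L[ℝ] E) (a b : F) :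
    pullbackForm B L a b = B (L a) (L b) := rfl

/-- The orthogonal complement of any timelike vector of a Lorentzian form is positive definite. -/
theorem IsLorentzForm.pos_of_orthogonal (hB : IsLorentzForm B) (hsymm : ∀ a b, B a b = B b a)
    {T v : E} (hT : B T T < 0) (h : B T v = 0) (hv : v ≠ 0) : 0 < B v v := by
  obtain ⟨τ, hτ, hpos⟩ := hB
  have hnn : ∀ w, B τ w = 0 → 0 ≤ B w w := fun w hw => by
    rcases eq_or_ne w 0 with rfl | h0
    · simp
    · exact (hpos w hw h0).le
  set m := -B τ τ with hm
  have hm0 : 0 < m := by linarith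
  -- decompose along the timelike vector `τ`
  have hdec : ∀ x : E, ∃ (a : ℝ) (x' : E), x = a • τ + x' ∧ B τ x' = 0 := fun x =>
    ⟨B τ x / B τ τ, x - (B τ x / B τ τ) • τ, by simp, by
      simp only [map_sub, map_smul, smul_eq_mul]
      field_simp [hτ.ne]
      ring⟩
  obtain ⟨a, t, rfl, ht⟩ := hdec T
  obtain ⟨b, u, rfl, hu⟩ := hdec v
  have ht' := hsymm t τ ▸ ht
  have hu' := hsymm u τ ▸ hu
  simp only [map_add, map_smul, smul_eq_mul, add_apply, smul_apply] at hT h ⊢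
  rw [hsymm t τ, ht] at hT
  rw [hsymm t τ, ht, hu] at h
  rw [hsymm u τ, hu]
  have hT1 : B t t < a ^ 2 * m := by rw [hm]; nlinarith
  have h1 : B t u = a * b * m := by rw [hm]; linarith
  have hCS : B t u ^ 2 ≤ B t t * B u u := by
    have hq : ∀ x : ℝ, 0 ≤ B u u * (x * x) + 2 * B t u * x + B t t := fun x => by
      have h2 := hnn (t + x • u) (by simp [ht, hu])
      simp only [map_add, map_smul, smul_eq_mul, add_apply, smul_apply] at h2
      rw [hsymm u t] at h2
      linarith
    have := discrim_le_zero hq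
    rw [discrim] at this
    linarith
  have htt := hnn t ht
  have ha : a ≠ 0 := by
    rintro rfl
    linarith
  have ha2 : 0 < a ^ 2 := by positivity
  rcases eq_or_ne u 0 with rfl | hu0
  · have hb : b ≠ 0 := by
      rintro rfl
      simp at hv
    simp only [map_zero] at h1
    exact absurd h1.symm (mul_ne_zero (mul_ne_zero ha hb) hm0.ne')
  · have huu := hpos u hu hu0
    have h3 : a ^ 2 * (b ^ 2 * m) * m < a ^ 2 * B u u * m := by
      have h4 : B t t * B u u < a ^ 2 * m * B u u := mul_lt_mul_of_pos_right hT1 huu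
      rw [h1] at hCS
      nlinarith
    have h5 : b ^ 2 * m < B u u := by
      have := lt_of_mul_lt_mul_right h3 hm0.le
      exact lt_of_mul_lt_mul_left this ha2.le
    rw [hm] at h5
    nlinarith

/-- A linear functional that vanishes on a hyperplane and on a vector transversal to it vanishes. -/
theorem eq_zero_of_hyperplane [FiniteDimensional ℝ E] [FiniteDimensional ℝ F]
    (hdim : Module.finrank ℝ E = Module.finrank ℝ F + 1) {L : F →L[ℝ] E}
    (hL : Function.Injective L) {v : E} (hv : v ∉ range L) {f : E →L[ℝ] ℝ}
    (hf : ∀ a, f (L a) = 0) (hfv : f v = 0) : f = 0 := by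
  have hker : LinearMap.range (L : F →ₗ[ℝ] E) ≤ LinearMap.ker (f : E →ₗ[ℝ] ℝ) := by
    rintro _ ⟨a, rfl⟩
    exact hf a
  have hlt : LinearMap.range (L : F →ₗ[ℝ] E) < LinearMap.ker (f : E →ₗ[ℝ] ℝ) :=
    lt_of_le_of_ne hker fun h => hv (by
      have : v ∈ LinearMap.ker (f : E →ₗ[ℝ] ℝ) := hfv
      rw [← h] at this
      exact this)
  have h1 := Submodule.finrank_lt_finrank_of_lt hlt
  rw [LinearMap.finrank_range_of_inj hL] at h1
  have h2 : LinearMap.ker (f : E →ₗ[ℝ] ℝ) = ⊤ :=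
    Submodule.eq_top_of_finrank_eq (le_antisymm (Submodule.finrank_le _) (by omega))
  ext w
  exact (h2 ▸ Submodule.mem_top : w ∈ LinearMap.ker (f : E →ₗ[ℝ] ℝ))

theorem injective_of_pullbackForm {L : F →L[ℝ] E}
    (h : IsLorentzForm (pullbackForm B L) ∨ IsPosForm (pullbackForm B L)) :
    Function.Injective L := by
  refine (injective_iff_map_eq_zero L).2 fun a ha => ?_
  rcases h with h | h
  · exact h.eq_zero_of_forall fun w => by rw [pullbackForm_apply, ha, map_zero]
  · by_contra h0
    have := h a h0
    rw [pullbackForm_apply, ha, map_zero] at this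
    exact this.ne' rfl

theorem pullbackForm_eq_zero (hsymm : ∀ a b, B a b = B b a) {L : F →L[ℝ] E}
    (h : IsLorentzForm (pullbackForm B L) ∨ IsPosForm (pullbackForm B L)) {a : F}
    (ha : ∀ b, pullbackForm B L a b = 0) : a = 0 := by
  rcases h with h | h
  · exact h.eq_zero_of_forall fun w => by
      rw [pullbackForm_apply, hsymm, ← pullbackForm_apply, ha]
  · by_contra h0
    exact (h a h0).ne' (ha a)

/-- A lightlike vector is not orthogonal to a timelike or spacelike hyperplane. -/
theorem IsLorentzForm.not_orthogonal_of_null [FiniteDimensional ℝ E] [FiniteDimensional ℝ F]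
    (hdim : Module.finrank ℝ E = Module.finrank ℝ F + 1) (hB : IsLorentzForm B)
    (hsymm : ∀ a b, B a b = B b a) {L : F →L[ℝ] E}
    (h : IsLorentzForm (pullbackForm B L) ∨ IsPosForm (pullbackForm B L)) {v : E} (hv : v ≠ 0)
    (hvv : B v v = 0) : ∃ a, B v (L a) ≠ 0 := by
  by_contra! hcon
  have hL := injective_of_pullbackForm h
  rcases h with ⟨T, hT, -⟩ | h
  · have := hB.pos_of_orthogonal hsymm hT (by rw [hsymm]; exact hcon T) hv
    exact this.ne' hvv
  · have hvr : v ∉ range L := by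
      rintro ⟨a, rfl⟩
      have := h a (fun h0 => hv (by rw [h0, map_zero]))
      exact this.ne' hvv
    have h0 := eq_zero_of_hyperplane hdim hL hvr hcon hvv
    exact hv (hB.eq_zero_of_forall fun w => by rw [hsymm, h0]; rfl)

end Forms

section Hypersurface

variable {n : ℕ} {U M : Type*}
  [TopologicalSpace U] [ChartedSpace (EuclideanSpace ℝ (Fin n)) U]
  [TopologicalSpace M] [ChartedSpace (EuclideanSpace ℝ (Fin (n + 1))) M]
  [IsManifold (𝓡 (n + 1)) ∞ M] {g : LorentzMetric n M} {ι : U → M}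

namespace LorentzMetric

theorem TimelikeOrSpacelike.at (h : g.TimelikeOrSpacelike ι) (x : U) :
    IsLorentzForm (g.induced ι x) ∨ IsPosForm (g.induced ι x) :=
  h.imp (fun h => h x) (fun h => h x)

theorem TimelikeOrSpacelike.mfderiv_injective (h : g.TimelikeOrSpacelike ι) (x : U) :
    Function.Injective (mfderiv (𝓡 n) (𝓡 (n + 1)) ι x) :=
  injective_of_pullbackForm (E := EuclideanSpace ℝ (Fin (n + 1))) (F := EuclideanSpace ℝ (Fin n))
    (h.at x)

theorem TimelikeOrSpacelike.induced_injective (h : g.TimelikeOrSpacelike ι) (x : U) :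
    Function.Injective (g.induced ι x) :=
  (injective_iff_map_eq_zero _).2 fun _ ha =>
    pullbackForm_eq_zero (E := EuclideanSpace ℝ (Fin (n + 1))) (F := EuclideanSpace ℝ (Fin n))
      (g.symm _) (h.at x) fun b => DFunLike.congr_fun ha b

theorem TimelikeOrSpacelike.induced_surjective (h : g.TimelikeOrSpacelike ι) (x : U) :
    Function.Surjective (g.induced ι x) := by
  obtain ⟨e, he⟩ := isInvertible_of_injective (m := n) (B := g.induced ι x) (h.induced_injective x)
  intro ξ
  exact ⟨e.symm ξ, by
    have := e.apply_symm_apply ξ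
    have h2 := DFunLike.congr_fun he (e.symm ξ)
    exact h2.symm.trans this⟩

theorem TimelikeOrSpacelike.not_orthogonal_of_null (h : g.TimelikeOrSpacelike ι) (x : U)
    {v : TangentSpace (𝓡 (n + 1)) (ι x)} (hv : g.IsNull v) :
    ∃ a, g.val (ι x) v (mfderiv (𝓡 n) (𝓡 (n + 1)) ι x a) ≠ 0 :=
  IsLorentzForm.not_orthogonal_of_null (E := EuclideanSpace ℝ (Fin (n + 1)))
    (F := EuclideanSpace ℝ (Fin n)) (by simp) (g.lorentz _) (g.symm _) (h.at x) hv.1 hv.2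

variable (g ι) in
/-- The restriction `g(v, ·)|_{T_xU}` of the covector `g(v, ·)` to the hypersurface. -/
def flat (x : U) (v : TangentSpace (𝓡 (n + 1)) (ι x)) : TangentSpace (𝓡 n) x →L[ℝ] ℝ :=
  (g.val (ι x) v).comp (mfderiv (𝓡 n) (𝓡 (n + 1)) ι x)

theorem isTangentialProj_iff {x : U} {v : TangentSpace (𝓡 (n + 1)) (ι x)}
    {v' : TangentSpace (𝓡 n) x} :
    g.IsTangentialProj ι x v v' ↔ g.induced ι x v' = g.flat ι x v := by
  rw [IsTangentialProj, ContinuousLinearMap.ext_iff]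
  refine forall_congr' fun a => ?_
  rw [map_sub]
  change g.val (ι x) v _ - g.val (ι x) _ _ = 0 ↔ g.val (ι x) _ _ = g.val (ι x) v _
  rw [sub_eq_zero, eq_comm]
  exact Iff.rfl

end LorentzMetric
end Hypersurface

namespace LightRaySetup

variable {n : ℕ} {U V M : Type*}
  [TopologicalSpace U] [ChartedSpace (EuclideanSpace ℝ (Fin n)) U] [IsManifold (𝓡 n) ∞ U]
  [TopologicalSpace V] [ChartedSpace (EuclideanSpace ℝ (Fin n)) V] [IsManifold (𝓡 n) ∞ V]
  [TopologicalSpace M] [ChartedSpace (EuclideanSpace ℝ (Fin (n + 1))) M]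
  [IsManifold (𝓡 (n + 1)) ∞ M] {x₀ : U} {y₀ : V} {C : LightRaySetup n U V M x₀ y₀}

/-- A lightlike geodesic, starting at `x ∈ U` with velocity `v`, that reaches `y ∈ V` at the time
`s > 0` with velocity `w`. Reparametrized over `[0,1]`, it has its initial condition `(x, s v)` in
`W`. -/
structure IsLightRay (C : LightRaySetup n U V M x₀ y₀) (W : Set (TangentBundle (𝓡 (n + 1)) M))
    (x : U) (y : V) (v : TangentSpace (𝓡 (n + 1)) (C.ιU x))
    (w : TangentSpace (𝓡 (n + 1)) (C.ιV y)) (s : ℝ) : Prop where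
  pos : 0 < s
  mem : (⟨C.ιU x, s • v⟩ : TangentBundle (𝓡 (n + 1)) M) ∈ W
  null : C.g.IsNull v
  flow : C.g.flow s ⟨C.ιU x, v⟩ = ⟨C.ιV y, w⟩

/-- The scattering relation in terms of the covectors that the initial and the final velocity of
the light ray induce on the hypersurfaces. -/
theorem scattering_iff {W : Set (TangentBundle (𝓡 (n + 1)) M)} {z : TangentBundle (𝓡 n) U}
    {z' : TangentBundle (𝓡 n) V} : C.Scattering W z z' ↔
      ∃ v w s, C.IsLightRay W z.1 z'.1 v w s ∧ C.g.induced C.ιU z.1 z.2 = C.g.flat C.ιU z.1 v ∧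
        C.g.induced C.ιV z'.1 z'.2 = C.g.flat C.ιV z'.1 w := by
  constructor
  · rintro ⟨v, w, s, h1, h2, h3, h4, h5, h6⟩
    exact ⟨v, w, s, ⟨h1, h2, h3, h5⟩, LorentzMetric.isTangentialProj_iff.1 h4,
      LorentzMetric.isTangentialProj_iff.1 h6⟩
  · rintro ⟨v, w, s, ⟨h1, h2, h3, h5⟩, h4, h6⟩
    exact ⟨v, w, s, h1, h2, h3, LorentzMetric.isTangentialProj_iff.2 h4, h5,
      LorentzMetric.isTangentialProj_iff.2 h6⟩

theorem scatteringSharp_iff {W : Set (TangentBundle (𝓡 (n + 1)) M)} {z : CotangentBundle n U}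
    {z' : CotangentBundle n V} : C.ScatteringSharp W z z' ↔
      ∃ v w s, C.IsLightRay W z.1 z'.1 v w s ∧ z.2 = C.g.flat C.ιU z.1 v ∧
        z'.2 = C.g.flat C.ιV z'.1 w := by
  constructor
  · rintro ⟨v', w', h1, h2, h3⟩
    obtain ⟨v, w, s, h, h4, h5⟩ := scattering_iff.1 h3
    exact ⟨v, w, s, h, h1.symm.trans h4, h2.symm.trans h5⟩
  · rintro ⟨v, w, s, h, h1, h2⟩
    obtain ⟨v', hv'⟩ := C.causalU.induced_surjective z.1 z.2
    obtain ⟨w', hw'⟩ := C.causalV.induced_surjective z'.1 z'.2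
    exact ⟨v', w', hv', hw', scattering_iff.2 ⟨v, w, s, h, hv'.trans h1, hw'.trans h2⟩⟩

end LightRaySetup

/-! ### Connecting geodesics in coordinates -/

theorem exists_continuousLinearEquiv_of_injective {X Y : Type*} [NormedAddCommGroup X]
    [NormedSpace ℝ X] [NormedAddCommGroup Y] [NormedSpace ℝ Y] [FiniteDimensional ℝ X]
    [FiniteDimensional ℝ Y] {L : X →L[ℝ] Y} (hL : Function.Injective L)
    (h : Module.finrank ℝ X = Module.finrank ℝ Y) : ∃ e : X ≃L[ℝ] Y, (e : X →L[ℝ] Y) = L :=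
  ⟨(LinearEquiv.ofInjectiveOfFinrankEq (L : X →ₗ[ℝ] Y) hL h).toContinuousLinearEquiv, by
    ext; rfl⟩

/-- The equation `F(i(a), w) = j(b)` is solved near `(a₀, b₀, w₀)` by a unique continuously
differentiable `w(a, b)` if the partial derivative of `F` in `w` is injective. -/
theorem exists_implicit_solution {A B E : Type*} [NormedAddCommGroup A] [NormedSpace ℝ A]
    [NormedAddCommGroup B] [NormedSpace ℝ B] [NormedAddCommGroup E] [NormedSpace ℝ E]
    [FiniteDimensional ℝ A] [FiniteDimensional ℝ E] {i : A → E} {j : B → E} {F : E × E → E}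
    {a₀ : A} {b₀ : B} {w₀ : E} (hi : ContDiffAt ℝ 1 i a₀) (hj : ContDiffAt ℝ 1 j b₀)
    (hF : ContDiffAt ℝ 1 F (i a₀, w₀)) (h₀ : F (i a₀, w₀) = j b₀)
    (hinj : ∀ w, fderiv ℝ F (i a₀, w₀) (0, w) = 0 → w = 0) :
    ∃ sol : A × B → E, ContDiffAt ℝ 1 sol (a₀, b₀) ∧ sol (a₀, b₀) = w₀ ∧
      (∀ᶠ c in 𝓝 (a₀, b₀), F (i c.1, sol c) = j c.2) ∧
      ∃ N ∈ 𝓝 w₀, ∀ᶠ c in 𝓝 (a₀, b₀), ∀ w ∈ N, F (i c.1, w) = j c.2 → sol c = w := by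
  have : CompleteSpace A := FiniteDimensional.complete ℝ A
  have : CompleteSpace E := FiniteDimensional.complete ℝ E
  set Φ : A × E → A × E := fun c => (c.1, F (i c.1, c.2)) with hΦ
  have hin : ContDiffAt ℝ 1 (fun c : A × E => (i c.1, c.2)) (a₀, w₀) :=
    (ContDiffAt.comp (g := i) (f := Prod.fst) (a₀, w₀) hi contDiffAt_fst).prodMk contDiffAt_snd
  have hFin : ContDiffAt ℝ 1 (fun c : A × E => F (i c.1, c.2)) (a₀, w₀) :=
    ContDiffAt.comp (g := F) (a₀, w₀) hF hin
  have hΦc : ContDiffAt ℝ 1 Φ (a₀, w₀) := contDiffAt_fst.prodMk hFin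
  have hΦd := (hΦc.differentiableAt one_ne_zero).hasFDerivAt
  have hΦd' : ∀ c, fderiv ℝ Φ (a₀, w₀) c =
      (c.1, fderiv ℝ F (i a₀, w₀) (fderiv ℝ i a₀ c.1, c.2)) := by
    intro c
    have h1 : HasFDerivAt (fun c : A × E => i c.1) _ (a₀, w₀) :=
      HasFDerivAt.comp (g := i) (f := Prod.fst) (a₀, w₀)
        (hi.differentiableAt one_ne_zero).hasFDerivAt hasFDerivAt_fst
    have h2 : HasFDerivAt (fun c : A × E => F (i c.1, c.2)) _ (a₀, w₀) :=
      HasFDerivAt.comp (g := F) (a₀, w₀) (hF.differentiableAt one_ne_zero).hasFDerivAt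
        (h1.prodMk hasFDerivAt_snd)
    rw [hΦd.unique ((hasFDerivAt_fst (p := (a₀, w₀))).prodMk h2)]
    rfl
  obtain ⟨e, he⟩ := exists_continuousLinearEquiv_of_injective (L := fderiv ℝ Φ (a₀, w₀))
    ((injective_iff_map_eq_zero _).2 fun c hc => by
      rw [hΦd'] at hc
      have h1 : c.1 = 0 := congrArg Prod.fst hc
      have h2 : fderiv ℝ F (i a₀, w₀) (fderiv ℝ i a₀ c.1, c.2) = 0 := congrArg Prod.snd hc
      rw [h1, map_zero] at h2
      exact Prod.ext h1 (hinj _ h2)) rfl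
  rw [← he] at hΦd
  set P := hΦc.toOpenPartialHomeomorph Φ hΦd one_ne_zero with hP
  have hPc : ∀ c, P c = Φ c := fun c => rfl
  have hsrc : (a₀, w₀) ∈ P.source := hΦc.mem_toOpenPartialHomeomorph_source hΦd one_ne_zero
  have hΦ₀ : Φ (a₀, w₀) = (a₀, j b₀) := by rw [hΦ]; simp only [h₀]
  have htgt : (a₀, j b₀) ∈ P.target := by rw [← hΦ₀]; exact P.map_source hsrc
  have hsymm₀ : P.symm (a₀, j b₀) = (a₀, w₀) := by
    rw [← hΦ₀]; exact P.left_inv hsrc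
  have hin' : ContDiffAt ℝ 1 (fun c : A × B => (c.1, j c.2)) (a₀, b₀) :=
    contDiffAt_fst.prodMk (ContDiffAt.comp (g := j) (f := Prod.snd) (a₀, b₀) hj contDiffAt_snd)
  have hPsymm : ContDiffAt ℝ 1 P.symm (a₀, j b₀) :=
    P.contDiffAt_symm htgt (f₀' := e) (by rw [hsymm₀]; exact hΦd) (by rw [hsymm₀]; exact hΦc)
  refine ⟨fun c => (P.symm (c.1, j c.2)).2, ?_, ?_, ?_, ?_⟩
  · exact (ContDiffAt.comp (g := P.symm) (a₀, b₀) hPsymm hin').snd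
  · simp only [hsymm₀]
  · filter_upwards [hin'.continuousAt.eventually_mem (P.open_target.mem_nhds htgt)] with c hc
    have h1 := P.right_inv hc
    rw [hPc, hΦ] at h1
    have h2 : (P.symm (c.1, j c.2)).1 = c.1 := congrArg Prod.fst h1
    have h3 := congrArg Prod.snd h1
    simp only [h2] at h3
    exact h3
  · obtain ⟨N₁, hN₁, N, hN, hsub⟩ := mem_nhds_prod_iff.1 (P.open_source.mem_nhds hsrc)
    refine ⟨N, hN, ?_⟩
    filter_upwards [continuousAt_fst.eventually_mem (x := (a₀, b₀)) hN₁] with c hc w hw hFw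
    have h1 : P.symm (Φ (c.1, w)) = (c.1, w) := P.left_inv (hsub ⟨hc, hw⟩)
    simp only [hΦ, hFw] at h1
    rw [h1]

namespace LightRaySetup

variable {n : ℕ} {U V M : Type*}
  [TopologicalSpace U] [ChartedSpace (EuclideanSpace ℝ (Fin n)) U] [IsManifold (𝓡 n) ∞ U]
  [TopologicalSpace V] [ChartedSpace (EuclideanSpace ℝ (Fin n)) V] [IsManifold (𝓡 n) ∞ V]
  [TopologicalSpace M] [ChartedSpace (EuclideanSpace ℝ (Fin (n + 1))) M]
  [IsManifold (𝓡 (n + 1)) ∞ M] {x₀ : U} {y₀ : V} (C : LightRaySetup n U V M x₀ y₀)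

/-- The hypersurface `U` in the charts at `x₀`. -/
def coordU : EuclideanSpace ℝ (Fin n) → EuclideanSpace ℝ (Fin (n + 1)) :=
  extChartAt (𝓡 (n + 1)) (C.ιU x₀) ∘ C.ιU ∘ (extChartAt (𝓡 n) x₀).symm

/-- The hypersurface `V` in the charts at `y₀`. -/
def coordV : EuclideanSpace ℝ (Fin n) → EuclideanSpace ℝ (Fin (n + 1)) :=
  extChartAt (𝓡 (n + 1)) (C.ιV y₀) ∘ C.ιV ∘ (extChartAt (𝓡 n) y₀).symm

/-- The time `1` geodesic flow in the charts at `x₀` and `y₀`. -/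
def flowUV : EuclideanSpace ℝ (Fin (n + 1)) × EuclideanSpace ℝ (Fin (n + 1)) →
    EuclideanSpace ℝ (Fin (n + 1)) × EuclideanSpace ℝ (Fin (n + 1)) :=
  C.g.flowCoord 1 (C.ιU x₀) (C.ιV y₀)

theorem continuous_ιU : Continuous C.ιU := C.embU.contMDiff.continuous

theorem continuous_ιV : Continuous C.ιV := C.embV.contMDiff.continuous

theorem mdifferentiable_ιU : MDifferentiable (𝓡 n) (𝓡 (n + 1)) C.ιU :=
  C.embU.contMDiff.mdifferentiable (by simp)

theorem mdifferentiable_ιV : MDifferentiable (𝓡 n) (𝓡 (n + 1)) C.ιV :=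
  C.embV.contMDiff.mdifferentiable (by simp)

theorem eventually_ιU : ∀ᶠ x in 𝓝 x₀, x ∈ (extChartAt (𝓡 n) x₀).source ∧
    C.ιU x ∈ (extChartAt (𝓡 (n + 1)) (C.ιU x₀)).source :=
  Filter.Eventually.and (extChartAt_source_mem_nhds x₀)
    (C.continuous_ιU.continuousAt.eventually_mem (extChartAt_source_mem_nhds _))

theorem eventually_ιV : ∀ᶠ y in 𝓝 y₀, y ∈ (extChartAt (𝓡 n) y₀).source ∧
    C.ιV y ∈ (extChartAt (𝓡 (n + 1)) (C.ιV y₀)).source :=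
  Filter.Eventually.and (extChartAt_source_mem_nhds y₀)
    (C.continuous_ιV.continuousAt.eventually_mem (extChartAt_source_mem_nhds _))

variable {C} in
theorem coordU_apply {x : U} (hx : x ∈ (extChartAt (𝓡 n) x₀).source) :
    C.coordU (extChartAt (𝓡 n) x₀ x) = extChartAt (𝓡 (n + 1)) (C.ιU x₀) (C.ιU x) := by
  simp only [coordU, Function.comp_apply, (extChartAt (𝓡 n) x₀).left_inv hx]

variable {C} in
theorem coordV_apply {y : V} (hy : y ∈ (extChartAt (𝓡 n) y₀).source) :
    C.coordV (extChartAt (𝓡 n) y₀ y) = extChartAt (𝓡 (n + 1)) (C.ιV y₀) (C.ιV y) := by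
  simp only [coordV, Function.comp_apply, (extChartAt (𝓡 n) y₀).left_inv hy]

theorem contDiffAt_coord_of_contMDiff {m m' : ℕ} {N N' : Type*} [TopologicalSpace N]
    [ChartedSpace (EuclideanSpace ℝ (Fin m)) N] [IsManifold (𝓡 m) ∞ N] [TopologicalSpace N']
    [ChartedSpace (EuclideanSpace ℝ (Fin m')) N'] [IsManifold (𝓡 m') ∞ N'] {F : N → N'}
    {x : N} (hF : ContMDiffAt (𝓡 m) (𝓡 m') ∞ F x) :
    ContDiffAt ℝ ∞ (extChartAt (𝓡 m') (F x) ∘ F ∘ (extChartAt (𝓡 m) x).symm)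
      (extChartAt (𝓡 m) x x) := by
  have := (contMDiffAt_iff.1 hF).2
  rwa [ModelWithCorners.range_eq_univ, contDiffWithinAt_univ] at this

theorem contDiffAt_coordU : ContDiffAt ℝ ∞ C.coordU (extChartAt (𝓡 n) x₀ x₀) :=
  contDiffAt_coord_of_contMDiff (C.embU.contMDiff x₀)

theorem contDiffAt_coordV : ContDiffAt ℝ ∞ C.coordV (extChartAt (𝓡 n) y₀ y₀) :=
  contDiffAt_coord_of_contMDiff (C.embV.contMDiff y₀)

variable {C} in
theorem dChart_mfderiv_ιU {x : U} (hx : x ∈ (extChartAt (𝓡 n) x₀).source ∧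
    C.ιU x ∈ (extChartAt (𝓡 (n + 1)) (C.ιU x₀)).source) (α : TangentSpace (𝓡 n) x) :
    dChart (C.ιU x₀) (C.ιU x) (mfderiv (𝓡 n) (𝓡 (n + 1)) C.ιU x α) =
      fderiv ℝ C.coordU (extChartAt (𝓡 n) x₀ x) (dChart x₀ x α) :=
  dChart_mfderiv hx.1 hx.2 (C.mdifferentiable_ιU x) α

variable {C} in
theorem dChart_mfderiv_ιV {y : V} (hy : y ∈ (extChartAt (𝓡 n) y₀).source ∧
    C.ιV y ∈ (extChartAt (𝓡 (n + 1)) (C.ιV y₀)).source) (β : TangentSpace (𝓡 n) y) :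
    dChart (C.ιV y₀) (C.ιV y) (mfderiv (𝓡 n) (𝓡 (n + 1)) C.ιV y β) =
      fderiv ℝ C.coordV (extChartAt (𝓡 n) y₀ y) (dChart y₀ y β) :=
  dChart_mfderiv hy.1 hy.2 (C.mdifferentiable_ιV y) β

/-- The initial velocity of the reference ray in the chart at `x₀`. -/
def coordv₀ : EuclideanSpace ℝ (Fin (n + 1)) := dChart (C.ιU x₀) (C.ιU x₀) C.v₀

theorem base_proj_mem : C.base.1 ∈ (extChartAt (𝓡 (n + 1)) (C.ιU x₀)).source :=
  mem_extChartAt_source _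

theorem tangentCoord_base : tangentCoord (C.ιU x₀) C.base =
    (C.coordU (extChartAt (𝓡 n) x₀ x₀), C.coordv₀) := by
  rw [tangentCoord_apply C.base_proj_mem, coordU_apply (mem_extChartAt_source _)]
  rfl

theorem base_mem_source : C.base ∈ (tangentCoord (C.ιU x₀)).source :=
  mem_tangentCoord_source.2 (mem_extChartAt_source _)

theorem flow_base : C.g.flow 1 C.base = ⟨C.ιV y₀, C.w₀⟩ := C.reach

theorem flowRegularAt_base [T2Space M] :
    C.g.FlowRegularAt 1 (C.ιU x₀) (C.ιV y₀) C.base :=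
  C.complete.flowRegularAt 1 (mem_extChartAt_source _)
    (by rw [flow_base]; exact mem_extChartAt_source _)

theorem flowUV_base : C.flowUV (C.coordU (extChartAt (𝓡 n) x₀ x₀), C.coordv₀) =
    (C.coordV (extChartAt (𝓡 n) y₀ y₀), dChart (C.ιV y₀) (C.ιV y₀) C.w₀) := by
  rw [← tangentCoord_base, flowUV, LorentzMetric.flowCoord_tangentCoord C.base_proj_mem,
    flow_base, coordV_apply (mem_extChartAt_source _)]
  exact tangentCoord_apply (q := ⟨C.ιV y₀, C.w₀⟩) (mem_extChartAt_source _)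

/-- Nonconjugacy in coordinates. -/
theorem fderiv_flowUV_injective [T2Space M] (w : EuclideanSpace ℝ (Fin (n + 1)))
    (hw : (fderiv ℝ C.flowUV (C.coordU (extChartAt (𝓡 n) x₀ x₀), C.coordv₀) (0, w)).1 = 0) :
    w = 0 := by
  set p := C.ιU x₀ with hp
  have hsrc : p ∈ (extChartAt (𝓡 (n + 1)) p).source := mem_extChartAt_source _
  set e : EuclideanSpace ℝ (Fin (n + 1)) → M := fun u => C.g.exp p u with he
  obtain ⟨v, hv⟩ : ∃ v : EuclideanSpace ℝ (Fin (n + 1)), v = C.v₀ := ⟨_, rfl⟩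
  have hend : e v = C.ιV y₀ := by
    rw [hv]
    exact congrArg TotalSpace.proj C.reach
  have hinj : Function.Injective
      (mfderiv 𝓘(ℝ, EuclideanSpace ℝ (Fin (n + 1))) (𝓡 (n + 1)) e v) := by
    rw [hv]; exact C.notConjugate
  have hed : MDifferentiableAt 𝓘(ℝ, EuclideanSpace ℝ (Fin (n + 1))) (𝓡 (n + 1)) e v := by
    by_contra h
    rw [mfderiv_zero_of_not_mdifferentiableAt h] at hinj
    exact C.null.1 (hv ▸ hinj rfl)
  have hchart : MDifferentiableAt (𝓡 (n + 1)) 𝓘(ℝ, EuclideanSpace ℝ (Fin (n + 1)))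
      (extChartAt (𝓡 (n + 1)) (C.ιV y₀)) (e v) := by
    rw [hend]; exact mdifferentiableAt_extChartAt (mem_chart_source _ _)
  have h1 := mfderiv_comp v hchart hed
  rw [mfderiv_eq_fderiv] at h1
  have hbase : (extChartAt (𝓡 (n + 1)) p p, dChart p p v) =
      (C.coordU (extChartAt (𝓡 n) x₀ x₀), C.coordv₀) := by
    rw [← tangentCoord_base, tangentCoord_apply (q := C.base) hsrc, hv]; rfl
  -- the same map in coordinates
  have hcoord : (extChartAt (𝓡 (n + 1)) (C.ιV y₀) ∘ e) =ᶠ[𝓝 v]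
      fun u => (C.flowUV (extChartAt (𝓡 (n + 1)) p p, dChart p p u)).1 := by
    have hc : ContinuousAt (fun u : EuclideanSpace ℝ (Fin (n + 1)) =>
        (extChartAt (𝓡 (n + 1)) p p, dChart p p u)) v :=
      continuousAt_const.prodMk (dChart p p).continuous.continuousAt
    have hev := C.flowRegularAt_base.eventually_source
    rw [tangentCoord_base, ← hbase] at hev
    filter_upwards [hc.eventually hev] with u hu
    have h3 : (tangentCoord p).symm (extChartAt (𝓡 (n + 1)) p p, dChart p p u) = ⟨p, u⟩ := by
      have h4 : (⟨p, u⟩ : TangentBundle (𝓡 (n + 1)) M) ∈ (tangentCoord p).source :=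
        mem_tangentCoord_source.2 hsrc
      rw [← (tangentCoord p).left_inv h4, tangentCoord_apply hsrc]
    have hu2 := hu.2.1
    rw [h3] at hu2
    simp only [flowUV, LorentzMetric.flowCoord]
    rw [h3, tangentCoord_apply hu2]
    rfl
  have hΨ : HasFDerivAt C.flowUV (fderiv ℝ C.flowUV (C.coordU (extChartAt (𝓡 n) x₀ x₀), C.coordv₀))
      (extChartAt (𝓡 (n + 1)) p p, dChart p p v) := by
    rw [hbase]
    have := C.flowRegularAt_base.contDiffAt
    rw [tangentCoord_base] at this
    exact (this.differentiableAt one_ne_zero).hasFDerivAt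
  have h5 : HasFDerivAt (fun u : EuclideanSpace ℝ (Fin (n + 1)) =>
      (extChartAt (𝓡 (n + 1)) p p, dChart p p u))
      (ContinuousLinearMap.prod (0 : EuclideanSpace ℝ (Fin (n + 1)) →L[ℝ]
        EuclideanSpace ℝ (Fin (n + 1))) (dChart p p)) v :=
    (hasFDerivAt_const _ _).prodMk (dChart p p).hasFDerivAt
  have h6 := (HasFDerivAt.comp (g := C.flowUV) v hΨ h5).fst
  rw [Filter.EventuallyEq.fderiv_eq hcoord] at h1
  obtain ⟨u, rfl⟩ := (dChart_bijective p hsrc).2 w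
  have h7 : mfderiv (𝓡 (n + 1)) 𝓘(ℝ, EuclideanSpace ℝ (Fin (n + 1)))
      (extChartAt (𝓡 (n + 1)) (C.ιV y₀)) (e v)
      (mfderiv 𝓘(ℝ, EuclideanSpace ℝ (Fin (n + 1))) (𝓡 (n + 1)) e v u) = 0 := by
    refine (DFunLike.congr_fun h1 u).symm.trans ?_
    exact (DFunLike.congr_fun h6.fderiv u).trans hw
  have h8 : Function.Injective (dChart (m := n + 1) (C.ιV y₀) (e v)) :=
    (dChart_bijective (C.ιV y₀) (by rw [hend]; exact mem_extChartAt_source _)).1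
  have h9 := h8 (h7.trans (map_zero _).symm)
  have h10 : u = 0 := hinj (h9.trans (map_zero _).symm)
  rw [h10, map_zero]

end LightRaySetup

namespace LorentzMetric
variable {n : ℕ} {M : Type*} [TopologicalSpace M]
  [ChartedSpace (EuclideanSpace ℝ (Fin (n + 1))) M] [IsManifold (𝓡 (n + 1)) ∞ M]
  {g : LorentzMetric n M}

theorem inChart_tangentCoord {p : M} {q : TangentBundle (𝓡 (n + 1)) M}
    (hq : q.1 ∈ (extChartAt (𝓡 (n + 1)) p).source) (a : TangentSpace (𝓡 (n + 1)) q.1) :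
    g.inChart p (tangentCoord p q).1 (tangentCoord p q).2 (dChart p q.1 a) = g.val q.1 q.2 a := by
  rw [tangentCoord_apply hq]
  exact g.inChart_dChart hq _ _

theorem formEnergy_tangentCoord {p : M} {q : TangentBundle (𝓡 (n + 1)) M}
    (hq : q.1 ∈ (extChartAt (𝓡 (n + 1)) p).source) :
    formEnergy (g.inChart p) (tangentCoord p q) = g.val q.1 q.2 q.2 := by
  rw [← inChart_tangentCoord hq, formEnergy, tangentCoord_apply hq]

end LorentzMetric

/-! ### The world function -/

section Chart

variable {n : ℕ} {U V : Type*}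
  [TopologicalSpace U] [ChartedSpace (EuclideanSpace ℝ (Fin n)) U]
  [TopologicalSpace V] [ChartedSpace (EuclideanSpace ℝ (Fin n)) V]

/-- The chart of `U × V` at `(x₀, y₀)`. -/
def chartUV (x₀ : U) (y₀ : V) (p : U × V) : EuclideanSpace ℝ (Fin n) × EuclideanSpace ℝ (Fin n) :=
  (extChartAt (𝓡 n) x₀ p.1, extChartAt (𝓡 n) y₀ p.2)

theorem tendsto_chartUV (x₀ : U) (y₀ : V) :
    Tendsto (chartUV x₀ y₀) (𝓝 (x₀, y₀))
      (𝓝 (extChartAt (𝓡 n) x₀ x₀, extChartAt (𝓡 n) y₀ y₀)) :=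
  ((continuousAt_extChartAt x₀).comp (f := Prod.fst) (x := (x₀, y₀)) continuousAt_fst).prodMk
    ((continuousAt_extChartAt y₀).comp (f := Prod.snd) (x := (x₀, y₀)) continuousAt_snd)

end Chart

theorem TotalSpace.exists_eq_mk {B F : Type*} {E : B → Type*} {q : TotalSpace F E} {x : B}
    (h : q.1 = x) : ∃ v : E x, q = ⟨x, v⟩ := by
  obtain ⟨x', v⟩ := q
  subst h
  exact ⟨v, rfl⟩

namespace LightRaySetup

variable {n : ℕ} {U V M : Type*}
  [TopologicalSpace U] [ChartedSpace (EuclideanSpace ℝ (Fin n)) U] [IsManifold (𝓡 n) ∞ U]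
  [TopologicalSpace V] [ChartedSpace (EuclideanSpace ℝ (Fin n)) V] [IsManifold (𝓡 n) ∞ V]
  [TopologicalSpace M] [ChartedSpace (EuclideanSpace ℝ (Fin (n + 1))) M]
  [IsManifold (𝓡 (n + 1)) ∞ M] {x₀ : U} {y₀ : V} (C : LightRaySetup n U V M x₀ y₀)

/-- The initial condition `q(x, y)` of the geodesic from `x` to `y`, unique among those in `N`, and
the world function `ρ(x, y) = g(v, v)`, `q(x, y) = (x, v)`, in the coordinates `chartUV`, whose
differential is given by the first variation formula. -/
structure IsWorldFunction (q : U × V → TangentBundle (𝓡 (n + 1)) M)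
    (N : Set (TangentBundle (𝓡 (n + 1)) M))
    (ρ : EuclideanSpace ℝ (Fin n) × EuclideanSpace ℝ (Fin n) → ℝ) : Prop where
  nhds : N ∈ 𝓝 C.base
  tendsto : Tendsto q (𝓝 (x₀, y₀)) (𝓝 C.base)
  base : q (x₀, y₀) = C.base
  unique : ∀ᶠ p in 𝓝 (x₀, y₀), ∀ v : TangentSpace (𝓡 (n + 1)) (C.ιU p.1),
    (⟨C.ιU p.1, v⟩ : TangentBundle (𝓡 (n + 1)) M) ∈ N → C.g.exp (C.ιU p.1) v = C.ιV p.2 →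
      q p = ⟨C.ιU p.1, v⟩
  connects : ∀ᶠ p in 𝓝 (x₀, y₀), ∃ (v : TangentSpace (𝓡 (n + 1)) (C.ιU p.1))
    (w : TangentSpace (𝓡 (n + 1)) (C.ιV p.2)), q p = ⟨C.ιU p.1, v⟩ ∧
      C.g.flow 1 ⟨C.ιU p.1, v⟩ = ⟨C.ιV p.2, w⟩
  energy : ∀ᶠ p in 𝓝 (x₀, y₀), ρ (chartUV x₀ y₀ p) = C.g.val (q p).1 (q p).2 (q p).2
  variation : ∀ᶠ p in 𝓝 (x₀, y₀),
    ∃ L : EuclideanSpace ℝ (Fin n) × EuclideanSpace ℝ (Fin n) →L[ℝ] ℝ,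
    HasFDerivAt ρ L (chartUV x₀ y₀ p) ∧
    ∀ (v : TangentSpace (𝓡 (n + 1)) (C.ιU p.1)) (w : TangentSpace (𝓡 (n + 1)) (C.ιV p.2)),
      q p = ⟨C.ιU p.1, v⟩ → C.g.flow 1 ⟨C.ιU p.1, v⟩ = ⟨C.ιV p.2, w⟩ →
      ∀ (α : TangentSpace (𝓡 n) p.1) (β : TangentSpace (𝓡 n) p.2),
        L (dChart x₀ p.1 α, dChart y₀ p.2 β) =
          2 * (C.g.flat C.ιV p.2 w β - C.g.flat C.ιU p.1 v α)

theorem contDiffAt_flowUV [T2Space M] :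
    ContDiffAt ℝ 1 C.flowUV (C.coordU (extChartAt (𝓡 n) x₀ x₀), C.coordv₀) := by
  rw [← tangentCoord_base]
  exact C.flowRegularAt_base.contDiffAt

theorem exists_isWorldFunction [T2Space M] : ∃ q N ρ, C.IsWorldFunction q N ρ := by
  set p₀ := C.ιU x₀ with hp₀
  set p₁ := C.ιV y₀ with hp₁
  set a₀ := extChartAt (𝓡 n) x₀ x₀ with ha₀
  set b₀ := extChartAt (𝓡 n) y₀ y₀ with hb₀
  have hreg := C.flowRegularAt_base
  have hΨ := C.contDiffAt_flowUV
  obtain ⟨sol, hsol, hsol₀, hsol1, N, hN, hsol2⟩ := exists_implicit_solution (i := C.coordU)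
    (j := C.coordV) (F := fun z => (C.flowUV z).1) (w₀ := C.coordv₀)
    (C.contDiffAt_coordU.of_le (WithTop.coe_le_coe.2 le_top))
    (C.contDiffAt_coordV.of_le (WithTop.coe_le_coe.2 le_top)) hΨ.fst
    (congrArg Prod.fst C.flowUV_base) (fun w hw => by
      rw [(hΨ.differentiableAt one_ne_zero).hasFDerivAt.fst.fderiv] at hw
      exact C.fderiv_flowUV_injective w hw)
  set z : EuclideanSpace ℝ (Fin n) × EuclideanSpace ℝ (Fin n) →
    EuclideanSpace ℝ (Fin (n + 1)) × EuclideanSpace ℝ (Fin (n + 1)) :=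
    fun c => (C.coordU c.1, sol c) with hz
  have hzc : ContDiffAt ℝ 1 z (a₀, b₀) :=
    ((C.contDiffAt_coordU.of_le (WithTop.coe_le_coe.2 le_top)).comp (f := Prod.fst) (a₀, b₀)
      contDiffAt_fst).prodMk hsol
  have hz₀ : z (a₀, b₀) = tangentCoord p₀ C.base := by
    rw [tangentCoord_base]
    exact Prod.ext rfl hsol₀
  have hchart := tendsto_chartUV (n := n) x₀ y₀
  have hzt : Tendsto z (𝓝 (a₀, b₀)) (𝓝 (tangentCoord p₀ C.base)) :=
    hz₀ ▸ hzc.continuousAt.tendsto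
  set q : U × V → TangentBundle (𝓡 (n + 1)) M :=
    fun p => (tangentCoord p₀).symm (z (chartUV x₀ y₀ p)) with hq
  have hU : ∀ᶠ p in 𝓝 (x₀, y₀), p.1 ∈ (extChartAt (𝓡 n) x₀).source ∧
      C.ιU p.1 ∈ (extChartAt (𝓡 (n + 1)) p₀).source :=
    C.eventually_ιU.prod_inl_nhds y₀
  have hV : ∀ᶠ p in 𝓝 (x₀, y₀), p.2 ∈ (extChartAt (𝓡 n) y₀).source ∧
      C.ιV p.2 ∈ (extChartAt (𝓡 (n + 1)) p₁).source :=
    C.eventually_ιV.prod_inr_nhds x₀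
  have hzU : ∀ᶠ p in 𝓝 (x₀, y₀),
      (z (chartUV x₀ y₀ p)).1 = extChartAt (𝓡 (n + 1)) p₀ (C.ιU p.1) := by
    filter_upwards [hU] with p hp using coordU_apply hp.1
  have hqcoord : ∀ᶠ p in 𝓝 (x₀, y₀), tangentCoord p₀ (q p) = z (chartUV x₀ y₀ p) := by
    filter_upwards [hU, hzU] with p hp hp'
    refine (tangentCoord p₀).right_inv (mem_tangentCoord_target.2 ?_)
    rw [hp']
    exact (extChartAt (𝓡 (n + 1)) p₀).map_source hp.2
  have hq1 : ∀ᶠ p in 𝓝 (x₀, y₀), (q p).1 = C.ιU p.1 := by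
    filter_upwards [hU, hzU] with p hp hp'
    rw [hq]
    simp only
    rw [tangentCoord_symm_apply (by rw [hp']; exact (extChartAt _ p₀).map_source hp.2)]
    simp only [hp']
    exact (extChartAt _ p₀).left_inv hp.2
  have hflow : ∀ᶠ p in 𝓝 (x₀, y₀), (C.g.flow 1 (q p)).1 ∈ (extChartAt (𝓡 (n + 1)) p₁).source ∧
      (z (chartUV x₀ y₀ p)).1 ∈ (extChartAt (𝓡 (n + 1)) p₀).target ∧
      C.flowUV (z (chartUV x₀ y₀ p)) = tangentCoord p₁ (C.g.flow 1 (q p)) := by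
    filter_upwards [(hzt.comp hchart).eventually hreg.eventually_source] with p hp
    exact ⟨hp.2.1, hp.1, rfl⟩
  have hq2 : ∀ᶠ p in 𝓝 (x₀, y₀), (C.g.flow 1 (q p)).1 = C.ιV p.2 := by
    filter_upwards [hflow, hV, hchart.eventually hsol1] with p h1 h2 h3
    refine (extChartAt (𝓡 (n + 1)) p₁).injOn h1.1 h2.2 ?_
    have h4 := h1.2.2
    rw [tangentCoord_apply h1.1] at h4
    exact (congrArg Prod.fst h4).symm.trans (h3.trans (coordV_apply h2.1))
  refine ⟨q, {q | (tangentCoord p₀ q).2 ∈ N ∧ q ∈ (tangentCoord p₀).source ∧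
    C.g.flow 1 q ∈ (tangentCoord p₁).source}, fun c => formEnergy (C.g.inChart p₀) (z c),
    ?_, ?_, ?_, ?_, ?_, ?_, ?_⟩
  · have h1 := (tangentCoord p₀).continuousAt C.base_mem_source
    refine (h1.snd.eventually_mem ?_).and (Filter.Eventually.and
      ((tangentCoord p₀).open_source.mem_nhds C.base_mem_source)
      (hreg.continuousAt.eventually_mem ((tangentCoord p₁).open_source.mem_nhds
        (mem_tangentCoord_source.2 hreg.source'))))
    rw [tangentCoord_base]
    exact hN
  · have h1 := (tangentCoord p₀).symm.continuousAt
      ((tangentCoord p₀).map_source C.base_mem_source)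
    rw [ContinuousAt, (tangentCoord p₀).left_inv C.base_mem_source] at h1
    exact h1.comp (hzt.comp hchart)
  · have : q (x₀, y₀) = (tangentCoord p₀).symm (z (a₀, b₀)) := rfl
    rw [this, hz₀, (tangentCoord p₀).left_inv C.base_mem_source]
  · filter_upwards [hchart.eventually hsol2, hU, hV, hzU] with p h1 h2 h3 h4 v hv hexp
    have h5 : tangentCoord p₀ ⟨C.ιU p.1, v⟩ = (C.coordU (chartUV x₀ y₀ p).1,
        (tangentCoord p₀ ⟨C.ιU p.1, v⟩).2) := by
      refine Prod.ext ?_ rfl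
      rw [tangentCoord_apply (q := ⟨C.ιU p.1, v⟩) h2.2]
      exact h4.symm
    have h6 : (C.flowUV (tangentCoord p₀ ⟨C.ιU p.1, v⟩)).1 = C.coordV (chartUV x₀ y₀ p).2 := by
      rw [flowUV, LorentzMetric.flowCoord_tangentCoord (q := ⟨C.ιU p.1, v⟩) h2.2,
        tangentCoord_apply (mem_tangentCoord_source.1 hv.2.2)]
      refine Eq.trans ?_ (coordV_apply h3.1).symm
      exact congrArg _ hexp
    rw [h5] at h6
    have h7 := h1 _ hv.1 h6
    rw [← (tangentCoord p₀).left_inv hv.2.1, h5, ← h7]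
  · filter_upwards [hq1, hq2] with p h1 h2
    obtain ⟨v, hv⟩ := TotalSpace.exists_eq_mk h1
    rw [hv] at h2
    obtain ⟨w, hw⟩ := TotalSpace.exists_eq_mk h2
    exact ⟨v, w, hv, hw⟩
  · filter_upwards [hqcoord, hq1, hU] with p h1 h2 h3
    rw [← h1]
    exact LorentzMetric.formEnergy_tangentCoord (by rw [h2]; exact h3.2)
  · have hdz : ∀ᶠ c in 𝓝 (a₀, b₀), DifferentiableAt ℝ z c :=
      (hzc.eventually (by simp)).mono fun c h => h.differentiableAt one_ne_zero
    have hdi : ∀ᶠ c in 𝓝 (a₀, b₀), DifferentiableAt ℝ C.coordU c.1 :=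
      (((C.contDiffAt_coordU.of_le (m := 1)
        (WithTop.coe_le_coe.2 le_top)).eventually (by simp)).mono fun c h =>
          h.differentiableAt one_ne_zero).prod_inl_nhds b₀
    have hdj : ∀ᶠ c in 𝓝 (a₀, b₀), DifferentiableAt ℝ C.coordV c.2 :=
      (((C.contDiffAt_coordV.of_le (m := 1)
        (WithTop.coe_le_coe.2 le_top)).eventually (by simp)).mono fun c h =>
          h.differentiableAt one_ne_zero).prod_inr_nhds a₀
    have hdΨ : ∀ᶠ z in 𝓝 (tangentCoord p₀ C.base), DifferentiableAt ℝ C.flowUV z :=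
      (hreg.contDiffAt.eventually (by simp)).mono fun c h => h.differentiableAt one_ne_zero
    filter_upwards [hchart.eventually (hdz.and (hdi.and (hdj.and hsol1.eventually_nhds))),
      (hzt.comp hchart).eventually (hdΨ.and hreg.variation), hqcoord, hflow, hU, hV]
      with p ⟨h1, h2, h3, h4⟩ ⟨h5, h6⟩ h7 h8 h9 h10
    set c := chartUV (n := n) x₀ y₀ p with hc
    obtain ⟨L, hL, -⟩ := hasFDerivAt_formEnergy
      (LorentzMetric.differentiableAt_inChart (g := C.g) h8.2.1)
    refine ⟨L.comp (fderiv ℝ z c), hL.comp c h1.hasFDerivAt, fun v w hv hw α β => ?_⟩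
    -- differentiate `(Ψ (z c)).1 = j c.2` and `(z c).1 = i c.1`
    have e1 : ∀ δ, (fderiv ℝ C.flowUV (z c) (fderiv ℝ z c δ)).1 =
        fderiv ℝ C.coordV c.2 δ.2 := fun δ => by
      have d1 : HasFDerivAt (fun c => (C.flowUV (z c)).1) _ c :=
        (HasFDerivAt.comp (g := C.flowUV) c (DifferentiableAt.hasFDerivAt (x := z c) h5)
          h1.hasFDerivAt).fst
      have d2 : HasFDerivAt (fun c : EuclideanSpace ℝ (Fin n) × EuclideanSpace ℝ (Fin n) =>
          C.coordV c.2) _ c :=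
        HasFDerivAt.comp (g := C.coordV) (f := Prod.snd) c h3.hasFDerivAt hasFDerivAt_snd
      exact DFunLike.congr_fun ((d1.congr_of_eventuallyEq
        (h4.mono fun c hc => hc.symm)).unique d2) δ
    have e2 : ∀ δ, (fderiv ℝ z c δ).1 = fderiv ℝ C.coordU c.1 δ.1 := fun δ => by
      have d1 := h1.hasFDerivAt.fst
      have d2 : HasFDerivAt (fun c : EuclideanSpace ℝ (Fin n) × EuclideanSpace ℝ (Fin n) =>
          C.coordU c.1) _ c :=
        HasFDerivAt.comp (g := C.coordU) (f := Prod.fst) c h2.hasFDerivAt hasFDerivAt_fst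
      exact DFunLike.congr_fun (d1.unique d2) δ
    have h6' := h6 (fderiv ℝ z c (dChart x₀ p.1 α, dChart y₀ p.2 β))
    change C.g.inChart p₁ (C.flowUV (z c)).1 (C.flowUV (z c)).2 (fderiv ℝ C.flowUV (z c) _).1 =
      C.g.inChart p₀ (z c).1 (z c).2 (fderiv ℝ z c _).1 +
        1 / 2 * fderiv ℝ (formEnergy (C.g.inChart p₀)) (z c) _ at h6'
    rw [e1, e2, hL.fderiv, h8.2.2, ← h7, hv, hw] at h6'
    have f1 := dChart_mfderiv_ιV h10 β
    have f2 := dChart_mfderiv_ιU h9 α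
    change C.g.inChart p₁ _ _ (fderiv ℝ C.coordV (extChartAt (𝓡 n) y₀ p.2) (dChart y₀ p.2 β)) =
      C.g.inChart p₀ _ _ (fderiv ℝ C.coordU (extChartAt (𝓡 n) x₀ p.1) (dChart x₀ p.1 α)) + _ at h6'
    rw [← f1, ← f2] at h6'
    have f3 := LorentzMetric.inChart_tangentCoord (g := C.g) (q := ⟨C.ιV p.2, w⟩) h10.2
      (mfderiv (𝓡 n) (𝓡 (n + 1)) C.ιV p.2 β)
    have f4 := LorentzMetric.inChart_tangentCoord (g := C.g) (q := ⟨C.ιU p.1, v⟩) h9.2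
      (mfderiv (𝓡 n) (𝓡 (n + 1)) C.ιU p.1 α)
    rw [f3, f4] at h6'
    have h11 : C.g.flat C.ιV p.2 w β = C.g.flat C.ιU p.1 v α +
        1 / 2 * L (fderiv ℝ z c (dChart x₀ p.1 α, dChart y₀ p.2 β)) := h6'
    change L (fderiv ℝ z c _) = _
    linarith

end LightRaySetup

/-! ### Division of smooth functions -/

theorem contDiff_intervalIntegral {X : Type*} [NormedAddCommGroup X] [NormedSpace ℝ X]
    {G : X × ℝ → ℝ} (hG : ContDiff ℝ ∞ G) : ContDiff ℝ ∞ fun x => ∫ t in (0 : ℝ)..1, G (x, t) := by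
  -- the integral is the value at `0` of a convolution with the compactly supported `g x`
  let χ : ContDiffBump (0 : ℝ) := ⟨2, 3, by norm_num, by norm_num⟩
  let g : X → ℝ → ℝ := fun x s => χ s * G (x, -s)
  have hg : ContDiff ℝ ∞ (fun q : X × ℝ => g q.1 q.2) :=
    (χ.contDiff.comp contDiff_snd).mul (hG.comp (contDiff_fst.prodMk contDiff_snd.neg))
  have h := MeasureTheory.contDiffOn_convolution_right_with_param_comp (n := ⊤)
    (μ := MeasureTheory.volume.restrict (Ioc (0 : ℝ) 1)) (ContinuousLinearMap.mul ℝ ℝ)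
    (v := fun _ : X => (0 : ℝ)) contDiffOn_const (f := fun _ => (1 : ℝ)) (g := g) isOpen_univ
    (isCompact_closedBall (0 : ℝ) 3) (fun p x _ hx => by
      have : χ x = 0 := χ.zero_of_le_dist (by
        rw [Metric.mem_closedBall, not_le] at hx
        exact hx.le)
      simp [g, this])
    (MeasureTheory.locallyIntegrable_const 1) hg.contDiffOn
  rw [contDiffOn_univ] at h
  refine Eq.mpr (congrArg (ContDiff ℝ ∞) (funext fun x => ?_)) h
  rw [intervalIntegral.integral_of_le zero_le_one]
  refine MeasureTheory.setIntegral_congr_fun measurableSet_Ioc fun t ht => ?_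
  have : χ (0 - t) = 1 := χ.one_of_mem_closedBall (by
    rw [Metric.mem_closedBall, Real.dist_eq, abs_le]
    change _ ∧ _ ≤ (2 : ℝ)
    constructor
    · change -(2 : ℝ) ≤ _
      linarith [ht.1, ht.2]
    · linarith [ht.1, ht.2])
  simp only [ContinuousLinearMap.mul_apply', g, this, one_mul]
  simp

/-- Hadamard's lemma: `F(y) - F(y - l(y) e)` is a smooth multiple of `l`, the factor being the mean
of `∂ₑF` over the segment between the two points. -/
theorem exists_smooth_quotient_linear {X : Type*} [NormedAddCommGroup X] [NormedSpace ℝ X]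
    {F : X → ℝ} (hF : ContDiff ℝ ∞ F) (l : X →L[ℝ] ℝ) (e : X) :
    ∃ κ : X → ℝ, ContDiff ℝ ∞ κ ∧ ∀ y, F y - F (y - l y • e) = κ y * l y := by
  refine ⟨fun y => ∫ t in (0 : ℝ)..1, fderiv ℝ F (y - (1 - t) • l y • e) e, ?_, fun y => ?_⟩
  · refine contDiff_intervalIntegral (G := fun q : X × ℝ =>
      fderiv ℝ F (q.1 - (1 - q.2) • l q.1 • e) e) ?_
    have h1 : ContDiff ℝ ∞ (fderiv ℝ F) := hF.fderiv_right (by simp)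
    refine ContDiff.clm_apply (h1.comp ?_) contDiff_const
    fun_prop
  · have hd : ∀ t : ℝ, HasDerivAt (fun t : ℝ => F (y - (1 - t) • l y • e))
        (fderiv ℝ F (y - (1 - t) • l y • e) (l y • e)) t := fun t => by
      have h1 : HasDerivAt (fun t : ℝ => y - (1 - t) • l y • e) (l y • e) t := by
        have := (((hasDerivAt_id t).const_sub 1).smul_const (l y • e)).const_sub y
        simpa using this
      exact (hF.differentiable (by simp) _).hasFDerivAt.comp_hasDerivAt t h1
    have hc : Continuous fun t : ℝ => fderiv ℝ F (y - (1 - t) • l y • e) (l y • e) := by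
      have h1 : Continuous (fderiv ℝ F) := hF.continuous_fderiv (by simp)
      exact (h1.comp (by fun_prop)).clm_apply continuous_const
    have := intervalIntegral.integral_eq_sub_of_hasDerivAt (fun t _ => hd t)
      (hc.intervalIntegrable 0 1)
    simp only [sub_self, zero_smul, sub_zero, one_smul] at this
    rw [← this]
    simp only [map_smul, smul_eq_mul]
    rw [intervalIntegral.integral_const_mul, mul_comm]

/-- A smooth function `f` that vanishes on the zero set of a smooth function `h` with `dh ≠ 0` is a
smooth multiple of `h`; the factor is nonzero if `df ≠ 0`. -/
theorem exists_smooth_quotient {X : Type*} [NormedAddCommGroup X] [NormedSpace ℝ X]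
    [FiniteDimensional ℝ X] {f h : X → ℝ} {c₀ : X} (hf : ∀ᶠ c in 𝓝 c₀, ContDiffAt ℝ ∞ f c)
    (hh : ∀ᶠ c in 𝓝 c₀, ContDiffAt ℝ ∞ h c) (h0 : h c₀ = 0) (hdh : fderiv ℝ h c₀ ≠ 0)
    (hzero : ∀ᶠ c in 𝓝 c₀, h c = 0 → f c = 0) (hdf : fderiv ℝ f c₀ ≠ 0) :
    ∃ κ : X → ℝ, ∀ᶠ c in 𝓝 c₀, ContDiffAt ℝ ∞ κ c ∧ κ c ≠ 0 ∧ f c = κ c * h c := by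
  have : CompleteSpace X := FiniteDimensional.complete ℝ X
  set l := fderiv ℝ h c₀ with hl
  obtain ⟨e, he⟩ : ∃ e, l e = 1 := by
    obtain ⟨v, hv⟩ := DFunLike.exists_ne hdh
    refine ⟨(l v)⁻¹ • v, ?_⟩
    rw [map_smul, smul_eq_mul]
    exact inv_mul_cancel₀ hv
  -- coordinates in which `h` is the linear functional `l`
  set Ξ : X → X := fun c => (c - c₀) - l (c - c₀) • e + h c • e with hΞ
  have hlΞ : ∀ c, l (Ξ c) = h c := fun c => by simp [hΞ, he]
  have hΞ0 : Ξ c₀ = 0 := by simp [hΞ, h0]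
  have hΞc : ∀ c, ContDiffAt ℝ ∞ h c → ContDiffAt ℝ ∞ Ξ c := fun c hc => by
    have h1 : ContDiff ℝ ∞ fun c : X => (c - c₀) - l (c - c₀) • e := by fun_prop
    exact h1.contDiffAt.add (hc.smul contDiffAt_const)
  have hΞd : HasFDerivAt Ξ ((ContinuousLinearEquiv.refl ℝ X : X ≃L[ℝ] X) : X →L[ℝ] X) c₀ := by
    have h1 : HasFDerivAt h l c₀ := (hh.self_of_nhds.differentiableAt (by simp)).hasFDerivAt
    have h2 : HasFDerivAt (fun c : X => c - c₀) (ContinuousLinearMap.id ℝ X) c₀ :=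
      (hasFDerivAt_id c₀).sub_const c₀
    have h3 := (h2.sub ((l.hasFDerivAt.comp c₀ h2).smul_const e)).add (h1.smul_const e)
    refine h3.congr_fderiv ?_
    ext v
    simp
  have hΞc0 := hΞc c₀ hh.self_of_nhds
  set P := hΞc0.toOpenPartialHomeomorph Ξ hΞd (by simp) with hP
  have hsrc : c₀ ∈ P.source := hΞc0.mem_toOpenPartialHomeomorph_source hΞd (by simp)
  have htgt : (0 : X) ∈ P.target := by
    have := P.map_source hsrc
    rwa [show P c₀ = Ξ c₀ from rfl, hΞ0] at this
  have hsymm0 : P.symm 0 = c₀ := by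
    have := P.left_inv hsrc
    rwa [show P c₀ = Ξ c₀ from rfl, hΞ0] at this
  have hPs : ContDiffAt ℝ ∞ P.symm 0 :=
    P.contDiffAt_symm htgt (f₀' := ContinuousLinearEquiv.refl ℝ X) (by rw [hsymm0]; exact hΞd)
      (by rw [hsymm0]; exact hΞc0)
  have hPst : Tendsto P.symm (𝓝 0) (𝓝 c₀) := hsymm0 ▸ hPs.continuousAt.tendsto
  have hPsmooth : ∀ᶠ y in 𝓝 0, ContDiffAt ℝ ∞ P.symm y := by
    have h1 : ContinuousAt (fderiv ℝ Ξ) c₀ :=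
      ((hΞc0.of_le (m := 2) (WithTop.coe_le_coe.2 le_top)).fderiv_right (m := 1)
        (by norm_num)).continuousAt
    have h2 := (ContinuousLinearEquiv.refl ℝ X).nhds
    rw [← hΞd.fderiv] at h2
    filter_upwards [hPst.eventually ((h1.eventually h2).and hh), P.open_target.mem_nhds htgt]
      with y ⟨⟨e', he'⟩, hy2⟩ hy3
    refine P.contDiffAt_symm hy3 (f₀' := e') ?_ (hΞc _ hy2)
    rw [he']
    exact ((hΞc _ hy2).differentiableAt (by simp)).hasFDerivAt
  have hF : ∀ᶠ y in 𝓝 (0 : X), ContDiffAt ℝ ∞ (f ∘ P.symm) y ∧ (l y = 0 → f (P.symm y) = 0) := by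
    filter_upwards [hPsmooth, hPst.eventually (hf.and hzero), P.open_target.mem_nhds htgt]
      with y h1 ⟨h2, h3⟩ h4
    refine ⟨h2.comp y h1, fun h5 => h3 ?_⟩
    rw [← hlΞ, show Ξ (P.symm y) = P (P.symm y) from rfl, P.right_inv h4, h5]
  obtain ⟨r, hr, hball⟩ := Metric.eventually_nhds_iff_ball.1 hF
  let β : ContDiffBump (0 : X) := ⟨r / 4, r / 2, by linarith, by linarith⟩
  have hglobal : ContDiff ℝ ∞ fun y => β y * f (P.symm y) := by
    refine contDiff_iff_contDiffAt.2 fun y => ?_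
    by_cases hy : y ∈ Metric.ball (0 : X) r
    · exact β.contDiff.contDiffAt.mul (hball y hy).1
    · have h1 : (Metric.closedBall (0 : X) (r / 2))ᶜ ∈ 𝓝 y :=
        Metric.isClosed_closedBall.isOpen_compl.mem_nhds fun h => hy
          (Metric.closedBall_subset_ball (by linarith) h)
      refine contDiffAt_const (c := (0 : ℝ)) |>.congr_of_eventuallyEq ?_
      filter_upwards [h1] with y' hy'
      rw [mem_compl_iff, Metric.mem_closedBall, not_le] at hy'
      rw [β.zero_of_le_dist hy'.le, zero_mul]
  obtain ⟨κ, hκ, hκ'⟩ := exists_smooth_quotient_linear hglobal l e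
  have hΞt : Tendsto Ξ (𝓝 c₀) (𝓝 0) := hΞ0 ▸ hΞc0.continuousAt.tendsto
  have hfac : ∀ᶠ c in 𝓝 c₀, f c = κ (Ξ c) * h c := by
    have h1 : Tendsto (fun y => y - l y • e) (𝓝 (0 : X)) (𝓝 0) := by
      have : Continuous fun y => y - l y • e := by fun_prop
      simpa using this.tendsto 0
    filter_upwards [P.open_source.mem_nhds hsrc, hΞt.eventually (h1.eventually hF),
      hΞt.eventually (Metric.closedBall_mem_nhds (0 : X) (by linarith : 0 < r / 4))] with c h1 h2 h3
    have h4 := hκ' (Ξ c)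
    have h5 : f (P.symm (Ξ c - l (Ξ c) • e)) = 0 := h2.2 (by simp [he])
    rw [h5, mul_zero, sub_zero, β.one_of_mem_closedBall h3, one_mul, hlΞ,
      show Ξ c = P c from rfl, P.left_inv h1] at h4
    exact h4
  have hκc : ∀ᶠ c in 𝓝 c₀, ContDiffAt ℝ ∞ (κ ∘ Ξ) c := by
    filter_upwards [hh] with c hc using hκ.contDiffAt.comp c (hΞc c hc)
  have hκ0 : κ (Ξ c₀) ≠ 0 := by
    intro h1
    have h2 : HasFDerivAt (fun c => κ (Ξ c) * h c) _ c₀ :=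
      ((hκc.self_of_nhds.differentiableAt (by simp)).hasFDerivAt).mul
        (hh.self_of_nhds.differentiableAt (by simp)).hasFDerivAt
    refine hdf ?_
    rw [(h2.congr_of_eventuallyEq hfac).fderiv]
    simp [h1, h0]
  refine ⟨κ ∘ Ξ, ?_⟩
  filter_upwards [hκc, hfac, hκc.self_of_nhds.continuousAt.eventually_ne hκ0] with c h1 h2 h3
  exact ⟨h1, h3, h2⟩

/-! ### Functions with the same sign -/

section Sign

variable {X : Type*} [NormedAddCommGroup X] [NormedSpace ℝ X] {f h : X → ℝ} {c : X}

theorem eventually_neg_of_fderiv_neg (hf : DifferentiableAt ℝ f c) (h0 : f c = 0) {a : X}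
    (ha : fderiv ℝ f c a < 0) : ∀ᶠ t in 𝓝[>] (0 : ℝ), f (c + t • a) < 0 := by
  have h1 : Tendsto (fun t : ℝ => t⁻¹ • (f (c + t • a) - f c)) (𝓝[>] 0) (𝓝 (fderiv ℝ f c a)) :=
    (hf.hasFDerivAt.hasLineDerivAt a).tendsto_slope_zero_right
  filter_upwards [h1.eventually_lt_const ha, self_mem_nhdsWithin] with t ht ht0
  rw [h0, sub_zero, smul_eq_mul] at ht
  by_contra hcon
  exact absurd ht (not_lt.2 (mul_nonneg (inv_nonneg.2 (le_of_lt ht0)) (not_lt.1 hcon)))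

theorem fderiv_nonpos_of_eventually_neg (hf : DifferentiableAt ℝ f c) (h0 : f c = 0) {a : X}
    (ha : ∀ᶠ t in 𝓝[>] (0 : ℝ), f (c + t • a) < 0) : fderiv ℝ f c a ≤ 0 := by
  have h1 : Tendsto (fun t : ℝ => t⁻¹ • (f (c + t • a) - f c)) (𝓝[>] 0) (𝓝 (fderiv ℝ f c a)) :=
    (hf.hasFDerivAt.hasLineDerivAt a).tendsto_slope_zero_right
  refine le_of_tendsto h1 ?_
  filter_upwards [ha, self_mem_nhdsWithin] with t ht ht0
  rw [h0, sub_zero, smul_eq_mul]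
  exact mul_nonpos_of_nonneg_of_nonpos (inv_nonneg.2 (le_of_lt ht0)) ht.le

/-- A functional that is nonpositive on the open half-space `L < 0` is a positive multiple of `L`,
unless it is zero. -/
theorem exists_pos_smul_of_neg_imp {L R : X →L[ℝ] ℝ} (hL : L ≠ 0) (hR : R ≠ 0)
    (h : ∀ a, L a < 0 → R a ≤ 0) : ∃ κ : ℝ, 0 < κ ∧ R = κ • L := by
  obtain ⟨v, hv⟩ := DFunLike.exists_ne hL
  simp only [zero_apply] at hv
  obtain ⟨b, hb⟩ : ∃ b, L b = -1 := ⟨-(L v)⁻¹ • v, by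
    rw [map_smul, smul_eq_mul, neg_mul, inv_mul_cancel₀ hv]⟩
  have hker : ∀ a, L a = 0 → R a = 0 := by
    intro a ha
    by_contra hne
    have h1 := h (b + ((1 - R b) / R a) • a) (by simp [ha, hb])
    rw [map_add, map_smul, smul_eq_mul, div_mul_cancel₀ _ hne] at h1
    linarith
  have heq : R = (-R b) • L := by
    ext a
    have h1 := hker (a + L a • b) (by simp [hb])
    simp only [map_add, map_smul, smul_eq_mul] at h1
    simp only [smul_apply, smul_eq_mul]
    linarith
  refine ⟨-R b, lt_of_le_of_ne (by linarith [h b (by rw [hb]; norm_num)]) fun h0 => hR ?_, heq⟩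
  rw [heq, ← h0, zero_smul]

theorem tendsto_add_smul_nhdsGT (c a : X) :
    Tendsto (fun t : ℝ => c + t • a) (𝓝[>] 0) (𝓝 c) := by
  have : Continuous fun t : ℝ => c + t • a := by fun_prop
  have h := this.tendsto 0
  rw [zero_smul, add_zero] at h
  exact h.mono_left nhdsWithin_le_nhds

/-- If `h` is negative wherever `f` is, their differentials at a common zero, unless zero, are
positive multiples of each other. -/
theorem exists_fderiv_eq_smul (hf : DifferentiableAt ℝ f c) (hh : DifferentiableAt ℝ h c)
    (hf0 : f c = 0) (hh0 : h c = 0) (hdf : fderiv ℝ f c ≠ 0) (hdh : fderiv ℝ h c ≠ 0)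
    (hsign : ∀ᶠ c' in 𝓝 c, f c' < 0 → h c' < 0) :
    ∃ κ : ℝ, 0 < κ ∧ fderiv ℝ h c = κ • fderiv ℝ f c :=
  exists_pos_smul_of_neg_imp hdf hdh fun a ha =>
    fderiv_nonpos_of_eventually_neg hh hh0 (by
      filter_upwards [eventually_neg_of_fderiv_neg hf hf0 ha,
        (tendsto_add_smul_nhdsGT c a).eventually hsign] with t h1 h2 using h2 h1)

/-- A regular zero of `f` is a zero of every continuous function that is negative at the same
points. -/
theorem eq_zero_of_neg_iff (hf : DifferentiableAt ℝ f c) (hf0 : f c = 0) (hdf : fderiv ℝ f c ≠ 0)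
    (hh : ContinuousAt h c) (hsign : ∀ᶠ c' in 𝓝 c, f c' < 0 ↔ h c' < 0) : h c = 0 := by
  obtain ⟨v, hv⟩ := DFunLike.exists_ne hdf
  simp only [zero_apply] at hv
  obtain ⟨a, ha⟩ : ∃ a, fderiv ℝ f c a < 0 := ⟨-(fderiv ℝ f c v)⁻¹ • v, by
    rw [map_smul, smul_eq_mul, neg_mul, inv_mul_cancel₀ hv]; norm_num⟩
  have ht := tendsto_add_smul_nhdsGT c a
  refine le_antisymm (le_of_tendsto (hh.tendsto.comp ht) ?_) (not_lt.1 fun h1 => ?_)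
  · filter_upwards [eventually_neg_of_fderiv_neg hf hf0 ha, ht.eventually hsign] with t h1 h2
    exact (h2.1 h1).le
  · exact absurd (hsign.self_of_nhds.2 h1) (by rw [hf0]; exact lt_irrefl _)

end Sign

/-! ### Functions on a product of manifolds in coordinates -/

section Chart

variable {n : ℕ} {U V : Type*}
  [TopologicalSpace U] [ChartedSpace (EuclideanSpace ℝ (Fin n)) U] [IsManifold (𝓡 n) ∞ U]
  [TopologicalSpace V] [ChartedSpace (EuclideanSpace ℝ (Fin n)) V] [IsManifold (𝓡 n) ∞ V]
  {x₀ : U} {y₀ : V}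

/-- The inverse of the chart of `U × V` at `(x₀, y₀)`. -/
def chartUVSymm (x₀ : U) (y₀ : V) (c : EuclideanSpace ℝ (Fin n) × EuclideanSpace ℝ (Fin n)) :
    U × V :=
  ((extChartAt (𝓡 n) x₀).symm c.1, (extChartAt (𝓡 n) y₀).symm c.2)

omit [IsManifold (𝓡 n) ∞ U] [IsManifold (𝓡 n) ∞ V] in
theorem eventually_chartUVSymm_chartUV :
    ∀ᶠ p in 𝓝 (x₀, y₀), chartUVSymm x₀ y₀ (chartUV (n := n) x₀ y₀ p) = p := by
  have h1 := Filter.Eventually.prod_nhds (extChartAt_source_mem_nhds (I := 𝓡 n) x₀)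
    (extChartAt_source_mem_nhds (I := 𝓡 n) y₀)
  filter_upwards [h1] with p hp
  exact Prod.ext ((extChartAt (𝓡 n) x₀).left_inv hp.1) ((extChartAt (𝓡 n) y₀).left_inv hp.2)

omit [IsManifold (𝓡 n) ∞ U] [IsManifold (𝓡 n) ∞ V] in
theorem eventually_chartUV_chartUVSymm :
    ∀ᶠ c in 𝓝 (extChartAt (𝓡 n) x₀ x₀, extChartAt (𝓡 n) y₀ y₀),
      chartUV x₀ y₀ (chartUVSymm x₀ y₀ c) = c := by
  have h1 := Filter.Eventually.prod_nhds (extChartAt_target_mem_nhds (I := 𝓡 n) x₀)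
    (extChartAt_target_mem_nhds (I := 𝓡 n) y₀)
  filter_upwards [h1] with p hp
  exact Prod.ext ((extChartAt (𝓡 n) x₀).right_inv hp.1) ((extChartAt (𝓡 n) y₀).right_inv hp.2)

omit [IsManifold (𝓡 n) ∞ U] [IsManifold (𝓡 n) ∞ V] in
theorem tendsto_chartUVSymm :
    Tendsto (chartUVSymm x₀ y₀) (𝓝 (extChartAt (𝓡 n) x₀ x₀, extChartAt (𝓡 n) y₀ y₀))
      (𝓝 (x₀, y₀)) := by
  have h1 := continuousAt_extChartAt_symm (I := 𝓡 n) x₀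
  have h2 := continuousAt_extChartAt_symm (I := 𝓡 n) y₀
  rw [ContinuousAt, extChartAt_to_inv] at h1 h2
  rw [nhds_prod_eq, nhds_prod_eq]
  exact h1.prodMap h2

omit [IsManifold (𝓡 n) ∞ U] [IsManifold (𝓡 n) ∞ V] in
theorem eventually_chartUV_iff
    {P : EuclideanSpace ℝ (Fin n) × EuclideanSpace ℝ (Fin n) → Prop} :
    (∀ᶠ p in 𝓝 (x₀, y₀), P (chartUV x₀ y₀ p)) ↔
      ∀ᶠ c in 𝓝 (extChartAt (𝓡 n) x₀ x₀, extChartAt (𝓡 n) y₀ y₀), P c := by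
  refine ⟨fun h => ?_, fun h => (tendsto_chartUV x₀ y₀).eventually h⟩
  filter_upwards [tendsto_chartUVSymm.eventually h, eventually_chartUV_chartUVSymm] with c h1 h2
  rwa [h2] at h1

theorem eventually_contMDiffAt_chartUV :
    ∀ᶠ p in 𝓝 (x₀, y₀), ContMDiffAt ((𝓡 n).prod (𝓡 n))
      𝓘(ℝ, EuclideanSpace ℝ (Fin n) × EuclideanSpace ℝ (Fin n)) ∞ (chartUV (n := n) x₀ y₀) p := by
  have h1 := Filter.Eventually.prod_nhds
    ((chartAt (EuclideanSpace ℝ (Fin n)) x₀).open_source.mem_nhds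
    (mem_chart_source _ x₀)) ((chartAt (EuclideanSpace ℝ (Fin n)) y₀).open_source.mem_nhds
    (mem_chart_source _ y₀))
  filter_upwards [h1] with p hp
  exact ContMDiffAt.prodMk_space
    ((contMDiffAt_extChartAt' (I := 𝓡 n) hp.1).comp p contMDiffAt_fst)
    ((contMDiffAt_extChartAt' (I := 𝓡 n) hp.2).comp p contMDiffAt_snd)

theorem eventually_contMDiffAt_chartUVSymm :
    ∀ᶠ c in 𝓝 (extChartAt (𝓡 n) x₀ x₀, extChartAt (𝓡 n) y₀ y₀),
      ContMDiffAt 𝓘(ℝ, EuclideanSpace ℝ (Fin n) × EuclideanSpace ℝ (Fin n)) ((𝓡 n).prod (𝓡 n)) ∞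
        (chartUVSymm x₀ y₀) c := by
  have h1 := Filter.Eventually.prod_nhds (extChartAt_target_mem_nhds (I := 𝓡 n) x₀)
    (extChartAt_target_mem_nhds (I := 𝓡 n) y₀)
  filter_upwards [h1] with c hc
  have h2 := (contMDiffOn_extChartAt_symm (I := 𝓡 n) (n := ∞) x₀).contMDiffAt
    ((isOpen_chart_target x₀).mem_nhds hc.1)
  have h3 := (contMDiffOn_extChartAt_symm (I := 𝓡 n) (n := ∞) y₀).contMDiffAt
    ((isOpen_chart_target y₀).mem_nhds hc.2)
  have f1 : ContMDiffAt 𝓘(ℝ, EuclideanSpace ℝ (Fin n) × EuclideanSpace ℝ (Fin n)) (𝓡 n) ∞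
    (Prod.fst : EuclideanSpace ℝ (Fin n) × EuclideanSpace ℝ (Fin n) → _) c :=
    contDiff_fst.contMDiff.contMDiffAt
  have f2 : ContMDiffAt 𝓘(ℝ, EuclideanSpace ℝ (Fin n) × EuclideanSpace ℝ (Fin n)) (𝓡 n) ∞
    (Prod.snd : EuclideanSpace ℝ (Fin n) × EuclideanSpace ℝ (Fin n) → _) c :=
    contDiff_snd.contMDiff.contMDiffAt
  exact (h2.comp c f1).prodMk (h3.comp c f2)

theorem eventually_contDiffAt_comp_chartUVSymm {r : U × V → ℝ}
    (hr : ∀ᶠ p in 𝓝 (x₀, y₀), ContMDiffAt ((𝓡 n).prod (𝓡 n)) 𝓘(ℝ, ℝ) ∞ r p) :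
    ∀ᶠ c in 𝓝 (extChartAt (𝓡 n) x₀ x₀, extChartAt (𝓡 n) y₀ y₀),
      ContDiffAt ℝ ∞ (r ∘ chartUVSymm x₀ y₀) c := by
  filter_upwards [tendsto_chartUVSymm.eventually hr, eventually_contMDiffAt_chartUVSymm]
    with c h1 h2
  exact (h1.comp c h2).contDiffAt

theorem eventually_fderiv_comp_chartUVSymm_ne_zero {r : U × V → ℝ}
    (hr : ∀ᶠ p in 𝓝 (x₀, y₀), ContMDiffAt ((𝓡 n).prod (𝓡 n)) 𝓘(ℝ, ℝ) ∞ r p) :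
    ∀ᶠ p in 𝓝 (x₀, y₀), mfderiv ((𝓡 n).prod (𝓡 n)) 𝓘(ℝ, ℝ) r p ≠ 0 →
      fderiv ℝ (r ∘ chartUVSymm (n := n) x₀ y₀) (chartUV (n := n) x₀ y₀ p) ≠ 0 := by
  filter_upwards [eventually_chartUV_iff.2 (eventually_contDiffAt_comp_chartUVSymm hr),
    eventually_contMDiffAt_chartUV (n := n) (x₀ := x₀) (y₀ := y₀),
    (eventually_chartUVSymm_chartUV (n := n) (x₀ := x₀) (y₀ := y₀)).eventually_nhds]
    with p h1 h2 h3 h4 h5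
  refine h4 ?_
  have h6 : r =ᶠ[𝓝 p] (r ∘ chartUVSymm x₀ y₀) ∘ chartUV (n := n) x₀ y₀ := by
    filter_upwards [h3] with p' hp'
    simp only [Function.comp_apply, hp']
  rw [h6.mfderiv_eq, mfderiv_comp p (h1.differentiableAt (by simp)).mdifferentiableAt
    (h2.mdifferentiableAt (by simp)), mfderiv_eq_fderiv]
  ext v
  exact DFunLike.congr_fun h5 _

end Chart

theorem LorentzMetric.val_smul_self {n : ℕ} {M : Type*} [TopologicalSpace M]
    [ChartedSpace (EuclideanSpace ℝ (Fin (n + 1))) M] [IsManifold (𝓡 (n + 1)) ∞ M]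
    (g : LorentzMetric n M) {x : M} {v : TangentSpace (𝓡 (n + 1)) x} (h : g.val x v v = 0) (a : ℝ) :
    g.val x (a • v) (a • v) = 0 := by
  have h1 := (g.val x).map_smul a v
  have h2 := (g.val x v).map_smul a v
  rw [h1]
  change a • g.val x v (a • v) = 0
  rw [h2, h, smul_zero, smul_zero]

namespace LightRaySetup

variable {n : ℕ} {U V M : Type*}
  [TopologicalSpace U] [ChartedSpace (EuclideanSpace ℝ (Fin n)) U] [IsManifold (𝓡 n) ∞ U]
  [TopologicalSpace V] [ChartedSpace (EuclideanSpace ℝ (Fin n)) V] [IsManifold (𝓡 n) ∞ V]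
  [TopologicalSpace M] [ChartedSpace (EuclideanSpace ℝ (Fin (n + 1))) M]
  [IsManifold (𝓡 (n + 1)) ∞ M] {x₀ : U} {y₀ : V} {C : LightRaySetup n U V M x₀ y₀}
  {q : U × V → TangentBundle (𝓡 (n + 1)) M} {N : Set (TangentBundle (𝓡 (n + 1)) M)}
  {ρ : EuclideanSpace ℝ (Fin n) × EuclideanSpace ℝ (Fin n) → ℝ}

/-! ### Light rays and the zero set of the world function -/

theorem TotalSpace.mk_inj_right {B F : Type*} {E : B → Type*} {x : B} {v w : E x}
    (h : (⟨x, v⟩ : TotalSpace F E) = ⟨x, w⟩) : v = w := by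
  cases h; rfl

namespace IsWorldFunction

theorem connects_iff (hρ : C.IsWorldFunction q N ρ) {W : Set (TangentBundle (𝓡 (n + 1)) M)}
    (hW : W ∈ 𝓝 C.base) (hWN : W ⊆ N) :
    ∀ᶠ p in 𝓝 (x₀, y₀), ∀ v, C.Connects W p.1 p.2 v ↔ q p = ⟨C.ιU p.1, v⟩ := by
  filter_upwards [hρ.unique, hρ.connects, hρ.tendsto.eventually_mem hW] with p h1 h2 h3 v
  refine ⟨fun h => h1 v (hWN h.1) h.2, fun h => ⟨h ▸ h3, ?_⟩⟩
  obtain ⟨v', w, hv', hw⟩ := h2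
  obtain rfl := TotalSpace.mk_inj_right (h.symm.trans hv')
  exact congrArg TotalSpace.proj hw

theorem eventually_ne_zero (hρ : C.IsWorldFunction q N ρ) :
    ∀ᶠ p in 𝓝 (x₀, y₀), ∀ v : TangentSpace (𝓡 (n + 1)) (C.ιU p.1), q p = ⟨C.ιU p.1, v⟩ →
      v ≠ 0 := by
  have h1 : (tangentCoord (C.ιU x₀) C.base).2 ≠ 0 := by
    rw [tangentCoord_base]
    intro h
    exact C.null.1 ((dChart_bijective _ (mem_extChartAt_source _)).1 (h.trans (map_zero _).symm))
  have h2 := ((tangentCoord (C.ιU x₀)).continuousAt C.base_mem_source).snd.eventually_ne h1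
  filter_upwards [hρ.tendsto.eventually (h2.and
    ((tangentCoord (C.ιU x₀)).open_source.mem_nhds C.base_mem_source))] with p ⟨h3, h4⟩ v hv hv0
  rw [tangentCoord_apply (mem_tangentCoord_source.1 h4), hv, hv0] at h3
  exact h3 (map_zero _)

theorem lightPairs_iff (hρ : C.IsWorldFunction q N ρ) {W : Set (TangentBundle (𝓡 (n + 1)) M)}
    (hW : W ∈ 𝓝 C.base) (hWN : W ⊆ N) :
    ∀ᶠ p in 𝓝 (x₀, y₀), p ∈ C.lightPairs W ↔ ρ (chartUV x₀ y₀ p) = 0 := by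
  filter_upwards [hρ.connects_iff hW hWN, hρ.connects, hρ.energy, hρ.eventually_ne_zero]
    with p h1 ⟨v, w, hv, hw⟩ h3 h4
  rw [h3, hv]
  constructor
  · rintro ⟨v', ⟨h5, h6⟩, -⟩
    obtain rfl := TotalSpace.mk_inj_right (((h1 v').1 h5).symm.trans hv)
    exact h6.2
  · intro h
    exact ⟨v, ⟨(h1 v).2 hv, h4 v hv, h⟩, fun u hu =>
      TotalSpace.mk_inj_right (((h1 u).1 hu.1).symm.trans hv)⟩

theorem timelikePairs_iff (hρ : C.IsWorldFunction q N ρ) {W : Set (TangentBundle (𝓡 (n + 1)) M)}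
    (hW : W ∈ 𝓝 C.base) (hWN : W ⊆ N) :
    ∀ᶠ p in 𝓝 (x₀, y₀), p ∈ C.timelikePairs W ↔ ρ (chartUV x₀ y₀ p) < 0 := by
  filter_upwards [hρ.connects_iff hW hWN, hρ.connects, hρ.energy] with p h1 ⟨v, w, hv, hw⟩ h3
  rw [h3, hv]
  constructor
  · rintro ⟨v', h5, -, h6⟩
    obtain rfl := TotalSpace.mk_inj_right (((h1 v').1 h5).symm.trans hv)
    exact h6
  · intro h
    exact ⟨v, (h1 v).2 hv, fun u hu => TotalSpace.mk_inj_right (((h1 u).1 hu).symm.trans hv), h⟩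

theorem base_eq_zero (hρ : C.IsWorldFunction q N ρ) : ρ (chartUV x₀ y₀ (x₀, y₀)) = 0 := by
  rw [hρ.energy.self_of_nhds, hρ.base]
  exact C.null.2

theorem differentiableAt (hρ : C.IsWorldFunction q N ρ) :
    ∀ᶠ p in 𝓝 (x₀, y₀), DifferentiableAt ℝ ρ (chartUV x₀ y₀ p) := by
  filter_upwards [hρ.variation] with p ⟨L, hL, _⟩ using hL.differentiableAt

theorem isNull (hρ : C.IsWorldFunction q N ρ) :
    ∀ᶠ p in 𝓝 (x₀, y₀), ρ (chartUV x₀ y₀ p) = 0 →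
      ∀ v : TangentSpace (𝓡 (n + 1)) (C.ιU p.1), q p = ⟨C.ιU p.1, v⟩ → C.g.IsNull v := by
  filter_upwards [hρ.energy, hρ.eventually_ne_zero] with p h1 h2 h3 v hv
  rw [h1, hv] at h3
  exact ⟨h2 v hv, h3⟩

/-- The differential of the world function does not vanish on `Σ`, since lightlike vectors are not
orthogonal to `U`. -/
theorem fderiv_ne_zero (hρ : C.IsWorldFunction q N ρ) :
    ∀ᶠ p in 𝓝 (x₀, y₀), ρ (chartUV x₀ y₀ p) = 0 → fderiv ℝ ρ (chartUV x₀ y₀ p) ≠ 0 := by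
  filter_upwards [hρ.variation, hρ.connects, hρ.isNull] with p ⟨L, hL, h1⟩ ⟨v, w, hv, hw⟩ h2 h3 h4
  obtain ⟨α, hα⟩ := C.causalU.not_orthogonal_of_null p.1 (h2 h3 v hv)
  have h5 := h1 v w hv hw α 0
  rw [← hL.fderiv, h4, map_zero] at h5
  refine hα ?_
  change C.g.flat C.ιU p.1 v α = 0
  simpa using h5

/-- At the zeros of the world function, the connecting geodesic, with any positive rescaling of its
parameter, is a light ray. -/
theorem isLightRay [T2Space M] (hρ : C.IsWorldFunction q N ρ)
    {W : Set (TangentBundle (𝓡 (n + 1)) M)} (hW : W ∈ 𝓝 C.base) :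
    ∀ᶠ p in 𝓝 (x₀, y₀), ρ (chartUV x₀ y₀ p) = 0 →
      ∀ (v : TangentSpace (𝓡 (n + 1)) (C.ιU p.1)) (w : TangentSpace (𝓡 (n + 1)) (C.ιV p.2)),
        q p = ⟨C.ιU p.1, v⟩ → C.g.flow 1 ⟨C.ιU p.1, v⟩ = ⟨C.ιV p.2, w⟩ → ∀ a : ℝ, 0 < a →
          C.IsLightRay W p.1 p.2 (a • v) (a • w) a⁻¹ := by
  filter_upwards [hρ.tendsto.eventually_mem hW, hρ.isNull] with p h1 h2 h3 v w hv hw a ha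
  obtain ⟨h4, h5⟩ := h2 h3 v hv
  refine ⟨inv_pos.2 ha, ?_, ⟨smul_ne_zero ha.ne' h4, C.g.val_smul_self h5 a⟩, ?_⟩
  · rw [smul_smul, inv_mul_cancel₀ ha.ne', one_smul, ← hv]
    exact h1
  · rw [C.complete.flow_smul, mul_inv_cancel₀ ha.ne', hw]

/-- Each light ray is, up to its parametrization, the connecting geodesic of its end points. -/
theorem of_isLightRay [T2Space M] (hρ : C.IsWorldFunction q N ρ) :
    ∀ᶠ p in 𝓝 (x₀, y₀), ∀ (v : TangentSpace (𝓡 (n + 1)) (C.ιU p.1))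
      (w : TangentSpace (𝓡 (n + 1)) (C.ιV p.2)) (s : ℝ), C.IsLightRay N p.1 p.2 v w s →
      q p = ⟨C.ιU p.1, s • v⟩ ∧ C.g.flow 1 ⟨C.ιU p.1, s • v⟩ = ⟨C.ιV p.2, s • w⟩ ∧
        ρ (chartUV x₀ y₀ p) = 0 := by
  filter_upwards [hρ.unique, hρ.energy] with p h1 h2 v w s h
  have h3 : C.g.flow 1 ⟨C.ιU p.1, s • v⟩ = ⟨C.ιV p.2, s • w⟩ := by
    rw [C.complete.flow_smul, mul_one, h.flow]
  have h4 := h1 (s • v) h.mem (congrArg TotalSpace.proj h3)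
  refine ⟨h4, h3, ?_⟩
  rw [h2, h4]
  exact C.g.val_smul_self h.null.2 s

end IsWorldFunction

theorem IsLightRay.mono {W W' : Set (TangentBundle (𝓡 (n + 1)) M)} (hW : W ⊆ W') {x : U} {y : V}
    {v : TangentSpace (𝓡 (n + 1)) (C.ιU x)} {w : TangentSpace (𝓡 (n + 1)) (C.ιV y)} {s : ℝ}
    (h : C.IsLightRay W x y v w s) : C.IsLightRay W' x y v w s :=
  ⟨h.pos, hW h.mem, h.null, h.flow⟩

/-! ### Defining functions and the world function -/

/-- In coordinates, a defining function of `Σ` is smooth, has the sign of the world function and,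
at the zeros of the latter, a nonvanishing differential. -/
theorem IsDefiningFunction.coord {r : U × V → ℝ} (hr : C.IsDefiningFunction r)
    (hρ : C.IsWorldFunction q N ρ) :
    (∀ᶠ c in 𝓝 (chartUV (n := n) x₀ y₀ (x₀, y₀)),
      ContDiffAt ℝ ∞ (r ∘ chartUVSymm (n := n) x₀ y₀) c) ∧
    (∀ᶠ c in 𝓝 (chartUV (n := n) x₀ y₀ (x₀, y₀)), ρ c = 0 →
      (r ∘ chartUVSymm (n := n) x₀ y₀) c = 0 ∧ fderiv ℝ (r ∘ chartUVSymm (n := n) x₀ y₀) c ≠ 0) ∧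
    ∀ᶠ c in 𝓝 (chartUV (n := n) x₀ y₀ (x₀, y₀)),
      (r ∘ chartUVSymm (n := n) x₀ y₀) c < 0 ↔ ρ c < 0 := by
  obtain ⟨hsmooth, N', hN', hr⟩ := hr
  have hW := Filter.inter_mem hN' hρ.nhds
  refine ⟨eventually_contDiffAt_comp_chartUVSymm hsmooth, eventually_chartUV_iff.1 ?_,
    eventually_chartUV_iff.1 ?_⟩
  · filter_upwards [hr _ hW inter_subset_left, hρ.lightPairs_iff hW inter_subset_right,
      eventually_fderiv_comp_chartUVSymm_ne_zero hsmooth,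
      eventually_chartUVSymm_chartUV (n := n) (x₀ := x₀) (y₀ := y₀)] with p h1 h2 h3 h4 h5
    obtain ⟨h6, h7⟩ := h1.1 (h2.2 h5)
    refine ⟨?_, h3 h7⟩
    rw [Function.comp_apply, h4, h6]
  · filter_upwards [hr _ hW inter_subset_left, hρ.timelikePairs_iff hW inter_subset_right,
      eventually_chartUVSymm_chartUV (n := n) (x₀ := x₀) (y₀ := y₀)] with p h1 h2 h3
    rw [Function.comp_apply, h3, h1.2, h2]

/-- Near `(x₀, y₀)`, a defining function of `Σ` and the world function have the same zeros, where
the differential of the former is a positive multiple of that of the latter. -/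
theorem IsDefiningFunction.compare {r : U × V → ℝ} (hr : C.IsDefiningFunction r)
    (hρ : C.IsWorldFunction q N ρ) :
    ∀ᶠ c in 𝓝 (chartUV (n := n) x₀ y₀ (x₀, y₀)),
      ((r ∘ chartUVSymm (n := n) x₀ y₀) c = 0 ↔ ρ c = 0) ∧
      (ρ c = 0 → fderiv ℝ ρ c ≠ 0 ∧
        ∃ κ : ℝ, 0 < κ ∧ fderiv ℝ (r ∘ chartUVSymm (n := n) x₀ y₀) c = κ • fderiv ℝ ρ c) := by
  obtain ⟨h1, h2, h3⟩ := hr.coord hρ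
  have hd := eventually_chartUV_iff (P := DifferentiableAt ℝ ρ).1 hρ.differentiableAt
  have hd0 := eventually_chartUV_iff (P := fun c => ρ c = 0 → fderiv ℝ ρ c ≠ 0).1 hρ.fderiv_ne_zero
  have hne : ∀ᶠ c in 𝓝 (chartUV (n := n) x₀ y₀ (x₀, y₀)),
      fderiv ℝ (r ∘ chartUVSymm (n := n) x₀ y₀) c ≠ 0 := by
    have h5 : ContinuousAt (fderiv ℝ (r ∘ chartUVSymm (n := n) x₀ y₀))
        (chartUV x₀ y₀ (x₀, y₀)) :=
      ((h1.self_of_nhds.of_le (m := 2) (WithTop.coe_le_coe.2 le_top)).fderiv_right (m := 1)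
        (by norm_num)).continuousAt
    exact h5.eventually_ne (h2.self_of_nhds hρ.base_eq_zero).2
  filter_upwards [h1, h2, h3.eventually_nhds, hd, hd0, hne] with c h1 h2 h3 h4 h5 h6
  have hrd := h1.differentiableAt (x := c) (by simp)
  exact ⟨⟨fun h => eq_zero_of_neg_iff hrd h h6 h4.continuousAt h3, fun h => (h2 h).1⟩,
    fun h => ⟨h5 h, exists_fderiv_eq_smul h4 hrd h (h2 h).1 (h5 h) (h2 h).2
      (h3.mono fun c' h' => h'.2)⟩⟩

end LightRaySetup

/-! ### Covectors in coordinates -/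

section Covector

variable {n : ℕ} {U : Type*}
  [TopologicalSpace U] [ChartedSpace (EuclideanSpace ℝ (Fin n)) U] [IsManifold (𝓡 n) ∞ U]

/-- The components of a covector at `x` in the chart at `p`. -/
def covectorCoord (p x : U) (ξ : TangentSpace (𝓡 n) x →L[ℝ] ℝ) : EuclideanSpace ℝ (Fin n) →L[ℝ] ℝ :=
  ContinuousLinearMap.inCoordinates (EuclideanSpace ℝ (Fin n)) (TangentSpace (𝓡 n) : U → Type _) ℝ
    (fun _ : U => ℝ) p x p x ξ

theorem covectorCoord_dChart {p x : U} (hx : x ∈ (extChartAt (𝓡 n) p).source)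
    (ξ : TangentSpace (𝓡 n) x →L[ℝ] ℝ) (a : TangentSpace (𝓡 n) x) :
    covectorCoord p x ξ (dChart p x a) = ξ a := by
  have hx' : x ∈ (chartAt (EuclideanSpace ℝ (Fin n)) p).source := by simpa using hx
  have hb : x ∈ (trivializationAt (EuclideanSpace ℝ (Fin n))
    (TangentSpace (𝓡 n) : U → Type _) p).baseSet := hx'
  rw [covectorCoord, ContinuousLinearMap.inCoordinates_eq hb (mem_univ _)]
  have h1 := ((trivializationAt (EuclideanSpace ℝ (Fin n))
    (TangentSpace (𝓡 n) : U → Type _) p).continuousLinearEquivAt ℝ x hb).symm_apply_apply a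
  have h2 : (trivializationAt (EuclideanSpace ℝ (Fin n))
      (TangentSpace (𝓡 n) : U → Type _) p).continuousLinearEquivAt ℝ x hb a = dChart p x a := by
    rw [dChart, ← TangentBundle.continuousLinearMapAt_trivializationAt hx',
      Trivialization.continuousLinearMapAt_apply, Trivialization.coe_linearMapAt_of_mem _ hb]
    rfl
  rw [h2] at h1
  exact congrArg ξ h1

/-- A covector is determined by its components. -/
theorem covectorCoord_eq_iff {p x : U} (hx : x ∈ (extChartAt (𝓡 n) p).source)
    {ξ : TangentSpace (𝓡 n) x →L[ℝ] ℝ} {η : EuclideanSpace ℝ (Fin n) →L[ℝ] ℝ} :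
    covectorCoord p x ξ = η ↔ ∀ a, ξ a = η (dChart p x a) := by
  refine ⟨fun h a => by rw [← h, covectorCoord_dChart hx], fun h => ?_⟩
  ext u
  obtain ⟨a, rfl⟩ := (dChart_bijective p hx).2 u
  rw [covectorCoord_dChart hx, h]

theorem continuousAt_covectorCoord (p : U) (ξ₀ : TangentSpace (𝓡 n) p →L[ℝ] ℝ) :
    ContinuousAt (fun ζ : CotangentBundle n U => covectorCoord p ζ.1 ζ.2) ⟨p, ξ₀⟩ :=
  ((continuousAt_hom_bundle (RingHom.id ℝ) (x₀ := (⟨p, ξ₀⟩ : CotangentBundle n U)) id).1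
    continuousAt_id).2

theorem continuousAt_cotangent {X : Type*} [TopologicalSpace X] {f : X → CotangentBundle n U}
    {x₀ : X} (h1 : ContinuousAt (fun x => (f x).1) x₀)
    (h2 : ContinuousAt (fun x => covectorCoord (f x₀).1 (f x).1 (f x).2) x₀) :
    ContinuousAt f x₀ :=
  (continuousAt_hom_bundle (RingHom.id ℝ) f).2 ⟨h1, h2⟩

theorem continuousAt_cotangentBundle_proj (ζ : CotangentBundle n U) :
    ContinuousAt (fun ζ : CotangentBundle n U => ζ.1) ζ :=
  ((continuousAt_hom_bundle (RingHom.id ℝ) (x₀ := ζ) id).1 continuousAt_id).1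

end Covector

/-- If the partial derivative of `K` in `x` is bijective, then the solutions `x`, near `x₀`, of
`K(x, p) = K(x₀, p₀)` tend to `x₀` as `p` tends to `p₀`. -/
theorem exists_nhds_solution_mem {X P Y : Type*} [NormedAddCommGroup X] [NormedSpace ℝ X]
    [NormedAddCommGroup P] [NormedSpace ℝ P] [NormedAddCommGroup Y] [NormedSpace ℝ Y]
    [FiniteDimensional ℝ X] [FiniteDimensional ℝ P] [FiniteDimensional ℝ Y] {K : X × P → Y}
    {x₀ : X} {p₀ : P} (hdim : Module.finrank ℝ X = Module.finrank ℝ Y)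
    (hK : ContDiffAt ℝ 1 K (x₀, p₀)) (hinj : ∀ δ, fderiv ℝ K (x₀, p₀) (δ, 0) = 0 → δ = 0) :
    ∃ N ∈ 𝓝 x₀, ∀ O ∈ 𝓝 x₀, ∀ᶠ p in 𝓝 p₀, ∀ x ∈ N, K (x, p) = K (x₀, p₀) → x ∈ O := by
  have : CompleteSpace X := FiniteDimensional.complete ℝ X
  have : CompleteSpace P := FiniteDimensional.complete ℝ P
  have hΦc : ContDiffAt ℝ 1 (fun c : X × P => (K c, c.2)) (x₀, p₀) := hK.prodMk contDiffAt_snd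
  have hΦd := (hK.differentiableAt one_ne_zero).hasFDerivAt.prodMk
    (hasFDerivAt_snd (𝕜 := ℝ) (p := (x₀, p₀)))
  obtain ⟨e, he⟩ := exists_continuousLinearEquiv_of_injective
    (L := (fderiv ℝ K (x₀, p₀)).prod (ContinuousLinearMap.snd ℝ X P))
    ((injective_iff_map_eq_zero _).2 fun c hc => by
      have h1 : c.2 = 0 := congrArg Prod.snd hc
      have h2 : fderiv ℝ K (x₀, p₀) c = 0 := congrArg Prod.fst hc
      have h3 : c = (c.1, 0) := Prod.ext rfl h1
      rw [h3] at h2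
      exact Prod.ext (hinj _ h2) h1) (by
      rw [Module.finrank_prod, Module.finrank_prod, hdim])
  rw [← he] at hΦd
  set Q := hΦc.toOpenPartialHomeomorph _ hΦd one_ne_zero with hQ
  have hsrc : (x₀, p₀) ∈ Q.source := hΦc.mem_toOpenPartialHomeomorph_source hΦd one_ne_zero
  obtain ⟨N, hN, N', hN', hsub⟩ := mem_nhds_prod_iff.1 (Q.open_source.mem_nhds hsrc)
  refine ⟨N, hN, fun O hO => ?_⟩
  have h1 : ContinuousAt (fun p => (Q.symm (K (x₀, p₀), p)).1) p₀ := by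
    have h2 : ContinuousAt Q.symm (K (x₀, p₀), p₀) := Q.symm.continuousAt (Q.map_source hsrc)
    exact (ContinuousAt.comp (g := Q.symm) (x := p₀) h2
      (continuousAt_const.prodMk continuousAt_id)).fst
  have h3 : Q.symm (K (x₀, p₀), p₀) = (x₀, p₀) := Q.left_inv hsrc
  filter_upwards [h1.eventually_mem (by rw [h3]; exact hO), hN'] with p hp hp' x hx hxp
  have h4 : Q.symm (K (x, p), p) = (x, p) := Q.left_inv (hsub ⟨hx, hp'⟩)
  rwa [← hxp, h4] at hp

namespace LightRaySetup

variable {n : ℕ} {U V M : Type*}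
  [TopologicalSpace U] [ChartedSpace (EuclideanSpace ℝ (Fin n)) U] [IsManifold (𝓡 n) ∞ U]
  [TopologicalSpace V] [ChartedSpace (EuclideanSpace ℝ (Fin n)) V] [IsManifold (𝓡 n) ∞ V]
  [TopologicalSpace M] [ChartedSpace (EuclideanSpace ℝ (Fin (n + 1))) M]
  [IsManifold (𝓡 (n + 1)) ∞ M] {x₀ : U} {y₀ : V} (C : LightRaySetup n U V M x₀ y₀)

/-- The restriction to `U` of the covector `g(u, ·)`, in coordinates. -/
def flatCoord (a : EuclideanSpace ℝ (Fin n)) (u : EuclideanSpace ℝ (Fin (n + 1))) :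
    EuclideanSpace ℝ (Fin n) →L[ℝ] ℝ :=
  (C.g.inChart (C.ιU x₀) (C.coordU a) u).comp (fderiv ℝ C.coordU a)

/-- The metric induced on `U`, in coordinates. -/
def inducedCoord (a : EuclideanSpace ℝ (Fin n)) :
    EuclideanSpace ℝ (Fin n) →L[ℝ] EuclideanSpace ℝ (Fin n) →L[ℝ] ℝ :=
  pullbackForm (C.g.inChart (C.ιU x₀) (C.coordU a)) (fderiv ℝ C.coordU a)

variable {C} in
theorem covectorCoord_flat {x : U} (hx : x ∈ (extChartAt (𝓡 n) x₀).source ∧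
    C.ιU x ∈ (extChartAt (𝓡 (n + 1)) (C.ιU x₀)).source) (v : TangentSpace (𝓡 (n + 1)) (C.ιU x)) :
    covectorCoord x₀ x (C.g.flat C.ιU x v) =
      C.flatCoord (extChartAt (𝓡 n) x₀ x) (dChart (C.ιU x₀) (C.ιU x) v) := by
  refine (covectorCoord_eq_iff hx.1).2 fun a => ?_
  change C.g.val (C.ιU x) v (mfderiv (𝓡 n) (𝓡 (n + 1)) C.ιU x a) =
    C.g.inChart (C.ιU x₀) (C.coordU (extChartAt (𝓡 n) x₀ x)) _
      (fderiv ℝ C.coordU (extChartAt (𝓡 n) x₀ x) (dChart x₀ x a))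
  rw [← dChart_mfderiv_ιU hx, coordU_apply hx.1, C.g.inChart_dChart hx.2]

variable {C} in
theorem covectorCoord_induced {x : U} (hx : x ∈ (extChartAt (𝓡 n) x₀).source ∧
    C.ιU x ∈ (extChartAt (𝓡 (n + 1)) (C.ιU x₀)).source) (α : TangentSpace (𝓡 n) x) :
    covectorCoord x₀ x (C.g.induced C.ιU x α) =
      C.inducedCoord (extChartAt (𝓡 n) x₀ x) (dChart x₀ x α) := by
  refine (covectorCoord_flat hx (mfderiv (𝓡 n) (𝓡 (n + 1)) C.ιU x α)).trans ?_
  rw [dChart_mfderiv_ιU hx]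
  rfl

theorem coordU_mem_target : C.coordU (extChartAt (𝓡 n) x₀ x₀) ∈
    (extChartAt (𝓡 (n + 1)) (C.ιU x₀)).target := by
  rw [coordU_apply (mem_extChartAt_source _)]
  exact mem_extChartAt_target _

theorem contDiffAt_inChart_coordU :
    ContDiffAt ℝ 1 (fun a => C.g.inChart (C.ιU x₀) (C.coordU a)) (extChartAt (𝓡 n) x₀ x₀) :=
  ((C.g.contDiffAt_inChart C.coordU_mem_target).comp _ C.contDiffAt_coordU).of_le
    (WithTop.coe_le_coe.2 le_top)

theorem contDiffAt_fderiv_coordU :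
    ContDiffAt ℝ 1 (fderiv ℝ C.coordU) (extChartAt (𝓡 n) x₀ x₀) :=
  C.contDiffAt_coordU.fderiv_right (WithTop.coe_le_coe.2 le_top)

theorem contDiffAt_flatCoord (u : EuclideanSpace ℝ (Fin (n + 1))) :
    ContDiffAt ℝ 1 (fun z : EuclideanSpace ℝ (Fin n) × EuclideanSpace ℝ (Fin (n + 1)) =>
      C.flatCoord z.1 z.2) (extChartAt (𝓡 n) x₀ x₀, u) :=
  ((ContDiffAt.comp (f := Prod.fst) (extChartAt (𝓡 n) x₀ x₀, u) C.contDiffAt_inChart_coordU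
    contDiffAt_fst).clm_apply contDiffAt_snd).clm_comp
    (ContDiffAt.comp (f := Prod.fst) (extChartAt (𝓡 n) x₀ x₀, u) C.contDiffAt_fderiv_coordU
      contDiffAt_fst)

theorem continuousAt_inducedCoord :
    ContinuousAt C.inducedCoord (extChartAt (𝓡 n) x₀ x₀) := by
  have h1 := C.contDiffAt_inChart_coordU.continuousAt
  have h2 := C.contDiffAt_fderiv_coordU.continuousAt
  have h3 : ContinuousAt (fun a => (ContinuousLinearMap.compL ℝ (EuclideanSpace ℝ (Fin n))
    (EuclideanSpace ℝ (Fin (n + 1))) ℝ).flip (fderiv ℝ C.coordU a)) (extChartAt (𝓡 n) x₀ x₀) :=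
    (ContinuousLinearMap.continuous _).continuousAt.comp h2
  exact h3.clm_comp (h1.clm_comp h2)

variable {C} in
theorem isInvertible_inducedCoord {x : U} (hx : x ∈ (extChartAt (𝓡 n) x₀).source ∧
    C.ιU x ∈ (extChartAt (𝓡 (n + 1)) (C.ιU x₀)).source) :
    (C.inducedCoord (extChartAt (𝓡 n) x₀ x)).IsInvertible := by
  refine isInvertible_of_injective ((injective_iff_map_eq_zero _).2 fun u hu => ?_)
  obtain ⟨α, rfl⟩ := (dChart_bijective x₀ hx.1).2 u
  rw [← covectorCoord_induced hx] at hu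
  have h1 : C.g.induced C.ιU x α = 0 := by
    ext b
    exact (covectorCoord_eq_iff hx.1).1 hu b
  rw [C.causalU.induced_injective x (h1.trans (map_zero _).symm), map_zero]

/-- The map `v' ↦ g(v', ·)` from the tangent to the cotangent bundle of `U` is continuous. -/
theorem continuousAt_induced : ContinuousAt (fun z : TangentBundle (𝓡 n) U =>
    (⟨z.1, C.g.induced C.ιU z.1 z.2⟩ : CotangentBundle n U)) ⟨x₀, C.v₀'⟩ := by
  have h0 : (⟨x₀, C.v₀'⟩ : TangentBundle (𝓡 n) U) ∈ (tangentCoord x₀).source :=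
    mem_tangentCoord_source.2 (mem_extChartAt_source _)
  have hcont := (tangentCoord x₀).continuousAt h0
  have hproj : ContinuousAt (fun z : TangentBundle (𝓡 n) U => z.1) ⟨x₀, C.v₀'⟩ :=
    (FiberBundle.continuous_proj (EuclideanSpace ℝ (Fin n))
      (TangentSpace (𝓡 n) : U → Type _)).continuousAt
  refine continuousAt_cotangent hproj ?_
  have h1 : ContinuousAt (fun z : TangentBundle (𝓡 n) U =>
      C.inducedCoord (tangentCoord x₀ z).1 (tangentCoord x₀ z).2) ⟨x₀, C.v₀'⟩ := by
    refine ContinuousAt.clm_apply (ContinuousAt.comp (g := C.inducedCoord) ?_ hcont.fst) hcont.snd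
    rw [tangentCoord_apply (p := x₀) (q := (⟨x₀, C.v₀'⟩ : TangentBundle (𝓡 n) U))
      (mem_extChartAt_source _)]
    exact C.continuousAt_inducedCoord
  refine h1.congr ?_
  filter_upwards [hproj.eventually C.eventually_ιU] with z hz
  rw [covectorCoord_induced hz, tangentCoord_apply hz.1]

end LightRaySetup

namespace LightRaySetup

variable {n : ℕ} {U V M : Type*}
  [TopologicalSpace U] [ChartedSpace (EuclideanSpace ℝ (Fin n)) U] [IsManifold (𝓡 n) ∞ U]
  [TopologicalSpace V] [ChartedSpace (EuclideanSpace ℝ (Fin n)) V] [IsManifold (𝓡 n) ∞ V]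
  [TopologicalSpace M] [ChartedSpace (EuclideanSpace ℝ (Fin (n + 1))) M]
  [IsManifold (𝓡 (n + 1)) ∞ M] {x₀ : U} {y₀ : V} (C : LightRaySetup n U V M x₀ y₀)

/-! ### Light rays with given initial covector -/

/-- By homogeneity, the derivative of the end point in the radial direction is the final
velocity. -/
theorem fderiv_flowUV_coordv₀ [T2Space M] :
    (fderiv ℝ C.flowUV (C.coordU (extChartAt (𝓡 n) x₀ x₀), C.coordv₀) (0, C.coordv₀)).1 =
      dChart (C.ιV y₀) (C.ιV y₀) C.w₀ := by
  set z₀ := (C.coordU (extChartAt (𝓡 n) x₀ x₀), C.coordv₀) with hz₀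
  have hline : HasDerivAt (fun t : ℝ => (C.coordU (extChartAt (𝓡 n) x₀ x₀), t • C.coordv₀))
      (0, C.coordv₀) 1 := by
    have h2 := (hasDerivAt_id (1 : ℝ)).smul_const C.coordv₀
    rw [one_smul] at h2
    exact (hasDerivAt_const (1 : ℝ) (C.coordU (extChartAt (𝓡 n) x₀ x₀))).prodMk h2
  have h1 : (C.coordU (extChartAt (𝓡 n) x₀ x₀), (1 : ℝ) • C.coordv₀) = z₀ := by rw [one_smul]
  have hd : HasDerivAt (fun t : ℝ => (C.flowUV (C.coordU (extChartAt (𝓡 n) x₀ x₀),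
      t • C.coordv₀)).1) (fderiv ℝ C.flowUV z₀ (0, C.coordv₀)).1 1 := by
    have h2 : HasFDerivAt (fun z => (C.flowUV z).1)
        ((ContinuousLinearMap.fst ℝ _ _).comp (fderiv ℝ C.flowUV z₀))
        ((C.coordU (extChartAt (𝓡 n) x₀ x₀), (1 : ℝ) • C.coordv₀)) := by
      rw [h1]
      exact (C.contDiffAt_flowUV.differentiableAt one_ne_zero).hasFDerivAt.fst
    exact h2.comp_hasDerivAt (1 : ℝ) hline
  have hend : C.g.geodesic C.base 1 = C.ιV y₀ := congrArg TotalSpace.proj C.flow_base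
  have hsrc : C.g.geodesic C.base 1 ∈ (extChartAt (𝓡 (n + 1)) (C.ιV y₀)).source := by
    rw [hend]; exact mem_extChartAt_source _
  have hev : (fun t : ℝ => (C.flowUV (C.coordU (extChartAt (𝓡 n) x₀ x₀), t • C.coordv₀)).1)
      =ᶠ[𝓝 1] fun t => extChartAt (𝓡 (n + 1)) (C.ιV y₀) (C.g.geodesic C.base t) := by
    have hgeo := (C.complete.geodesic_spec C.base).1.1.continuous
    filter_upwards [hgeo.continuousAt.eventually_mem
      ((isOpen_extChartAt_source (I := 𝓡 (n + 1)) (C.ιV y₀)).mem_nhds hsrc)] with t ht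
    have h2 : (C.coordU (extChartAt (𝓡 n) x₀ x₀), t • C.coordv₀) =
        tangentCoord (C.ιU x₀) ⟨C.ιU x₀, t • C.v₀⟩ := by
      rw [tangentCoord_apply (q := ⟨C.ιU x₀, t • C.v₀⟩) (mem_extChartAt_source _),
        coordU_apply (mem_extChartAt_source _)]
      exact Prod.ext rfl ((dChart (C.ιU x₀) (C.ιU x₀)).map_smul t C.v₀).symm
    have h3 : (C.g.flow 1 ⟨C.ιU x₀, t • C.v₀⟩).1 = C.g.geodesic C.base t := by
      rw [C.complete.flow_smul, mul_one]
      rfl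
    rw [h2, flowUV, LorentzMetric.flowCoord_tangentCoord (q := ⟨C.ιU x₀, t • C.v₀⟩)
      (mem_extChartAt_source _), tangentCoord_apply (by rw [h3]; exact ht), h3]
  have h4 := dChart_velocity hsrc
    ((C.complete.geodesic_spec C.base).1.1.mdifferentiable (by simp) 1)
  rw [← hev.deriv_eq, hd.deriv] at h4
  rw [← h4]
  change dChart (C.ιV y₀) (C.g.flow 1 C.base).1 (C.g.flow 1 C.base).2 = _
  rw [C.flow_base]

/-- The equations, in coordinates, for the initial velocity `u` of the geodesic segment over `[0,1]`
from `a ∈ U` to `b ∈ V`, the end point `b`, and the number `s` such that `u` induces on `U` the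
covector `s ξ`. -/
def rayEquation (z : (EuclideanSpace ℝ (Fin (n + 1)) × ℝ × EuclideanSpace ℝ (Fin n)) ×
      (EuclideanSpace ℝ (Fin n) × (EuclideanSpace ℝ (Fin n) →L[ℝ] ℝ))) :
    EuclideanSpace ℝ (Fin (n + 1)) × (EuclideanSpace ℝ (Fin n) →L[ℝ] ℝ) × ℝ :=
  ((C.flowUV (C.coordU z.2.1, z.1.1)).1 - C.coordV z.1.2.2,
    C.flatCoord z.2.1 z.1.1 - z.1.2.1 • z.2.2,
    C.g.inChart (C.ιU x₀) (C.coordU z.2.1) z.1.1 z.1.1)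

variable {C} in
/-- The ray equations hold along each light ray; their velocity `u` is that of the ray
reparametrized over `[0,1]`. -/
theorem rayEquation_eq_zero [T2Space M] {W : Set (TangentBundle (𝓡 (n + 1)) M)} {x : U} {y : V}
    {v : TangentSpace (𝓡 (n + 1)) (C.ιU x)} {w : TangentSpace (𝓡 (n + 1)) (C.ιV y)} {s : ℝ}
    (hx : x ∈ (extChartAt (𝓡 n) x₀).source ∧
      C.ιU x ∈ (extChartAt (𝓡 (n + 1)) (C.ιU x₀)).source)
    (hy : y ∈ (extChartAt (𝓡 n) y₀).source ∧
      C.ιV y ∈ (extChartAt (𝓡 (n + 1)) (C.ιV y₀)).source)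
    (h : C.IsLightRay W x y v w s) :
    C.rayEquation ((dChart (C.ιU x₀) (C.ιU x) (s • v), s, extChartAt (𝓡 n) y₀ y),
      (extChartAt (𝓡 n) x₀ x, covectorCoord x₀ x (C.g.flat C.ιU x v))) = 0 := by
  have h1 : (C.coordU (extChartAt (𝓡 n) x₀ x), dChart (C.ιU x₀) (C.ιU x) (s • v)) =
      tangentCoord (C.ιU x₀) ⟨C.ιU x, s • v⟩ := by
    rw [tangentCoord_apply (q := ⟨C.ιU x, s • v⟩) hx.2, coordU_apply hx.1]
  have h2 : C.g.flow 1 ⟨C.ιU x, s • v⟩ = ⟨C.ιV y, s • w⟩ := by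
    rw [C.complete.flow_smul, mul_one, h.flow]
  refine Prod.ext ?_ (Prod.ext ?_ ?_)
  · change (C.flowUV (C.coordU (extChartAt (𝓡 n) x₀ x), _)).1 - C.coordV _ = 0
    rw [h1, flowUV, LorentzMetric.flowCoord_tangentCoord (q := ⟨C.ιU x, s • v⟩) hx.2, h2,
      tangentCoord_apply (q := ⟨C.ιV y, s • w⟩) hy.2, coordV_apply hy.1, sub_self]
  · change C.flatCoord _ _ - s • _ = 0
    rw [← covectorCoord_flat hx, sub_eq_zero]
    refine (covectorCoord_eq_iff hx.1).2 fun a => ?_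
    change C.g.val (C.ιU x) (s • v) _ = s • covectorCoord x₀ x (C.g.flat C.ιU x v) _
    rw [covectorCoord_dChart hx.1, map_smul]
    rfl
  · change C.g.inChart (C.ιU x₀) (C.coordU (extChartAt (𝓡 n) x₀ x)) _ _ = 0
    rw [coordU_apply hx.1, C.g.inChart_dChart hx.2]
    exact C.g.val_smul_self h.null.2 s

variable {C} in
/-- The coordinates of the reference ray, with velocity scaled by `c`. -/
theorem isLightRay_base [T2Space M] {c : ℝ} (hc : 0 < c) :
    C.IsLightRay univ x₀ y₀ (c • C.v₀) (c • C.w₀) c⁻¹ := by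
  refine ⟨inv_pos.2 hc, mem_univ _, ⟨smul_ne_zero hc.ne' C.null.1, C.g.val_smul_self C.null.2 c⟩,
    ?_⟩
  rw [C.complete.flow_smul, mul_inv_cancel₀ hc.ne', C.reach]

theorem contDiffAt_rayEquation [T2Space M] (s : ℝ) (ξ : EuclideanSpace ℝ (Fin n) →L[ℝ] ℝ) :
    ContDiffAt ℝ 1 C.rayEquation ((C.coordv₀, s, extChartAt (𝓡 n) y₀ y₀),
      (extChartAt (𝓡 n) x₀ x₀, ξ)) := by
  set z₀ : (EuclideanSpace ℝ (Fin (n + 1)) × ℝ × EuclideanSpace ℝ (Fin n)) ×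
      (EuclideanSpace ℝ (Fin n) × (EuclideanSpace ℝ (Fin n) →L[ℝ] ℝ)) :=
    ((C.coordv₀, s, extChartAt (𝓡 n) y₀ y₀), (extChartAt (𝓡 n) x₀ x₀, ξ)) with hz₀
  have hu : ContDiffAt ℝ 1 (fun z :
      (EuclideanSpace ℝ (Fin (n + 1)) × ℝ × EuclideanSpace ℝ (Fin n)) ×
      (EuclideanSpace ℝ (Fin n) × (EuclideanSpace ℝ (Fin n) →L[ℝ] ℝ)) => z.1.1) z₀ := by fun_prop
  have hs : ContDiffAt ℝ 1 (fun z :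
      (EuclideanSpace ℝ (Fin (n + 1)) × ℝ × EuclideanSpace ℝ (Fin n)) ×
      (EuclideanSpace ℝ (Fin n) × (EuclideanSpace ℝ (Fin n) →L[ℝ] ℝ)) => z.1.2.1) z₀ := by fun_prop
  have hb : ContDiffAt ℝ 1 (fun z :
      (EuclideanSpace ℝ (Fin (n + 1)) × ℝ × EuclideanSpace ℝ (Fin n)) ×
      (EuclideanSpace ℝ (Fin n) × (EuclideanSpace ℝ (Fin n) →L[ℝ] ℝ)) => z.1.2.2) z₀ := by fun_prop
  have ha : ContDiffAt ℝ 1 (fun z :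
      (EuclideanSpace ℝ (Fin (n + 1)) × ℝ × EuclideanSpace ℝ (Fin n)) ×
      (EuclideanSpace ℝ (Fin n) × (EuclideanSpace ℝ (Fin n) →L[ℝ] ℝ)) => z.2.1) z₀ := by fun_prop
  have hξ : ContDiffAt ℝ 1 (fun z :
      (EuclideanSpace ℝ (Fin (n + 1)) × ℝ × EuclideanSpace ℝ (Fin n)) ×
      (EuclideanSpace ℝ (Fin n) × (EuclideanSpace ℝ (Fin n) →L[ℝ] ℝ)) => z.2.2) z₀ := by fun_prop
  have hi := ContDiffAt.comp (g := C.coordU) z₀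
    (C.contDiffAt_coordU.of_le (WithTop.coe_le_coe.2 le_top)) ha
  have hj := ContDiffAt.comp (g := C.coordV) z₀
    (C.contDiffAt_coordV.of_le (WithTop.coe_le_coe.2 le_top)) hb
  have hG := ContDiffAt.comp (g := fun a => C.g.inChart (C.ιU x₀) (C.coordU a)) z₀
    C.contDiffAt_inChart_coordU ha
  exact ((ContDiffAt.comp (g := C.flowUV) z₀ C.contDiffAt_flowUV (hi.prodMk hu)).fst.sub hj).prodMk
    (((ContDiffAt.comp (g := fun z : EuclideanSpace ℝ (Fin n) × EuclideanSpace ℝ (Fin (n + 1)) =>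
      C.flatCoord z.1 z.2) z₀ (C.contDiffAt_flatCoord _) (ha.prodMk hu)).sub (hs.smul hξ)).prodMk
      ((hG.clm_apply hu).clm_apply hu))

variable {C} in
theorem fderiv_coordU_injective :
    Function.Injective (fderiv ℝ C.coordU (extChartAt (𝓡 n) x₀ x₀)) := by
  refine (injective_iff_map_eq_zero _).2 fun u hu => ?_
  obtain ⟨α, rfl⟩ := (dChart_bijective x₀ (mem_extChartAt_source x₀)).2 u
  rw [← dChart_mfderiv_ιU ⟨mem_extChartAt_source _, mem_extChartAt_source _⟩] at hu
  have h1 := (dChart_bijective (C.ιU x₀) (mem_extChartAt_source (C.ιU x₀))).1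
    (hu.trans (map_zero _).symm)
  have h2 := C.causalU.mfderiv_injective x₀ (h1.trans (map_zero _).symm)
  rw [h2, map_zero]

variable {C} in
theorem fderiv_coordV_injective :
    Function.Injective (fderiv ℝ C.coordV (extChartAt (𝓡 n) y₀ y₀)) := by
  refine (injective_iff_map_eq_zero _).2 fun u hu => ?_
  obtain ⟨β, rfl⟩ := (dChart_bijective y₀ (mem_extChartAt_source y₀)).2 u
  rw [← dChart_mfderiv_ιV ⟨mem_extChartAt_source _, mem_extChartAt_source _⟩] at hu
  have h1 := (dChart_bijective (C.ιV y₀) (mem_extChartAt_source (C.ιV y₀))).1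
    (hu.trans (map_zero _).symm)
  have h2 := C.causalV.mfderiv_injective y₀ (h1.trans (map_zero _).symm)
  rw [h2, map_zero]

theorem coordv₀_notMem_range :
    C.coordv₀ ∉ range (fderiv ℝ C.coordU (extChartAt (𝓡 n) x₀ x₀)) := by
  rintro ⟨u, hu⟩
  obtain ⟨α, rfl⟩ := (dChart_bijective x₀ (mem_extChartAt_source x₀)).2 u
  rw [← dChart_mfderiv_ιU ⟨mem_extChartAt_source _, mem_extChartAt_source _⟩] at hu
  exact C.transversalU ⟨α, (dChart_bijective (C.ιU x₀) (mem_extChartAt_source (C.ιU x₀))).1 hu⟩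

theorem coordw₀_notMem_range : dChart (C.ιV y₀) (C.ιV y₀) C.w₀ ∉
    range (fderiv ℝ C.coordV (extChartAt (𝓡 n) y₀ y₀)) := by
  rintro ⟨u, hu⟩
  obtain ⟨β, rfl⟩ := (dChart_bijective y₀ (mem_extChartAt_source y₀)).2 u
  rw [← dChart_mfderiv_ιV ⟨mem_extChartAt_source _, mem_extChartAt_source _⟩] at hu
  exact C.transversalV ⟨β, (dChart_bijective (C.ιV y₀) (mem_extChartAt_source (C.ιV y₀))).1 hu⟩

/-- The linearized ray equations determine `(δu, δs, δb)`: a variation of the light ray that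
preserves the direction of the initial covector only rescales `u`, by transversality to `U`, so the
end point moves along the ray, and therefore not at all, by transversality to `V`. -/
theorem fderiv_rayEquation_injective [T2Space M] (c : ℝ)
    (δ : EuclideanSpace ℝ (Fin (n + 1)) × ℝ × EuclideanSpace ℝ (Fin n))
    (hδ : fderiv ℝ C.rayEquation ((C.coordv₀, c⁻¹, extChartAt (𝓡 n) y₀ y₀),
      (extChartAt (𝓡 n) x₀ x₀, c • C.flatCoord (extChartAt (𝓡 n) x₀ x₀) C.coordv₀)) (δ, 0) = 0)
    (hc : c ≠ 0) : δ = 0 := by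
  set a₀ := extChartAt (𝓡 n) x₀ x₀ with ha₀
  set b₀ := extChartAt (𝓡 n) y₀ y₀ with hb₀
  set G := C.g.inChart (C.ιU x₀) (C.coordU a₀) with hG
  set ξ := c • C.flatCoord a₀ C.coordv₀ with hξ
  have hK := (C.contDiffAt_rayEquation c⁻¹ ξ).differentiableAt one_ne_zero
  -- the equations as a function of `(u, s, b)`
  have hin : HasFDerivAt (𝕜 := ℝ) (fun x : EuclideanSpace ℝ (Fin (n + 1)) × ℝ ×
      EuclideanSpace ℝ (Fin n) =>
      (x, (a₀, ξ))) _ (C.coordv₀, c⁻¹, b₀) :=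
    (hasFDerivAt_id (𝕜 := ℝ) _).prodMk (hasFDerivAt_const (𝕜 := ℝ) (a₀, ξ) _)
  have hd := hK.hasFDerivAt.comp (C.coordv₀, c⁻¹, b₀) hin
  have hu : HasFDerivAt (𝕜 := ℝ) (fun x : EuclideanSpace ℝ (Fin (n + 1)) × ℝ ×
      EuclideanSpace ℝ (Fin n) =>
      x.1) _ (C.coordv₀, c⁻¹, b₀) := hasFDerivAt_fst
  have hs : HasFDerivAt (𝕜 := ℝ) (fun x : EuclideanSpace ℝ (Fin (n + 1)) × ℝ ×
      EuclideanSpace ℝ (Fin n) =>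
      x.2.1) _ (C.coordv₀, c⁻¹, b₀) := hasFDerivAt_snd.fst
  have hb : HasFDerivAt (𝕜 := ℝ) (fun x : EuclideanSpace ℝ (Fin (n + 1)) × ℝ ×
      EuclideanSpace ℝ (Fin n) =>
      x.2.2) _ (C.coordv₀, c⁻¹, b₀) := hasFDerivAt_snd.snd
  have e1 : (fderiv ℝ C.flowUV (C.coordU a₀, C.coordv₀) (0, δ.1)).1 -
      fderiv ℝ C.coordV b₀ δ.2.2 = 0 := by
    have h1 : HasFDerivAt (𝕜 := ℝ) (fun x : EuclideanSpace ℝ (Fin (n + 1)) × ℝ ×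
      EuclideanSpace ℝ (Fin n) =>
        (C.flowUV (C.coordU a₀, x.1)).1 - C.coordV x.2.2) _ (C.coordv₀, c⁻¹, b₀) :=
      (HasFDerivAt.comp (g := C.flowUV) (C.coordv₀, c⁻¹, b₀)
        (C.contDiffAt_flowUV.differentiableAt one_ne_zero).hasFDerivAt
        ((hasFDerivAt_const (C.coordU a₀) _).prodMk hu)).fst.sub
      (HasFDerivAt.comp (g := C.coordV) (C.coordv₀, c⁻¹, b₀)
        (C.contDiffAt_coordV.differentiableAt (by simp)).hasFDerivAt hb)
    exact (DFunLike.congr_fun (h1.unique hd.fst) δ).trans (congrArg Prod.fst hδ)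
  have e2 : ∀ α, G δ.1 (fderiv ℝ C.coordU a₀ α) - δ.2.1 * ξ α = 0 := fun α => by
    have h1 : HasFDerivAt (𝕜 := ℝ) (fun x : EuclideanSpace ℝ (Fin (n + 1)) × ℝ ×
      EuclideanSpace ℝ (Fin n) =>
        G x.1 (fderiv ℝ C.coordU a₀ α) - x.2.1 * ξ α) _ (C.coordv₀, c⁻¹, b₀) :=
      (((G.flip (fderiv ℝ C.coordU a₀ α)).hasFDerivAt).comp (C.coordv₀, c⁻¹, b₀) hu).sub
        (hs.mul_const (ξ α))
    have h2 := ((ContinuousLinearMap.apply ℝ ℝ α).hasFDerivAt).comp (C.coordv₀, c⁻¹, b₀) hd.snd.fst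
    have h3 := DFunLike.congr_fun (h1.unique h2) δ
    have h4 : ((fderiv ℝ C.rayEquation ((C.coordv₀, c⁻¹, b₀), (a₀, ξ)) (δ, 0)).2.1) α = 0 := by
      rw [hδ]; rfl
    refine Eq.trans ?_ (h3.trans h4)
    change _ = G δ.1 _ - (ξ α) • δ.2.1
    rw [smul_eq_mul, mul_comm]
  have e3 : G C.coordv₀ δ.1 = 0 := by
    have h1 : HasFDerivAt (𝕜 := ℝ) (fun x : EuclideanSpace ℝ (Fin (n + 1)) × ℝ ×
      EuclideanSpace ℝ (Fin n) =>
        G x.1 x.1) _ (C.coordv₀, c⁻¹, b₀) :=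
      (G.hasFDerivAt.comp (C.coordv₀, c⁻¹, b₀) hu).clm_apply hu
    have h3 := (DFunLike.congr_fun (h1.unique hd.snd.snd) δ).trans
      (congrArg (fun z => z.2.2) hδ)
    change G C.coordv₀ δ.1 + G δ.1 C.coordv₀ = 0 at h3
    rw [hG, C.g.inChart_symm (C.ιU x₀) (C.coordU a₀) δ.1 C.coordv₀] at h3
    rw [hG]
    linarith
  have hnull : G C.coordv₀ C.coordv₀ = 0 := by
    rw [hG, coordU_apply (mem_extChartAt_source _), coordv₀,
      C.g.inChart_dChart (mem_extChartAt_source _)]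
    exact C.null.2
  -- `δu = c δs u₀`
  have h1 : G (δ.1 - (c * δ.2.1) • C.coordv₀) = 0 := by
    refine eq_zero_of_hyperplane (by simp) fderiv_coordU_injective C.coordv₀_notMem_range
      (fun α => ?_) ?_
    · have := e2 α
      rw [hξ] at this
      change G δ.1 _ - δ.2.1 * (c * G C.coordv₀ (fderiv ℝ C.coordU a₀ α)) = 0 at this
      rw [map_sub, map_smul]
      change G δ.1 _ - (c * δ.2.1) * G C.coordv₀ (fderiv ℝ C.coordU a₀ α) = 0
      linarith
    · rw [hG, C.g.inChart_symm, ← hG, map_sub, map_smul, e3, hnull, smul_zero, sub_zero]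
  have h2 : δ.1 = (c * δ.2.1) • C.coordv₀ := by
    rw [← sub_eq_zero]
    exact C.g.inChart_eq_zero C.coordU_mem_target fun b => by
      rw [C.g.inChart_symm, ← hG, h1]; rfl
  have h3 : (c * δ.2.1) • dChart (C.ιV y₀) (C.ιV y₀) C.w₀ = fderiv ℝ C.coordV b₀ δ.2.2 := by
    have h4 : ((0 : EuclideanSpace ℝ (Fin (n + 1))), δ.1) = (c * δ.2.1) • (0, C.coordv₀) := by
      rw [h2]; exact Prod.ext (smul_zero _).symm rfl
    rw [← sub_eq_zero, ← e1, h4, map_smul, Prod.smul_fst, C.fderiv_flowUV_coordv₀]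
  have h5 : c * δ.2.1 = 0 := by
    by_contra h0
    refine C.coordw₀_notMem_range ⟨(c * δ.2.1)⁻¹ • δ.2.2, ?_⟩
    rw [map_smul, ← hb₀, ← h3, smul_smul, inv_mul_cancel₀ h0, one_smul]
  rw [h5, zero_smul] at h2 h3
  have h6 : δ.2.2 = 0 := fderiv_coordV_injective (h3.symm.trans (map_zero _).symm)
  exact Prod.ext h2 (Prod.ext ((mul_eq_zero.1 h5).resolve_left hc) h6)

end LightRaySetup

namespace LightRaySetup

variable {n : ℕ} {U V M : Type*}
  [TopologicalSpace U] [ChartedSpace (EuclideanSpace ℝ (Fin n)) U] [IsManifold (𝓡 n) ∞ U]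
  [TopologicalSpace V] [ChartedSpace (EuclideanSpace ℝ (Fin n)) V] [IsManifold (𝓡 n) ∞ V]
  [TopologicalSpace M] [ChartedSpace (EuclideanSpace ℝ (Fin (n + 1))) M]
  [IsManifold (𝓡 (n + 1)) ∞ M] {x₀ : U} {y₀ : V} (C : LightRaySetup n U V M x₀ y₀)

/-- Since `V` is embedded, light rays with initial condition near the reference ray end near
`y₀`. -/
theorem exists_nhds_end_mem [T2Space M] {O : Set V} (hO : O ∈ 𝓝 y₀) :
    ∃ N ∈ 𝓝 C.base, ∀ q ∈ N, ∀ y : V, (C.g.flow 1 q).1 = C.ιV y → y ∈ O := by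
  rw [C.embV.isEmbedding.isInducing.nhds_eq_comap] at hO
  obtain ⟨Q, hQ, hsub⟩ := hO
  have h1 : ContinuousAt (fun q => (C.g.flow 1 q).1) C.base :=
    (FiberBundle.continuous_proj (EuclideanSpace ℝ (Fin (n + 1)))
      (TangentSpace (𝓡 (n + 1)) : M → Type _)).continuousAt.comp C.flowRegularAt_base.continuousAt
  have h2 := h1.eventually_mem (s := Q) (by rw [C.flow_base]; exact hQ)
  exact ⟨_, h2, fun q hq y hy => hsub (by
    change C.ιV y ∈ Q
    rw [← hy]
    exact hq)⟩

/-- The scale `s` in the ray equations depends continuously on the other data: it is the quotient of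
the two covectors at any vector `e` at which the given one does not vanish. -/
theorem continuousAt_flatCoord_div {ξ₀ : EuclideanSpace ℝ (Fin n) →L[ℝ] ℝ}
    {e : EuclideanSpace ℝ (Fin n)} (he : ξ₀ e ≠ 0) :
    ContinuousAt (fun z : EuclideanSpace ℝ (Fin (n + 1)) ×
      (EuclideanSpace ℝ (Fin n) × (EuclideanSpace ℝ (Fin n) →L[ℝ] ℝ)) =>
      C.flatCoord z.2.1 z.1 e / z.2.2 e) (C.coordv₀, (extChartAt (𝓡 n) x₀ x₀, ξ₀)) := by
  have h1 : Tendsto (fun z : EuclideanSpace ℝ (Fin (n + 1)) ×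
      (EuclideanSpace ℝ (Fin n) × (EuclideanSpace ℝ (Fin n) →L[ℝ] ℝ)) => (z.2.1, z.1))
      (𝓝 (C.coordv₀, (extChartAt (𝓡 n) x₀ x₀, ξ₀)))
      (𝓝 (extChartAt (𝓡 n) x₀ x₀, C.coordv₀)) :=
    Continuous.tendsto' (by fun_prop) _ _ rfl
  have h2 : ContinuousAt (fun z : EuclideanSpace ℝ (Fin (n + 1)) ×
      (EuclideanSpace ℝ (Fin n) × (EuclideanSpace ℝ (Fin n) →L[ℝ] ℝ)) => z.2.2 e)
      (C.coordv₀, (extChartAt (𝓡 n) x₀ x₀, ξ₀)) := by fun_prop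
  have h3 : ContinuousAt (fun z : EuclideanSpace ℝ (Fin n) × EuclideanSpace ℝ (Fin (n + 1)) =>
      C.flatCoord z.1 z.2 e) (extChartAt (𝓡 n) x₀ x₀, C.coordv₀) :=
    (C.contDiffAt_flatCoord C.coordv₀).continuousAt.clm_apply continuousAt_const
  have h4 := h3.tendsto.comp h1
  exact Tendsto.div h4 h2.tendsto he

/-- Light rays near the reference ray whose initial covector is close to a positive multiple of the
reference covector end near `y₀`. The neighborhood `N` in which the rays lie does not depend on how
close to `(x₀, y₀)` their end points are required to be. -/
theorem exists_nhds_isLightRay_mem [T2Space M] {c : ℝ} (hc : 0 < c) :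
    ∃ N ∈ 𝓝 C.base, ∀ O ∈ 𝓝 (x₀, y₀),
      ∀ᶠ ζ in 𝓝 (⟨x₀, c • C.g.flat C.ιU x₀ C.v₀⟩ : CotangentBundle n U),
        ∀ (y : V) (v : TangentSpace (𝓡 (n + 1)) (C.ιU ζ.1)) (w : TangentSpace (𝓡 (n + 1)) (C.ιV y))
          (s : ℝ), C.IsLightRay N ζ.1 y v w s → ζ.2 = C.g.flat C.ιU ζ.1 v → (ζ.1, y) ∈ O := by
  set a₀ := extChartAt (𝓡 n) x₀ x₀ with ha₀
  set b₀ := extChartAt (𝓡 n) y₀ y₀ with hb₀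
  have hx₀ : x₀ ∈ (extChartAt (𝓡 n) x₀).source ∧
    C.ιU x₀ ∈ (extChartAt (𝓡 (n + 1)) (C.ιU x₀)).source :=
    ⟨mem_extChartAt_source _, mem_extChartAt_source _⟩
  have hy₀ : y₀ ∈ (extChartAt (𝓡 n) y₀).source ∧
    C.ιV y₀ ∈ (extChartAt (𝓡 (n + 1)) (C.ιV y₀)).source :=
    ⟨mem_extChartAt_source _, mem_extChartAt_source _⟩
  set ξ₀ := c • C.flatCoord a₀ C.coordv₀ with hξ₀
  have hξ : covectorCoord x₀ x₀ (c • C.g.flat C.ιU x₀ C.v₀) = ξ₀ := by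
    refine (covectorCoord_eq_iff hx₀.1).2 fun a => ?_
    rw [hξ₀, coordv₀, ← covectorCoord_flat hx₀]
    change c • C.g.flat C.ιU x₀ C.v₀ a = c • covectorCoord _ _ _ _
    rw [covectorCoord_dChart hx₀.1]
  have hK₀ : C.rayEquation ((C.coordv₀, c⁻¹, b₀), (a₀, ξ₀)) = 0 := by
    have h1 := rayEquation_eq_zero hx₀ hy₀ (isLightRay_base (C := C) hc)
    rw [smul_smul, inv_mul_cancel₀ hc.ne', one_smul] at h1
    rw [← hξ]
    refine Eq.trans ?_ h1
    congr 4
    ext a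
    change c • C.g.val _ C.v₀ _ = C.g.val _ (c • C.v₀) _
    rw [map_smul]
    rfl
  -- the solutions of the ray equations in a fixed neighborhood tend to the reference solution
  obtain ⟨N, hN, hsol⟩ := exists_nhds_solution_mem (K := C.rayEquation)
    (x₀ := (C.coordv₀, c⁻¹, b₀)) (p₀ := (a₀, ξ₀)) (by
      have : Module.finrank ℝ (EuclideanSpace ℝ (Fin n) →L[ℝ] ℝ) = n := by
        rw [← (InnerProductSpace.toDual ℝ (EuclideanSpace ℝ (Fin n))).toLinearEquiv.finrank_eq]
        simp
      simp only [Module.finrank_prod, this, finrank_euclideanSpace, Fintype.card_fin,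
        Module.finrank_self]
      omega)
    (C.contDiffAt_rayEquation _ _) fun δ hδ => C.fderiv_rayEquation_injective c δ hδ hc.ne'
  obtain ⟨Nu, hNu, N', hN', hsub⟩ := mem_nhds_prod_iff.1 hN
  obtain ⟨Ns, hNs, Nb, hNb, hsub'⟩ := mem_nhds_prod_iff.1 hN'
  -- the covector determines `s`
  obtain ⟨α, hα⟩ := C.causalU.not_orthogonal_of_null x₀ C.null
  have hα₀ : C.flatCoord a₀ C.coordv₀ (dChart x₀ x₀ α) ≠ 0 := by
    rw [coordv₀, ← covectorCoord_flat hx₀, covectorCoord_dChart hx₀.1]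
    exact hα
  have hξα : ξ₀ (dChart x₀ x₀ α) ≠ 0 := by
    rw [hξ₀, smul_apply, smul_eq_mul]
    exact mul_ne_zero hc.ne' hα₀
  have hs := C.continuousAt_flatCoord_div hξα
  have hs₀ : C.flatCoord a₀ C.coordv₀ (dChart x₀ x₀ α) / ξ₀ (dChart x₀ x₀ α) = c⁻¹ := by
    rw [hξ₀, smul_apply, smul_eq_mul]
    field_simp
  obtain ⟨Nu', hNu', P, hP, hsub''⟩ := mem_nhds_prod_iff.1 (hs.eventually_mem (s := Ns)
    (by rw [hs₀]; exact hNs))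
  obtain ⟨Nq, hNq, hend⟩ := C.exists_nhds_end_mem (C.eventually_ιV.and
    ((continuousAt_extChartAt (I := 𝓡 n) y₀).eventually_mem hNb))
  have hNq' : ∀ᶠ q in 𝓝 C.base, (tangentCoord (C.ιU x₀) q).2 ∈ Nu ∩ Nu' :=
    ((tangentCoord (C.ιU x₀)).continuousAt C.base_mem_source).snd.eventually_mem (by
      rw [tangentCoord_base]
      exact Filter.inter_mem hNu hNu')
  refine ⟨Nq ∩ {q | (tangentCoord (C.ιU x₀) q).2 ∈ Nu ∩ Nu'}, Filter.inter_mem hNq hNq',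
    fun O hO => ?_⟩
  obtain ⟨Ox, hOx, Oy, hOy, hOsub⟩ := mem_nhds_prod_iff.1 hO
  have hOy' : ∀ᶠ z : EuclideanSpace ℝ (Fin (n + 1)) × ℝ × EuclideanSpace ℝ (Fin n) in
      𝓝 (C.coordv₀, c⁻¹, b₀), (extChartAt (𝓡 n) y₀).symm z.2.2 ∈ Oy := by
    have h1 := continuousAt_extChartAt_symm (I := 𝓡 n) y₀
    have h2 : ContinuousAt (fun z : EuclideanSpace ℝ (Fin (n + 1)) × ℝ ×
      EuclideanSpace ℝ (Fin n) => z.2.2) (C.coordv₀, c⁻¹, b₀) := by fun_prop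
    have h3 := ContinuousAt.comp (x := (C.coordv₀, c⁻¹, b₀)) (g := (extChartAt (𝓡 n) y₀).symm) h1 h2
    exact h3.eventually_mem (by
      change Oy ∈ 𝓝 ((extChartAt (𝓡 n) y₀).symm b₀)
      rwa [hb₀, extChartAt_to_inv])
  have hp : ContinuousAt (fun ζ : CotangentBundle n U =>
      (extChartAt (𝓡 n) x₀ ζ.1, covectorCoord x₀ ζ.1 ζ.2)) ⟨x₀, c • C.g.flat C.ιU x₀ C.v₀⟩ :=
    (ContinuousAt.comp (x := (⟨x₀, c • C.g.flat C.ιU x₀ C.v₀⟩ : CotangentBundle n U))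
      (g := extChartAt (𝓡 n) x₀) (continuousAt_extChartAt x₀)
      (continuousAt_cotangentBundle_proj _)).prodMk
      (continuousAt_covectorCoord x₀ _)
  rw [ContinuousAt, hξ] at hp
  have hproj := continuousAt_cotangentBundle_proj
      (⟨x₀, c • C.g.flat C.ιU x₀ C.v₀⟩ : CotangentBundle n U)
  have hne : ∀ᶠ p : EuclideanSpace ℝ (Fin n) × (EuclideanSpace ℝ (Fin n) →L[ℝ] ℝ) in 𝓝 (a₀, ξ₀),
      p.2 (dChart x₀ x₀ α) ≠ 0 := by
    have h2 : ContinuousAt (fun p : EuclideanSpace ℝ (Fin n) ×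
      (EuclideanSpace ℝ (Fin n) →L[ℝ] ℝ) => p.2 (dChart x₀ x₀ α)) (a₀, ξ₀) := by fun_prop
    exact h2.eventually_ne hξα
  filter_upwards [hp.eventually ((hsol _ hOy').and (hne.and hP)), hproj.eventually_mem hOx,
    hproj.eventually C.eventually_ιU] with ζ ⟨h1, h2, h3⟩ h4 h5 y v w s h hv
  obtain ⟨h6, h7⟩ := hend _ h.mem.1 y (by
    rw [C.complete.flow_smul, mul_one, h.flow])
  have h8 := h.mem.2
  change (tangentCoord (C.ιU x₀) ⟨C.ιU ζ.1, s • v⟩).2 ∈ Nu ∩ Nu' at h8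
  rw [tangentCoord_apply (q := ⟨C.ιU ζ.1, s • v⟩) h5.2] at h8
  have h9 := rayEquation_eq_zero h5 h6 h
  rw [← hv] at h9
  have h10 : s ∈ Ns := by
    have e1 := DFunLike.congr_fun (congrArg (fun z => z.2.1) h9) (dChart x₀ x₀ α)
    change C.flatCoord _ _ _ - s * covectorCoord x₀ ζ.1 ζ.2 (dChart x₀ x₀ α) = 0 at e1
    have e2 : C.flatCoord (extChartAt (𝓡 n) x₀ ζ.1) (dChart (C.ιU x₀) (C.ιU ζ.1) (s • v))
      (dChart x₀ x₀ α) / covectorCoord x₀ ζ.1 ζ.2 (dChart x₀ x₀ α) ∈ Ns :=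
      @hsub'' (_, (_, _)) ⟨h8.2, h3⟩
    rwa [sub_eq_zero.1 e1, mul_div_cancel_right₀ _ h2] at e2
  have h11 := h1 (_, s, _) (hsub ⟨h8.1, hsub' ⟨h10, h7⟩⟩) (h9.trans hK₀.symm)
  refine hOsub ⟨h4, ?_⟩
  change (extChartAt (𝓡 n) y₀).symm (extChartAt (𝓡 n) y₀ y) ∈ Oy at h11
  rwa [(extChartAt (𝓡 n) y₀).left_inv h6.1] at h11

end LightRaySetup

namespace LightRaySetup

section OneSetup

variable {n : ℕ} {U V M : Type*}
  [TopologicalSpace U] [ChartedSpace (EuclideanSpace ℝ (Fin n)) U] [IsManifold (𝓡 n) ∞ U]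
  [TopologicalSpace V] [ChartedSpace (EuclideanSpace ℝ (Fin n)) V] [IsManifold (𝓡 n) ∞ V]
  [TopologicalSpace M] [ChartedSpace (EuclideanSpace ℝ (Fin (n + 1))) M]
  [IsManifold (𝓡 (n + 1)) ∞ M] {x₀ : U} {y₀ : V} {C : LightRaySetup n U V M x₀ y₀}
  {q : U × V → TangentBundle (𝓡 (n + 1)) M} {N : Set (TangentBundle (𝓡 (n + 1)) M)}
  {ρ : EuclideanSpace ℝ (Fin n) × EuclideanSpace ℝ (Fin n) → ℝ}

/-! ### The projected initial velocity -/

/-- The projection to `TU` of the initial velocity of the geodesic from `x` to `y` depends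
continuously on `(x, y)`. -/
theorem IsWorldFunction.exists_tendsto_proj (hρ : C.IsWorldFunction q N ρ) :
    ∃ z : U × V → TangentBundle (𝓡 n) U, Tendsto z (𝓝 (x₀, y₀)) (𝓝 ⟨x₀, C.v₀'⟩) ∧
      ∀ᶠ p in 𝓝 (x₀, y₀), ∃ v' : TangentSpace (𝓡 n) p.1, z p = ⟨p.1, v'⟩ ∧
        ∀ v : TangentSpace (𝓡 (n + 1)) (C.ιU p.1), q p = ⟨C.ιU p.1, v⟩ →
          C.g.induced C.ιU p.1 v' = C.g.flat C.ιU p.1 v := by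
  set a₀ := extChartAt (𝓡 n) x₀ x₀ with ha₀
  have hx₀ : x₀ ∈ (extChartAt (𝓡 n) x₀).source ∧
    C.ιU x₀ ∈ (extChartAt (𝓡 (n + 1)) (C.ιU x₀)).source :=
    ⟨mem_extChartAt_source _, mem_extChartAt_source _⟩
  -- the coordinates of the projection
  set f : EuclideanSpace ℝ (Fin n) × EuclideanSpace ℝ (Fin (n + 1)) →
    EuclideanSpace ℝ (Fin n) × EuclideanSpace ℝ (Fin n) :=
    fun c => (c.1, (C.inducedCoord c.1).inverse (C.flatCoord c.1 c.2)) with hf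
  have hz₀ : (⟨x₀, C.v₀'⟩ : TangentBundle (𝓡 n) U) ∈ (tangentCoord x₀).source :=
    mem_tangentCoord_source.2 hx₀.1
  have hf₀ : f (a₀, C.coordv₀) = tangentCoord x₀ ⟨x₀, C.v₀'⟩ := by
    rw [tangentCoord_apply (q := (⟨x₀, C.v₀'⟩ : TangentBundle (𝓡 n) U)) hx₀.1]
    refine Prod.ext rfl ((isInvertible_inducedCoord hx₀).inverse_apply_eq.2 ?_)
    rw [← covectorCoord_induced hx₀, LorentzMetric.isTangentialProj_iff.1 C.proj,
      covectorCoord_flat hx₀]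
    rfl
  have hinv : ContinuousAt (fun a => (C.inducedCoord a).inverse) a₀ := by
    obtain ⟨e, he⟩ := isInvertible_inducedCoord hx₀
    refine ContinuousAt.comp (g := ContinuousLinearMap.inverse) ?_ C.continuousAt_inducedCoord
    rw [← he]
    exact (contDiffAt_map_inverse (𝕜 := ℝ) (n := 1) e).continuousAt
  have hfc : Tendsto f (𝓝 (a₀, C.coordv₀)) (𝓝 (tangentCoord x₀ ⟨x₀, C.v₀'⟩)) := by
    rw [← hf₀]
    exact continuousAt_fst.prodMk
      ((ContinuousAt.comp (f := Prod.fst) (x := (a₀, C.coordv₀)) hinv continuousAt_fst).clm_apply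
        (C.contDiffAt_flatCoord C.coordv₀).continuousAt)
  have hc : Tendsto (fun p : U × V =>
      (extChartAt (𝓡 n) x₀ p.1, (tangentCoord (C.ιU x₀) (q p)).2)) (𝓝 (x₀, y₀))
      (𝓝 (a₀, C.coordv₀)) := by
    refine Tendsto.prodMk_nhds ?_ ?_
    · exact (continuousAt_extChartAt (I := 𝓡 n) x₀).tendsto.comp continuousAt_fst
    · have h1 := ((tangentCoord (C.ιU x₀)).continuousAt C.base_mem_source).snd
      rw [ContinuousAt, tangentCoord_base] at h1
      exact h1.comp hρ.tendsto
  refine ⟨fun p => (tangentCoord x₀).symm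
    (f (extChartAt (𝓡 n) x₀ p.1, (tangentCoord (C.ιU x₀) (q p)).2)), ?_, ?_⟩
  · have h1 := (tangentCoord x₀).symm.continuousAt ((tangentCoord x₀).map_source hz₀)
    rw [ContinuousAt, (tangentCoord x₀).left_inv hz₀] at h1
    exact h1.comp (hfc.comp hc)
  · filter_upwards [C.eventually_ιU.prod_inl_nhds y₀] with p hp
    have ht := (extChartAt (𝓡 n) x₀).map_source hp.1
    set c := f (extChartAt (𝓡 n) x₀ p.1, (tangentCoord (C.ιU x₀) (q p)).2) with hcdef
    have h1 : ((tangentCoord x₀).symm c).1 = p.1 := by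
      rw [tangentCoord_symm_apply ht]
      exact (extChartAt (𝓡 n) x₀).left_inv hp.1
    obtain ⟨v', hv'⟩ := TotalSpace.exists_eq_mk h1
    refine ⟨v', hv', fun v hv => ?_⟩
    have h2 : tangentCoord x₀ ⟨p.1, v'⟩ = c := by
      rw [← hv']
      exact (tangentCoord x₀).right_inv (mem_tangentCoord_target.2 ht)
    rw [tangentCoord_apply (q := ⟨p.1, v'⟩) hp.1] at h2
    have h3 : dChart x₀ p.1 v' = c.2 := congrArg Prod.snd h2
    have h4 := (isInvertible_inducedCoord hp).inverse_apply_eq.1 h3.symm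
    rw [hv, tangentCoord_apply (q := ⟨C.ιU p.1, v⟩) hp.2, ← covectorCoord_induced hp] at h4
    have h5 := h4.symm.trans (covectorCoord_flat hp v).symm
    ext α
    rw [← covectorCoord_dChart hp.1, h5, covectorCoord_dChart hp.1]

theorem flat_smul (x : U) (v : TangentSpace (𝓡 (n + 1)) (C.ιU x)) (a : ℝ) :
    C.g.flat C.ιU x (a • v) = a • C.g.flat C.ιU x v := by
  ext α
  change C.g.val (C.ιU x) (a • v) _ = a • C.g.val (C.ιU x) v _
  rw [map_smul]
  rfl

theorem flat_smul_ιV (y : V) (w : TangentSpace (𝓡 (n + 1)) (C.ιV y)) (a : ℝ) :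
    C.g.flat C.ιV y (a • w) = a • C.g.flat C.ιV y w := by
  ext α
  change C.g.val (C.ιV y) (a • w) _ = a • C.g.val (C.ιV y) w _
  rw [map_smul]
  rfl

end OneSetup

section TwoSetups

variable {n : ℕ} {U V M₁ M₂ : Type*}
  [TopologicalSpace U] [ChartedSpace (EuclideanSpace ℝ (Fin n)) U] [IsManifold (𝓡 n) ∞ U]
  [TopologicalSpace V] [ChartedSpace (EuclideanSpace ℝ (Fin n)) V] [IsManifold (𝓡 n) ∞ V]
  [TopologicalSpace M₁] [T2Space M₁] [ChartedSpace (EuclideanSpace ℝ (Fin (n + 1))) M₁]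
  [IsManifold (𝓡 (n + 1)) ∞ M₁]
  [TopologicalSpace M₂] [T2Space M₂] [ChartedSpace (EuclideanSpace ℝ (Fin (n + 1))) M₂]
  [IsManifold (𝓡 (n + 1)) ∞ M₂] {x₀ : U} {y₀ : V}
  {C₁ : LightRaySetup n U V M₁ x₀ y₀} {C₂ : LightRaySetup n U V M₂ x₀ y₀}
  {q₁ : U × V → TangentBundle (𝓡 (n + 1)) M₁} {N₁ : Set (TangentBundle (𝓡 (n + 1)) M₁)}
  {q₂ : U × V → TangentBundle (𝓡 (n + 1)) M₂} {N₂ : Set (TangentBundle (𝓡 (n + 1)) M₂)}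
  {ρ₁ ρ₂ : EuclideanSpace ℝ (Fin n) × EuclideanSpace ℝ (Fin n) → ℝ}

/-! ### The scattering relation determines the defining function -/

/-- If the scattering relations agree, pairs joined by a light ray of `C₁` are joined by one of
`C₂`. -/
theorem SameScattering.eq_zero (h : SameScattering C₁ C₂) (h₁ : C₁.IsWorldFunction q₁ N₁ ρ₁)
    (h₂ : C₂.IsWorldFunction q₂ N₂ ρ₂) :
    ∀ᶠ p in 𝓝 (x₀, y₀), ρ₁ (chartUV (n := n) x₀ y₀ p) = 0 →
      ρ₂ (chartUV (n := n) x₀ y₀ p) = 0 := by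
  obtain ⟨N₁', hN₁, N₂', hN₂, h⟩ := h
  obtain ⟨z, hz, hz'⟩ := h₁.exists_tendsto_proj
  have hW₁ := Filter.inter_mem hN₁ h₁.nhds
  have hW₂ := Filter.inter_mem hN₂ h₂.nhds
  filter_upwards [hz.eventually (h _ hW₁ _ hW₂ inter_subset_left inter_subset_left), hz',
    h₁.connects, h₁.isLightRay hW₁, h₂.of_isLightRay]
    with p e1 ⟨v', hv', e2⟩ ⟨v, w, hv, hw⟩ e3 e4 h0
  obtain ⟨w', hw'⟩ := C₁.causalV.induced_surjective p.2 (C₁.g.flat C₁.ιV p.2 w)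
  have e5 := e3 h0 v w hv hw 1 one_pos
  rw [one_smul, one_smul] at e5
  have e6 := e1 ⟨p.2, w'⟩
  rw [hv'] at e6
  obtain ⟨v₂, w₂, s, e7, -, -⟩ := scattering_iff.1
    (e6.1 (scattering_iff.2 ⟨v, w, _, e5, e2 v hv, hw'⟩))
  exact (e4 v₂ w₂ s (e7.mono inter_subset_right)).2.2

theorem SameScattering.exists_eq_mul (h : SameScattering C₁ C₂) {r₁ r₂ : U × V → ℝ}
    (hr₁ : C₁.IsDefiningFunction r₁) (hr₂ : C₂.IsDefiningFunction r₂) :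
    ∃ κ : U × V → ℝ, ∀ᶠ p in 𝓝 (x₀, y₀),
      ContMDiffAt ((𝓡 n).prod (𝓡 n)) 𝓘(ℝ, ℝ) ∞ κ p ∧ κ p ≠ 0 ∧ r₁ p = κ p * r₂ p := by
  obtain ⟨q₁, N₁, ρ₁, h₁⟩ := C₁.exists_isWorldFunction
  obtain ⟨q₂, N₂, ρ₂, h₂⟩ := C₂.exists_isWorldFunction
  obtain ⟨s₁, z₁, -⟩ := hr₁.coord h₁
  obtain ⟨s₂, z₂, -⟩ := hr₂.coord h₂
  obtain ⟨z₁, d₁⟩ := z₁.self_of_nhds h₁.base_eq_zero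
  obtain ⟨z₂, d₂⟩ := z₂.self_of_nhds h₂.base_eq_zero
  obtain ⟨κ, hκ⟩ := exists_smooth_quotient s₂ s₁ z₁ d₁ (by
    filter_upwards [hr₁.compare h₁, hr₂.compare h₂,
      (eventually_chartUV_iff (P := fun c => ρ₁ c = 0 → ρ₂ c = 0)).1
        (SameScattering.eq_zero h h₁ h₂)] with c e1 e2 e3 e4
    exact e2.1.2 (e3 (e1.1.1 e4))) d₂
  refine ⟨fun p => (κ (chartUV (n := n) x₀ y₀ p))⁻¹, ?_⟩
  filter_upwards [eventually_chartUV_iff.2 hκ, eventually_contMDiffAt_chartUV (n := n) (x₀ := x₀)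
    (y₀ := y₀), eventually_chartUVSymm_chartUV (n := n) (x₀ := x₀) (y₀ := y₀)]
    with p ⟨e1, e2, e3⟩ e4 e5
  refine ⟨(e1.inv e2).contMDiffAt.comp p e4, inv_ne_zero e2, ?_⟩
  rw [Function.comp_apply, Function.comp_apply, e5] at e3
  rw [e3, inv_mul_cancel_left₀ e2]

/-! ### The defining function determines the scattering relation -/

/-- Let the world function of `C₂` vanish where that of `C₁` does, with a proportional
differential. By the first variation formula, the light rays of `C₂` then induce the same covectors
on the hypersurfaces as those of `C₁`. -/
theorem IsWorldFunction.exists_isLightRay (h₁ : C₁.IsWorldFunction q₁ N₁ ρ₁)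
    (h₂ : C₂.IsWorldFunction q₂ N₂ ρ₂)
    (h : ∀ᶠ c in 𝓝 (chartUV (n := n) x₀ y₀ (x₀, y₀)), ρ₁ c = 0 →
      ρ₂ c = 0 ∧ ∃ t : ℝ, 0 < t ∧ fderiv ℝ ρ₁ c = t • fderiv ℝ ρ₂ c)
    {W₂ : Set (TangentBundle (𝓡 (n + 1)) M₂)} (hW₂ : W₂ ∈ 𝓝 C₂.base) :
    ∀ᶠ p in 𝓝 (x₀, y₀), ∀ (v : TangentSpace (𝓡 (n + 1)) (C₁.ιU p.1))
      (w : TangentSpace (𝓡 (n + 1)) (C₁.ιV p.2)) (s : ℝ), C₁.IsLightRay N₁ p.1 p.2 v w s →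
      ∃ (v' : TangentSpace (𝓡 (n + 1)) (C₂.ιU p.1)) (w' : TangentSpace (𝓡 (n + 1)) (C₂.ιV p.2))
        (s' : ℝ), C₂.IsLightRay W₂ p.1 p.2 v' w' s' ∧
        C₁.g.flat C₁.ιU p.1 v = C₂.g.flat C₂.ιU p.1 v' ∧
        C₁.g.flat C₁.ιV p.2 w = C₂.g.flat C₂.ιV p.2 w' := by
  filter_upwards [h₁.of_isLightRay, h₁.variation, h₂.variation, h₂.connects, h₂.isLightRay hW₂,
    eventually_chartUV_iff.2 h]
    with p e1 ⟨L₁, hL₁, e2⟩ ⟨L₂, hL₂, e3⟩ ⟨v₂, w₂, hv₂, hw₂⟩ e4 e5 v w s hr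
  obtain ⟨e6, e7, e8⟩ := e1 v w s hr
  obtain ⟨e9, t, ht, e10⟩ := e5 e8
  rw [hL₁.fderiv, hL₂.fderiv] at e10
  have hs := hr.pos
  have key : ∀ α β, s * C₁.g.flat C₁.ιV p.2 w β - s * C₁.g.flat C₁.ιU p.1 v α =
      t * C₂.g.flat C₂.ιV p.2 w₂ β - t * C₂.g.flat C₂.ιU p.1 v₂ α := fun α β => by
    have f1 := e2 _ _ e6 e7 α β
    rw [flat_smul, flat_smul_ιV, e10] at f1
    have f2 := e3 _ _ hv₂ hw₂ α β
    change t * L₂ _ = 2 * (s * C₁.g.flat C₁.ιV p.2 w β - s * C₁.g.flat C₁.ιU p.1 v α) at f1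
    rw [f2] at f1
    linarith
  refine ⟨(t / s) • v₂, (t / s) • w₂, _, e4 e9 v₂ w₂ hv₂ hw₂ _ (div_pos ht hs), ?_, ?_⟩
  · rw [flat_smul]
    ext α
    have := key α 0
    rw [map_zero, map_zero, mul_zero, mul_zero] at this
    change _ = t / s * C₂.g.flat C₂.ιU p.1 v₂ α
    field_simp
    linarith
  · rw [flat_smul_ιV]
    ext β
    have := key 0 β
    rw [map_zero, map_zero, mul_zero, mul_zero] at this
    change _ = t / s * C₂.g.flat C₂.ιV p.2 w₂ β
    field_simp
    linarith

omit [T2Space M₁] [T2Space M₂] in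
/-- With a common defining function, the world functions have the same zeros and at these zeros,
differentials that are positive multiples of each other. -/
theorem IsDefiningFunction.fderiv_eq_smul {r : U × V → ℝ} (hr₁ : C₁.IsDefiningFunction r)
    (hr₂ : C₂.IsDefiningFunction r) (h₁ : C₁.IsWorldFunction q₁ N₁ ρ₁)
    (h₂ : C₂.IsWorldFunction q₂ N₂ ρ₂) :
    ∀ᶠ c in 𝓝 (chartUV (n := n) x₀ y₀ (x₀, y₀)), ρ₁ c = 0 →
      ρ₂ c = 0 ∧ ∃ t : ℝ, 0 < t ∧ fderiv ℝ ρ₁ c = t • fderiv ℝ ρ₂ c := by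
  filter_upwards [hr₁.compare h₁, hr₂.compare h₂] with c ⟨e1, e2⟩ ⟨e3, e4⟩ e5
  have e6 := e3.1 (e1.2 e5)
  obtain ⟨-, a, ha, e7⟩ := e2 e5
  obtain ⟨-, b, hb, e8⟩ := e4 e6
  refine ⟨e6, b / a, div_pos hb ha, ?_⟩
  rw [div_eq_inv_mul, mul_smul, ← e8, e7, smul_smul, inv_mul_cancel₀ ha.ne', one_smul]

/-- The initial covectors of the two reference rays are proportional. -/
theorem exists_flat_eq_smul (h₁ : C₁.IsWorldFunction q₁ N₁ ρ₁) (h₂ : C₂.IsWorldFunction q₂ N₂ ρ₂)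
    (h : ∀ᶠ c in 𝓝 (chartUV (n := n) x₀ y₀ (x₀, y₀)), ρ₁ c = 0 →
      ρ₂ c = 0 ∧ ∃ t : ℝ, 0 < t ∧ fderiv ℝ ρ₁ c = t • fderiv ℝ ρ₂ c) :
    ∃ c : ℝ, 0 < c ∧ C₁.g.flat C₁.ιU x₀ C₁.v₀ = c • C₂.g.flat C₂.ιU x₀ C₂.v₀ := by
  have h3 : C₁.IsLightRay N₁ x₀ y₀ C₁.v₀ C₁.w₀ 1 :=
    ⟨one_pos, by rw [one_smul]; exact mem_of_mem_nhds h₁.nhds, C₁.null, C₁.reach⟩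
  obtain ⟨v', w', s', h4, h5, -⟩ :=
    (h₁.exists_isLightRay h₂ h h₂.nhds).self_of_nhds C₁.v₀ C₁.w₀ 1 h3
  have h6 := (h₂.of_isLightRay.self_of_nhds v' w' s' h4).1
  rw [h₂.base] at h6
  have h7 : C₂.v₀ = s' • v' := TotalSpace.mk_inj_right h6
  refine ⟨s'⁻¹, inv_pos.2 h4.pos, ?_⟩
  rw [h5, h7, flat_smul, smul_smul, inv_mul_cancel₀ h4.pos.ne', one_smul]

/-- A common defining function determines the scattering relation of covectors, as a relation near
`(x₀, y₀)`. -/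
theorem IsDefiningFunction.scatteringSharp_iff {r : U × V → ℝ} (hr₁ : C₁.IsDefiningFunction r)
    (hr₂ : C₂.IsDefiningFunction r) :
    ∃ N₁ ∈ 𝓝 C₁.base, ∃ N₂ ∈ 𝓝 C₂.base, ∀ W₁ ∈ 𝓝 C₁.base, ∀ W₂ ∈ 𝓝 C₂.base,
      W₁ ⊆ N₁ → W₂ ⊆ N₂ → ∀ O ∈ 𝓝 (x₀, y₀),
      ∀ᶠ z in 𝓝 (⟨x₀, C₁.g.induced C₁.ιU x₀ C₁.v₀'⟩ : CotangentBundle n U),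
        ∀ z' : CotangentBundle n V, (C₁.ScatteringSharp W₁ z z' ↔ C₂.ScatteringSharp W₂ z z') ∧
          (C₁.ScatteringSharp W₁ z z' → (z.1, z'.1) ∈ O) := by
  obtain ⟨q₁, N₁, ρ₁, h₁⟩ := C₁.exists_isWorldFunction
  obtain ⟨q₂, N₂, ρ₂, h₂⟩ := C₂.exists_isWorldFunction
  have h12 := hr₁.fderiv_eq_smul hr₂ h₁ h₂
  have h21 := hr₂.fderiv_eq_smul hr₁ h₂ h₁
  obtain ⟨c, hc, hflat⟩ := exists_flat_eq_smul h₁ h₂ h12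
  obtain ⟨N₁', hN₁', end₁⟩ := C₁.exists_nhds_isLightRay_mem one_pos
  obtain ⟨N₂', hN₂', end₂⟩ := C₂.exists_nhds_isLightRay_mem hc
  rw [one_smul] at end₁
  rw [← hflat] at end₂
  rw [LorentzMetric.isTangentialProj_iff.1 C₁.proj]
  refine ⟨_, Filter.inter_mem h₁.nhds hN₁', _, Filter.inter_mem h₂.nhds hN₂',
    fun W₁ hW₁ W₂ hW₂ hWN₁ hWN₂ O hO => ?_⟩
  have hO' := Filter.inter_mem (Filter.inter_mem (h₁.exists_isLightRay h₂ h12 hW₂)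
    (h₂.exists_isLightRay h₁ h21 hW₁)) hO
  filter_upwards [end₁ _ hO', end₂ _ hO'] with z e1 e2 z'
  have f1 : C₁.ScatteringSharp W₁ z z' → C₂.ScatteringSharp W₂ z z' ∧ (z.1, z'.1) ∈ O := by
    intro hS
    obtain ⟨v, w, s, hray, hv, hw⟩ := LightRaySetup.scatteringSharp_iff.1 hS
    obtain ⟨⟨g1, -⟩, g2⟩ := e1 z'.1 v w s (hray.mono fun _ h => (hWN₁ h).2) hv
    obtain ⟨v', w', s', hray', hv', hw'⟩ := g1 v w s (hray.mono fun _ h => (hWN₁ h).1)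
    exact ⟨LightRaySetup.scatteringSharp_iff.2 ⟨v', w', s', hray', hv.trans hv', hw.trans hw'⟩, g2⟩
  refine ⟨⟨fun hS => (f1 hS).1, fun hS => ?_⟩, fun hS => (f1 hS).2⟩
  obtain ⟨v, w, s, hray, hv, hw⟩ := LightRaySetup.scatteringSharp_iff.1 hS
  obtain ⟨⟨-, g1⟩, -⟩ := e2 z'.1 v w s (hray.mono fun _ h => (hWN₂ h).2) hv
  obtain ⟨v', w', s', hray', hv', hw'⟩ := g1 v w s (hray.mono fun _ h => (hWN₂ h).1)
  exact LightRaySetup.scatteringSharp_iff.2 ⟨v', w', s', hray', hv.trans hv', hw.trans hw'⟩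

theorem IsDefiningFunction.sameScatteringSharp {r : U × V → ℝ} (hr₁ : C₁.IsDefiningFunction r)
    (hr₂ : C₂.IsDefiningFunction r) : SameScatteringSharp C₁ C₂ := by
  obtain ⟨N₁, hN₁, N₂, hN₂, h⟩ := hr₁.scatteringSharp_iff hr₂
  exact ⟨N₁, hN₁, N₂, hN₂, fun W₁ hW₁ W₂ hW₂ hWN₁ hWN₂ =>
    (h W₁ hW₁ W₂ hW₂ hWN₁ hWN₂ univ univ_mem).mono fun z hz z' => (hz z').1⟩

theorem IsDefiningFunction.sameScattering {r : U × V → ℝ} (hr₁ : C₁.IsDefiningFunction r)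
    (hr₂ : C₂.IsDefiningFunction r) (hind : SameInduced C₁ C₂) : SameScattering C₁ C₂ := by
  obtain ⟨N₁, hN₁, N₂, hN₂, h⟩ := hr₁.scatteringSharp_iff hr₂
  refine ⟨N₁, hN₁, N₂, hN₂, fun W₁ hW₁ W₂ hW₂ hWN₁ hWN₂ => ?_⟩
  have hproj : ContinuousAt (fun z : TangentBundle (𝓡 n) U => z.1) ⟨x₀, C₁.v₀'⟩ :=
    (FiberBundle.continuous_proj (EuclideanSpace ℝ (Fin n))
      (TangentSpace (𝓡 n) : U → Type _)).continuousAt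
  filter_upwards [C₁.continuousAt_induced.eventually (h W₁ hW₁ W₂ hW₂ hWN₁ hWN₂
    {p | C₁.g.induced C₁.ιV p.2 = C₂.g.induced C₂.ιV p.2} (hind.2.prod_inr_nhds x₀)),
    hproj.eventually hind.1] with z e1 e2 z'
  have s₁ := (scattering_iff (C := C₁) (W := W₁) (z := z) (z' := z')).trans
    (LightRaySetup.scatteringSharp_iff (z := ⟨z.1, C₁.g.induced C₁.ιU z.1 z.2⟩)
      (z' := ⟨z'.1, C₁.g.induced C₁.ιV z'.1 z'.2⟩)).symm
  have s₂ := (scattering_iff (C := C₂) (W := W₂) (z := z) (z' := z')).trans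
    (LightRaySetup.scatteringSharp_iff (z := ⟨z.1, C₂.g.induced C₂.ιU z.1 z.2⟩)
      (z' := ⟨z'.1, C₂.g.induced C₂.ιV z'.1 z'.2⟩)).symm
  rw [← e2] at s₂
  rw [s₁, s₂]
  constructor
  · intro hS
    obtain ⟨f1, f2⟩ := e1 ⟨z'.1, C₁.g.induced C₁.ιV z'.1 z'.2⟩
    have f3 : C₁.g.induced C₁.ιV z'.1 = C₂.g.induced C₂.ιV z'.1 := f2 hS
    rw [← f3]
    exact f1.1 hS
  · intro hS
    obtain ⟨f1, f2⟩ := e1 ⟨z'.1, C₂.g.induced C₂.ιV z'.1 z'.2⟩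
    have f3 : C₁.g.induced C₁.ιV z'.1 = C₂.g.induced C₂.ιV z'.1 := f2 (f1.2 hS)
    rw [f3]
    exact f1.2 hS

end TwoSetups
end LightRaySetup

end

theorem corollary2p1 {n : ℕ} {U V M₁ M₂ : Type*}
    [TopologicalSpace U] [ChartedSpace (EuclideanSpace ℝ (Fin n)) U] [IsManifold (𝓡 n) ∞ U]
    [TopologicalSpace V] [ChartedSpace (EuclideanSpace ℝ (Fin n)) V] [IsManifold (𝓡 n) ∞ V]
    [TopologicalSpace M₁] [T2Space M₁] [ChartedSpace (EuclideanSpace ℝ (Fin (n + 1))) M₁]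
    [IsManifold (𝓡 (n + 1)) ∞ M₁]
    [TopologicalSpace M₂] [T2Space M₂] [ChartedSpace (EuclideanSpace ℝ (Fin (n + 1))) M₂]
    [IsManifold (𝓡 (n + 1)) ∞ M₂] {x₀ : U} {y₀ : V}
    (C₁ : LightRaySetup n U V M₁ x₀ y₀) (C₂ : LightRaySetup n U V M₂ x₀ y₀) :
    (SameScattering C₁ C₂ →
      ∀ r₁ r₂ : U × V → ℝ, C₁.IsDefiningFunction r₁ → C₂.IsDefiningFunction r₂ →
        ∃ κ : U × V → ℝ, ∀ᶠ p in 𝓝 (x₀, y₀),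
          ContMDiffAt ((𝓡 n).prod (𝓡 n)) 𝓘(ℝ, ℝ) ∞ κ p ∧ κ p ≠ 0 ∧ r₁ p = κ p * r₂ p) ∧
    (∀ r : U × V → ℝ, C₁.IsDefiningFunction r → C₂.IsDefiningFunction r →
      SameScatteringSharp C₁ C₂ ∧ (SameInduced C₁ C₂ → SameScattering C₁ C₂)) := by
  exact ⟨fun h _ _ hr₁ hr₂ => LightRaySetup.SameScattering.exists_eq_mul h hr₁ hr₂,
    fun _ hr₁ hr₂ => ⟨hr₁.sameScatteringSharp hr₂, hr₁.sameScattering hr₂⟩⟩
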